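/- Let $\gamma\in\mathbb R$, let $\mathbf Z^2_+=\{(n,m)\in\mathbf Z^2: n,m\ge 0\}$ and $\mathbf V=\{z=N+iM: N,M\in\mathbf Z,\ M\ge |N|\}$; label the points $(n,m)\in\mathbf Z^2_+$ with $n+m$ even by $z=N+iM\in\mathbf V$, $N=(n-m)/2$, $M=(n+m)/2$. A map $f:\mathbf Z^2_+\to\mathbf C$ is a discrete conformal map if for all $(n,m)\in\mathbf Z^2_+$ $$\frac{(f_{n,m}-f_{n+1,m})(f_{n+1,m+1}-f_{n,m+1})}{(f_{n+1,m}-f_{n+1,m+1})(f_{n,m+1}-f_{n,m})}=-1, \qquad (q)$$ and it is an immersion if the interiors of any two elementary quadrilaterals $(f_{n,m},f_{n+1,m},f_{n+1,m+1},f_{n,m+1})$ with a common edge are disjoint. The constraint is, for all $(n,m)\in\mathbf Z^2_+$ (terms with coefficient $2n=0$ or $2m=0$ are absent, the other denominators are nonzero), $$\gamma f_{n,m}=2n\frac{(f_{n+1,m}-f_{n,m})(f_{n,m}-f_{n-1,m})}{f_{n+1,m}-f_{n-1,m}}+2m\frac{(f_{n,m+1}-f_{n,m})(f_{n,m}-f_{n,m-1})}{f_{n,m+1}-f_{n,m-1}}.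 \qquad (c)$$ Consider, for $R:\mathbf V\to\mathbf R_+$ and $z=N+iM$, the equations $$R(z)R(z+1)(-2M-\gamma)+R(z+1)R(z+1+i)(2(N+1)-\gamma)+R(z+1+i)R(z+i)(2(M+1)-\gamma)+R(z+i)R(z)(-2N-\gamma)=0 \qquad (\square)$$ for $z\in\mathbf V_l:=\mathbf V\cup\{-k+i(k-1): k=1,2,\dots\}$, and $$(N+M)\bigl(R(z)^2-R(z+1)R(z-i)\bigr)\bigl(R(z+i)+R(z+1)\bigr)+(M-N)\bigl(R(z)^2-R(z+i)R(z+1)\bigr)\bigl(R(z+1)+R(z-i)\bigr)=0 \qquad (Ri)$$ for $z\in\mathbf V_{int}:=\mathbf V\setminus\{\pm k+ik: k=0,1,2,\dots\}$. (At $z=k+ik$ and at $z=-k+i(k-1)$ exactly one of the four vertices in $(\square)$ is outside of $\mathbf V$; there $(\square)$ is required for every number put for the missing value of $R$, which amounts to $(2(k+1)-\gamma)R(\pm(k+1)+i(k+1))=(2k+\gamma)R(\pm k+ik)$ for $k\ge 0$.) (1) Let $f$ satisfy (q) and (c), with $f_{0,0}=0$, $f_{1,0}=1$, $f_{0,1}=e^{i\alpha}$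 for some $\alpha\in\mathbf R$, and let $f$ be an immersion. Then for every $z\in\mathbf V$ the distances from $f_{n,m}$, where $(n,m)$ is the point labelled by $z$, to those of $f_{n\pm1,m}$, $f_{n,m\pm1}$ whose indices lie in $\mathbf Z^2_+$ are all equal and positive, and their common value $R(z)$ satisfies $(\square)$ on $\mathbf V_l$ and (Ri) on $\mathbf V_{int}$. (2) Conversely, let $R:\mathbf V\to\mathbf R_+$ satisfy $(\square)$ on $\mathbf V_l$ and (Ri) on $\mathbf V_{int}$. Then $R$ defines an immersed circle pattern with the combinatorics of the square grid: there are centers $c(z)$, $z\in\mathbf V$, with $c(0)=0$, unique up to isometries of the plane, such that for the circles $C(z)$ with center $c(z)$ and radius $R(z)$, circles with $|z-z'|=1$ intersect orthogonally, circles with $|z-z'|=\sqrt2$ are tangent and bound disjoint open discs, and no three circles $C(v+e),C(v+ie),C(v-e)$ (with $e^4=1$ and $v,v+e,v+ie,v-e\in\mathbf V$) have a common point. For every such pattern the corresponding map $f$ on $\mathbf Z^2_+$ is well defined, where for $n+m$ even $f_{n,m}$ is the center of the circle with the label of $(n,m)$, and for $n+m$ odd $f_{n,m}$ is the only common point of the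 circles labelled by $(n-1,m)$ and $(n+1,m)$, and of those labelled by $(n,m-1)$ and $(n,m+1)$ (whenever the two points lie in $\mathbf Z^2_+$). This $f$ is a discrete conformal map and an immersion, and if $c(0)=0$ it satisfies (c). -/

import Mathlib

namespace SquareGridPattern

/-! ### Maps on the quadrant `n, m ≥ 0` of the integer lattice

A map `f` on the quadrant is given by a function `ℤ → ℤ → ℂ`; only its values `f n m` with `0 ≤ n` and `0 ≤ m`
are ever used. -/

/-- `f` is a discrete conformal map on the quadrant: every elementary quadrilateral
`f n m, f (n+1) m, f (n+1) (m+1), f n (m+1)` has cross-ratio `-1`.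
(If a denominator vanished, the quotient would be `0` in Lean, so the equation also says that it does not.) -/
def IsDiscreteConformal (f : ℤ → ℤ → ℂ) : Prop :=
  ∀ n m : ℤ, 0 ≤ n → 0 ≤ m →
    ((f n m - f (n + 1) m) * (f (n + 1) (m + 1) - f n (m + 1))) /
      ((f (n + 1) m - f (n + 1) (m + 1)) * (f n (m + 1) - f n m)) = -1

/-- The nonautonomous constraint with parameter `γ`, at all points of the quadrant. A fraction whose coefficient
`2 n` or `2 m` is zero is absent; the denominators of the fractions that are present do not vanish. -/
def SatisfiesConstraint (γ : ℝ) (f : ℤ → ℤ → ℂ) : Prop :=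
  ∀ n m : ℤ, 0 ≤ n → 0 ≤ m →
    (n ≠ 0 → f (n + 1) m - f (n - 1) m ≠ 0) ∧
    (m ≠ 0 → f n (m + 1) - f n (m - 1) ≠ 0) ∧
    (γ : ℂ) * f n m =
      2 * (n : ℂ) * (((f (n + 1) m - f n m) * (f n m - f (n - 1) m)) / (f (n + 1) m - f (n - 1) m)) +
      2 * (m : ℂ) * (((f n (m + 1) - f n m) * (f n m - f n (m - 1))) / (f n (m + 1) - f n (m - 1)))

/-- The elementary quadrilateral at `(n, m)`, as a closed region. (Four points with cross-ratio `-1` lie in this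
cyclic order on a circle or a line, so that the quadrilateral is convex.) -/
def quad (f : ℤ → ℤ → ℂ) (n m : ℤ) : Set ℂ :=
  convexHull ℝ {f n m, f (n + 1) m, f (n + 1) (m + 1), f n (m + 1)}

/-- The interiors of any two elementary quadrilaterals of the quadrant with a common edge are disjoint. -/
def IsImmersion (f : ℤ → ℤ → ℂ) : Prop :=
  ∀ n m : ℤ, 0 ≤ n → 0 ≤ m →
    Disjoint (interior (quad f n m)) (interior (quad f (n + 1) m)) ∧
    Disjoint (interior (quad f n m)) (interior (quad f n (m + 1)))

/-! ### The sublattice `n + m` even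

The point `(n, m)` with `n + m` even is labelled by `z = N + iM`, where `N = (n - m) / 2` and `M = (n + m) / 2`,
that is, `n = N + M` and `m = M - N`. Functions on `V` are given as functions of `N` and `M`; their values outside
of `V` carry no information. -/

/-- `N + iM ∈ V`. -/
def InV (N M : ℤ) : Prop := |N| ≤ M

/-- `N + iM ∈ V ∪ {-k + i(k - 1) : k = 1, 2, …}`. -/
def InVl (N M : ℤ) : Prop := InV N M ∨ ∃ k : ℕ, 1 ≤ k ∧ N = -(k : ℤ) ∧ M = (k : ℤ) - 1

/-- `N + iM ∈ V \ {±k + ik : k = 0, 1, 2, …}`. -/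
def InVint (N M : ℤ) : Prop := InV N M ∧ ¬ ∃ k : ℕ, (N = (k : ℤ) ∨ N = -(k : ℤ)) ∧ M = (k : ℤ)

/-- Left-hand side of the equation on the elementary square `z, z + 1, z + 1 + i, z + i`, where `z = N + iM`. -/
def squareExpr (γ : ℝ) (R : ℤ → ℤ → ℝ) (N M : ℤ) : ℝ :=
  R N M * R (N + 1) M * (-2 * (M : ℝ) - γ) +
  R (N + 1) M * R (N + 1) (M + 1) * (2 * ((N : ℝ) + 1) - γ) +
  R (N + 1) (M + 1) * R N (M + 1) * (2 * ((M : ℝ) + 1) - γ) +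
  R N (M + 1) * R N M * (-2 * (N : ℝ) - γ)

/-- Left-hand side of the equation at `z = N + iM` that involves `z`, `z + 1`, `z + i` and `z - i`. -/
def starExpr (R : ℤ → ℤ → ℝ) (N M : ℤ) : ℝ :=
  ((N : ℝ) + (M : ℝ)) * (R N M ^ 2 - R (N + 1) M * R N (M - 1)) * (R N (M + 1) + R (N + 1) M) +
  ((M : ℝ) - (N : ℝ)) * (R N M ^ 2 - R N (M + 1) * R (N + 1) M) * (R (N + 1) M + R N (M - 1))

/-- The square equation holds at all points of `V_l` for the function `R` on `V`. For `z = k + ik` (`k ≥ 0`) the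
vertex `z + 1`, and for `z = -k + i(k - 1)` (`k ≥ 1`) the vertex `z`, lies outside of `V`; there the equation is
required whatever number is put for the missing value. (At these points the left-hand side is the product of the
sum of the missing and the opposite value with a factor that involves only the two other values, so that one
positive number for the missing value gives the same condition on a positive `R`.) -/
def SatisfiesSquare (γ : ℝ) (R : ℤ → ℤ → ℝ) : Prop :=
  ∀ R' : ℤ → ℤ → ℝ, (∀ N M : ℤ, InV N M → R' N M = R N M) →
    ∀ N M : ℤ, InVl N M → squareExpr γ R' N M = 0

/-- The second radius equation holds at all points of `V_int`. -/
def SatisfiesStar (R : ℤ → ℤ → ℝ) : Prop :=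
  ∀ N M : ℤ, InVint N M → starExpr R N M = 0

/-- `R` is a positive function on `V` and `R z` is the distance from `f n m` to each of the neighbouring points
`f (n+1) m`, `f n (m+1)`, `f (n-1) m`, `f n (m-1)` that belong to the quadrant, where `(n, m)` is the lattice point
with the label `z`. -/
def IsRadiusFunction (f : ℤ → ℤ → ℂ) (R : ℤ → ℤ → ℝ) : Prop :=
  ∀ N M : ℤ, InV N M →
    0 < R N M ∧
    R N M = ‖f (N + M) (M - N) - f (N + M + 1) (M - N)‖ ∧
    R N M = ‖f (N + M) (M - N) - f (N + M) (M - N + 1)‖ ∧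
    (1 ≤ N + M → R N M = ‖f (N + M) (M - N) - f (N + M - 1) (M - N)‖) ∧
    (1 ≤ M - N → R N M = ‖f (N + M) (M - N) - f (N + M) (M - N - 1)‖)

/-! ### Circle patterns -/

/-- The circle `C(z)` with center `c z` and radius `R z`, `z = N + iM`. -/
def circ (c : ℤ → ℤ → ℂ) (R : ℤ → ℤ → ℝ) (N M : ℤ) : Set ℂ :=
  Metric.sphere (c N M) (R N M)

/-- The circles `C(z)`, `z ∈ V`, with centers `c z` and radii `R z` form an immersed circle pattern with the
combinatorics of the square grid. -/
structure IsImmersedPattern (c : ℤ → ℤ → ℂ) (R : ℤ → ℤ → ℝ) : Prop where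
  /-- all radii are positive -/
  pos : ∀ N M : ℤ, InV N M → 0 < R N M
  /-- circles of neighbours, `|z - z'| = 1`, intersect orthogonally -/
  orthogonal : ∀ N M N' M' : ℤ, InV N M → InV N' M' → (N - N') ^ 2 + (M - M') ^ 2 = 1 →
    dist (c N M) (c N' M') ^ 2 = R N M ^ 2 + R N' M' ^ 2
  /-- circles of half-neighbours, `|z - z'| = √2`, are tangent -/
  tangent : ∀ N M N' M' : ℤ, InV N M → InV N' M' → (N - N') ^ 2 + (M - M') ^ 2 = 2 →
    ∃ p : ℂ, circ c R N M ∩ circ c R N' M' = {p}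
  /-- the open discs of tangent circles are disjoint -/
  disjoint_discs : ∀ N M N' M' : ℤ, InV N M → InV N' M' → (N - N') ^ 2 + (M - M') ^ 2 = 2 →
    Disjoint (Metric.ball (c N M) (R N M)) (Metric.ball (c N' M') (R N' M'))
  /-- the pattern does not fold: around `v = N + iM`, three successive neighbours `v + e`, `v + ie`, `v - e`, with
  `e = a + ib` a unit vector of the grid, have circles without a common point, so that the second circle is touched
  by the other two at different points -/
  no_fold : ∀ N M a b : ℤ, a ^ 2 + b ^ 2 = 1 → InV N M →
    InV (N + a) (M + b) → InV (N - b) (M + a) → InV (N - a) (M - b) →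
    circ c R (N + a) (M + b) ∩ circ c R (N - b) (M + a) ∩ circ c R (N - a) (M - b) = ∅

/-- `f` is the discrete conformal map that corresponds to the circle pattern: at the points with `n + m` even it is
the center of the circle; at those with `n + m` odd it is the only common point of the circles of `(n-1, m)` and
`(n+1, m)`, and of the circles of `(n, m-1)` and `(n, m+1)`, whenever the two points belong to the quadrant. -/
def IsMapOfPattern (c : ℤ → ℤ → ℂ) (R : ℤ → ℤ → ℝ) (f : ℤ → ℤ → ℂ) : Prop :=
  ∀ N M : ℤ, InV N M →
    f (N + M) (M - N) = c N M ∧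
    circ c R N M ∩ circ c R (N + 1) (M + 1) = {f (N + M + 1) (M - N)} ∧
    circ c R N M ∩ circ c R (N - 1) (M + 1) = {f (N + M) (M - N + 1)}

end SquareGridPattern

open SquareGridPattern

namespace SquareGridPattern

/-! ### Algebra of the radii -/

/-! Maps and patterns are two readings of one object, a cross field (`IsCrossField`): at every odd
lattice point the surrounding centers lie in the directions `-u`, `-J u`, `u`, `J u`, at distances
equal to the radii, with one square root `J` of `-1` for all points. Equivalently, every elementary
quadrilateral is a right kite and all kites have the same orientation (`IsKiteMap`). A right kite
has cross-ratio `-1`, and neighbouring kites have disjoint interiors exactly when their orientations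
agree. So immersion of the map, like the no-fold condition of a pattern, says that `J` is constant.

In a cross field the right-hand sides of the constraint at odd and even points are explicit
expressions `phi` and `psi` in `u` and the radii. The central identity is `phi_sub_psi`: along an
edge, `phi - psi - γ R u` is `u` times a number whose real component carries the square equation and
whose `J` component carries a relation `UpEq`. Differences of `phi` across an even point detect in
the same way the square equation beyond it and `RightEq`, which is (Ri). Read from left to right,
these identities turn the constraint into the radius equations.

For the converse, (Ri) has to yield `UpEq` and the closing condition `AngleEq`. Two squares with a
common edge carry a vertex equation from one end of the edge to the other, and two vertex equations
at one vertex give `AngleEq`; this propagates from the boundary to all of `V` (`upEq_of_mem`). By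
`AngleEq` a field of directions exists, and the constraint itself integrates it: `g = phi / γ`, `c =
g - R u`. In any other pattern with these radii `γ g - phi` is constant, and it vanishes when the
center at the origin is `0`.

To reach kites from a map, the constraint on the two boundary lines makes consecutive steps equal at
even points and parallel at odd points (`boundary_steps`); with the cross-ratio this starts an
induction over the quadrant. Values of `R` outside of `V` are set to `1`, so that the algebra can
assume a positive function on the whole lattice. -/

/-- The difference quotient `(a - b) / (a + b)`. -/
noncomputable def dq (a b : ℝ) : ℝ := (a - b) / (a + b)

/-- `r` times the cotangent of the sum of the angles with tangents `a / r` and `b / r`. -/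
noncomputable def cq (r a b : ℝ) : ℝ := (r ^ 2 - a * b) / (a + b)

lemma cq_comm (r a b : ℝ) : cq r a b = cq r b a := by
  unfold cq; rw [mul_comm a b, add_comm a b]

lemma dq_neg (a b : ℝ) : dq a b = -dq b a := by
  unfold dq; rw [add_comm b a, ← neg_div, neg_sub]

/-- Multiplication by `2 a` makes the cotangent term affine in `dq a b`. The square equation is
affine in such quotients too, which makes the two kinds of equations comparable. -/
lemma cq_eq {r a b : ℝ} (ha : 0 < a) (hb : 0 < b) :
    2 * a * cq r a b = (r ^ 2 - a ^ 2) + dq a b * (r ^ 2 + a ^ 2) := by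
  unfold cq dq
  have : a + b ≠ 0 := by positivity
  field_simp
  ring

/-- The polynomial is divided by the product of the two diagonal sums of radii. The weights `N + M +
1` and `M - N` are the lattice coordinates of the odd point in the middle of the square. -/
lemma squareExpr_eq_zero_iff {γ : ℝ} {R : ℤ → ℤ → ℝ} (hR : ∀ N M, 0 < R N M) (N M : ℤ) :
    squareExpr γ R N M = 0 ↔
      ((N : ℝ) + M + 1) * dq (R (N + 1) (M + 1)) (R N M) +
        ((M : ℝ) - N) * dq (R N (M + 1)) (R (N + 1) M) = γ - 1 := by
  have h0 := hR N M
  have h1 := hR (N + 1) M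
  have h2 := hR N (M + 1)
  have h3 := hR (N + 1) (M + 1)
  unfold squareExpr dq
  have a : R (N + 1) (M + 1) + R N M ≠ 0 := by positivity
  have b : R N (M + 1) + R (N + 1) M ≠ 0 := by positivity
  rw [← sub_eq_zero (b := γ - 1)]
  have : ((N : ℝ) + M + 1) * ((R (N + 1) (M + 1) - R N M) / (R (N + 1) (M + 1) + R N M)) +
        ((M : ℝ) - N) * ((R N (M + 1) - R (N + 1) M) / (R N (M + 1) + R (N + 1) M)) - (γ - 1)
      = (R N M * R (N + 1) M * (-2 * (M : ℝ) - γ) +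
  R (N + 1) M * R (N + 1) (M + 1) * (2 * ((N : ℝ) + 1) - γ) +
  R (N + 1) (M + 1) * R N (M + 1) * (2 * ((M : ℝ) + 1) - γ) +
  R N (M + 1) * R N M * (-2 * (N : ℝ) - γ)) /
    ((R (N + 1) (M + 1) + R N M) * (R N (M + 1) + R (N + 1) M)) := by
    field_simp
    ring
  rw [this, div_eq_zero_iff]
  simp [a, b]

/-- The equation at a vertex that belongs to the neighbour on the right. -/
def RightEq (R : ℤ → ℤ → ℝ) (N M : ℤ) : Prop :=
  ((N : ℝ) + M) * cq (R N M) (R (N + 1) M) (R N (M - 1)) +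
    ((M : ℝ) - N) * cq (R N M) (R (N + 1) M) (R N (M + 1)) = 0

/-- The equation at a vertex that belongs to the neighbour above. -/
def UpEq (R : ℤ → ℤ → ℝ) (N M : ℤ) : Prop :=
  ((N : ℝ) + M) * cq (R N M) (R N (M + 1)) (R (N - 1) M) =
    ((M : ℝ) - N) * cq (R N M) (R N (M + 1)) (R (N + 1) M)

/-- The equation at a vertex that belongs to the neighbour on the left. -/
def LeftEq (R : ℤ → ℤ → ℝ) (N M : ℤ) : Prop :=
  ((N : ℝ) + M) * cq (R N M) (R (N - 1) M) (R N (M + 1)) +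
    ((M : ℝ) - N) * cq (R N M) (R (N - 1) M) (R N (M - 1)) = 0

/-- The equation at a vertex that belongs to the neighbour below. -/
def DownEq (R : ℤ → ℤ → ℝ) (N M : ℤ) : Prop :=
  ((N : ℝ) + M) * cq (R N M) (R N (M - 1)) (R (N + 1) M) =
    ((M : ℝ) - N) * cq (R N M) (R N (M - 1)) (R (N - 1) M)

/-- Around a vertex the angles of the pattern add up to `2π`. -/
def AngleEq (R : ℤ → ℤ → ℝ) (N M : ℤ) : Prop :=
  cq (R N M) (R (N + 1) M) (R N (M + 1)) + cq (R N M) (R (N - 1) M) (R N (M - 1)) = 0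

/-- The resulting condition is symmetric in the four radii, so the pairing of the neighbours in the
angle equation is immaterial. -/
lemma cq_add_eq_zero_iff {r a b c d : ℝ} (ha : 0 < a) (hb : 0 < b) (hc : 0 < c) (hd : 0 < d) :
    cq r a b + cq r c d = 0 ↔
      r ^ 2 * (a + b + c + d) = a * b * c + a * b * d + a * c * d + b * c * d := by
  unfold cq
  have h1 : a + b ≠ 0 := by positivity
  have h2 : c + d ≠ 0 := by positivity
  rw [div_add_div _ _ h1 h2, div_eq_zero_iff]
  simp only [mul_eq_zero, h1, h2, or_false]
  constructor <;> intro h <;> linear_combination h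

lemma starExpr_eq_zero_iff {R : ℤ → ℤ → ℝ} (hR : ∀ N M, 0 < R N M) (N M : ℤ) :
    starExpr R N M = 0 ↔ RightEq R N M := by
  have h1 := hR (N + 1) M
  have h2 := hR N (M + 1)
  have h5 := hR N (M - 1)
  have a : R (N + 1) M + R N (M - 1) ≠ 0 := by positivity
  have b : R (N + 1) M + R N (M + 1) ≠ 0 := by positivity
  unfold starExpr RightEq cq
  rw [mul_div_assoc', mul_div_assoc', div_add_div _ _ a b, div_eq_zero_iff]
  simp only [mul_eq_zero, a, b, or_false]
  constructor <;> intro h <;> linear_combination h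

/-! ### Propagation of the vertex equations -/

section
variable {γ : ℝ} {R : ℤ → ℤ → ℝ} (hR : ∀ N M, 0 < R N M)
include hR

lemma upEq_iff (N M : ℤ) : UpEq R N M ↔
    2 * (N : ℝ) * (R N M ^ 2 - R N (M + 1) ^ 2) =
      (((M : ℝ) - N) * dq (R N (M + 1)) (R (N + 1) M) -
        ((N : ℝ) + M) * dq (R N (M + 1)) (R (N - 1) M)) * (R N M ^ 2 + R N (M + 1) ^ 2) := by
  have e1 := cq_eq (r := R N M) (hR N (M + 1)) (hR (N - 1) M)
  have e2 := cq_eq (r := R N M) (hR N (M + 1)) (hR (N + 1) M)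
  have h := hR N (M + 1)
  unfold UpEq
  constructor
  · intro H
    linear_combination 2 * R N (M + 1) * H - ((N : ℝ) + M) * e1 + ((M : ℝ) - N) * e2
  · intro H
    refine mul_left_cancel₀ (mul_ne_zero two_ne_zero h.ne') ?_
    linear_combination H + ((N : ℝ) + M) * e1 - ((M : ℝ) - N) * e2

lemma downEq_iff (N M : ℤ) : DownEq R N M ↔
    2 * (N : ℝ) * (R N M ^ 2 - R N (M - 1) ^ 2) =
      (((N : ℝ) + M) * dq (R (N + 1) M) (R N (M - 1)) -
        ((M : ℝ) - N) * dq (R (N - 1) M) (R N (M - 1))) * (R N M ^ 2 + R N (M - 1) ^ 2) := by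
  have e1 := cq_eq (r := R N M) (hR N (M - 1)) (hR (N - 1) M)
  have e2 := cq_eq (r := R N M) (hR N (M - 1)) (hR (N + 1) M)
  have h := hR N (M - 1)
  rw [dq_neg] at e1 e2
  unfold DownEq
  constructor
  · intro H
    linear_combination 2 * R N (M - 1) * H - ((N : ℝ) + M) * e2 + ((M : ℝ) - N) * e1
  · intro H
    refine mul_left_cancel₀ (mul_ne_zero two_ne_zero h.ne') ?_
    linear_combination H + ((N : ℝ) + M) * e2 - ((M : ℝ) - N) * e1

lemma rightEq_iff (N M : ℤ) : RightEq R N M ↔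
    2 * (M : ℝ) * (R N M ^ 2 - R (N + 1) M ^ 2) +
      (((N : ℝ) + M) * dq (R (N + 1) M) (R N (M - 1)) -
        ((M : ℝ) - N) * dq (R N (M + 1)) (R (N + 1) M)) * (R N M ^ 2 + R (N + 1) M ^ 2) = 0 := by
  have e1 := cq_eq (r := R N M) (hR (N + 1) M) (hR N (M - 1))
  have e2 := cq_eq (r := R N M) (hR (N + 1) M) (hR N (M + 1))
  have h := hR (N + 1) M
  rw [dq_neg] at e2
  unfold RightEq
  constructor
  · intro H
    linear_combination 2 * R (N + 1) M * H - ((N : ℝ) + M) * e1 - ((M : ℝ) - N) * e2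
  · intro H
    refine mul_left_cancel₀ (mul_ne_zero two_ne_zero h.ne') ?_
    linear_combination H + ((N : ℝ) + M) * e1 + ((M : ℝ) - N) * e2

lemma leftEq_iff (N M : ℤ) : LeftEq R N M ↔
    2 * (M : ℝ) * (R N M ^ 2 - R (N - 1) M ^ 2) +
      (((M : ℝ) - N) * dq (R (N - 1) M) (R N (M - 1)) -
        ((N : ℝ) + M) * dq (R N (M + 1)) (R (N - 1) M)) * (R N M ^ 2 + R (N - 1) M ^ 2) = 0 := by
  have e1 := cq_eq (r := R N M) (hR (N - 1) M) (hR N (M - 1))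
  have e2 := cq_eq (r := R N M) (hR (N - 1) M) (hR N (M + 1))
  have h := hR (N - 1) M
  rw [dq_neg] at e2
  unfold LeftEq
  constructor
  · intro H
    linear_combination 2 * R (N - 1) M * H - ((N : ℝ) + M) * e2 - ((M : ℝ) - N) * e1
  · intro H
    refine mul_left_cancel₀ (mul_ne_zero two_ne_zero h.ne') ?_
    linear_combination H + ((N : ℝ) + M) * e2 + ((M : ℝ) - N) * e1

/-- The edge from `(N, M)` to `(N, M + 1)` lies on the squares at `(N, M)` and `(N - 1, M)`. In `dq`
form the equations at its two ends agree, up to sign, modulo the difference of these two square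
equations. -/
lemma downEq_of_upEq {N M : ℤ} (h1 : squareExpr γ R N M = 0) (h2 : squareExpr γ R (N - 1) M = 0)
    (h : UpEq R N M) : DownEq R N (M + 1) := by
  rw [squareExpr_eq_zero_iff hR] at h1 h2
  rw [upEq_iff hR] at h
  rw [downEq_iff hR]
  simp only [sub_add_cancel, add_sub_cancel_right] at *
  push_cast at *
  linear_combination (-1 : ℝ) * h - (R N M ^ 2 + R N (M + 1) ^ 2) * (h1 - h2)

lemma leftEq_of_rightEq {N M : ℤ} (h1 : squareExpr γ R N M = 0)
    (h2 : squareExpr γ R N (M - 1) = 0) (h : RightEq R N M) : LeftEq R (N + 1) M := by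
  rw [squareExpr_eq_zero_iff hR] at h1 h2
  rw [rightEq_iff hR] at h
  rw [leftEq_iff hR]
  simp only [sub_add_cancel, add_sub_cancel_right] at *
  push_cast at *
  linear_combination (-1 : ℝ) * h - (R N M ^ 2 + R (N + 1) M ^ 2) * (h1 - h2)

lemma rightEq_of_leftEq {N M : ℤ} (h1 : squareExpr γ R N M = 0)
    (h2 : squareExpr γ R N (M - 1) = 0) (h : LeftEq R (N + 1) M) : RightEq R N M := by
  rw [squareExpr_eq_zero_iff hR] at h1 h2
  rw [leftEq_iff hR] at h
  rw [rightEq_iff hR]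
  simp only [sub_add_cancel, add_sub_cancel_right] at *
  push_cast at *
  linear_combination (-1 : ℝ) * h - (R N M ^ 2 + R (N + 1) M ^ 2) * (h1 - h2)

omit hR in
-- Both equations contain the cotangent of the right and lower neighbours with weight `N + M`.
-- Subtraction leaves `M - N` times the angle equation, hence the condition `N < M`.
lemma angleEq_of_downEq_of_rightEq {N M : ℤ} (hm : N < M) (hd : DownEq R N M)
    (hr : RightEq R N M) : AngleEq R N M := by
  unfold DownEq at hd
  unfold RightEq at hr
  unfold AngleEq
  have hm' : (M : ℝ) - N ≠ 0 := by
    have : (N : ℝ) < M := by exact_mod_cast hm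
    linarith
  rw [cq_comm _ _ (R (N + 1) M)] at hd
  rw [cq_comm _ _ (R (N - 1) M)] at hd
  refine mul_left_cancel₀ hm' ?_
  linear_combination hr - hd

lemma angleEq_iff (N M : ℤ) : AngleEq R N M ↔
    cq (R N M) (R (N + 1) M) (R N (M - 1)) + cq (R N M) (R (N - 1) M) (R N (M + 1)) = 0 := by
  unfold AngleEq
  rw [cq_add_eq_zero_iff, cq_add_eq_zero_iff] <;> try exact hR _ _
  constructor <;> intro h <;> linear_combination h

/-- The angle equation in its other pairing replaces the cotangent of right and lower neighbour by
minus that of left and upper neighbour. -/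
lemma upEq_of_angleEq {N M : ℤ} (ha : AngleEq R N M) (hr : RightEq R N M) : UpEq R N M := by
  have := (angleEq_iff hR N M).1 ha
  unfold RightEq at hr
  unfold UpEq
  rw [cq_comm _ (R N (M + 1)), cq_comm _ (R N (M + 1))]
  linear_combination ((N : ℝ) + M) * this - hr

lemma leftEq_of_angleEq {N M : ℤ} (ha : AngleEq R N M) (hr : RightEq R N M) : LeftEq R N M := by
  have := (angleEq_iff hR N M).1 ha
  unfold AngleEq at ha
  unfold RightEq at hr
  unfold LeftEq
  linear_combination ((N : ℝ) + M) * this + ((M : ℝ) - N) * ha - hr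

variable (hsq : ∀ N M : ℤ, -M - 1 ≤ N → N ≤ M → squareExpr γ R N M = 0)
  (hst : ∀ N M : ℤ, -M < N → N < M → RightEq R N M)
include hsq hst

/-- For `N = M > 0` the weight `M - N` vanishes, and `UpEq` and `LeftEq` become the same condition.
The latter crosses over from (Ri) at the interior vertex to the left, through a boundary square. -/
lemma upEq_right_boundary (k : ℕ) : UpEq R k k := by
  rcases k with _ | k
  · simp [UpEq]
  · have h := leftEq_of_rightEq hR (hsq k (k + 1) (by omega) (by omega))
      (hsq k (k + 1 - 1) (by omega) (by omega)) (hst k (k + 1) (by omega) (by omega))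
    unfold LeftEq at h
    unfold UpEq
    push_cast at *
    rw [cq_comm _ (R _ (_ + 1))]
    linear_combination h

/-- For `N = -M` the weight `N + M` vanishes, and `UpEq` and `RightEq` coincide. One step along the
boundary goes up to the interior vertex `(-k, k + 1)`, where the angle equation becomes available,
and then left; the last crossing uses the square at `(-k - 1, k)`, one of those added in `V_l`. -/
lemma upEq_left_boundary (k : ℕ) : UpEq R (-k) k := by
  induction k with
  | zero => simp [UpEq]
  | succ k ih =>
    have hd := downEq_of_upEq hR (hsq (-k) k (by omega) (by omega))
      (hsq (-k - 1) k (by omega) (by omega)) ih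
    have hr := hst (-k) (k + 1) (by omega) (by omega)
    have hl := leftEq_of_angleEq hR (angleEq_of_downEq_of_rightEq (by omega) hd hr) hr
    have e : (-k : ℤ) = -((k + 1 : ℕ) : ℤ) + 1 := by push_cast; ring
    have e' : (k : ℤ) + 1 = ((k + 1 : ℕ) : ℤ) := by push_cast; ring
    rw [e, e'] at hl
    have h := rightEq_of_leftEq hR (hsq _ _ (by omega) (by omega))
      (hsq _ _ (by omega) (by omega)) hl
    unfold RightEq at h
    unfold UpEq
    push_cast at *
    rw [cq_comm _ (R (_ + 1) _) (R _ (_ + 1))] at h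
    linear_combination (-1 : ℝ) * h

/-- The equations propagate from the boundary to all of `V`. -/
lemma upEq_of_mem (N M : ℤ) (h1 : -M ≤ N) (h2 : N ≤ M) : UpEq R N M := by
  -- Induction up the column of `N`, starting at its lowest vertex in `V`, which lies on the
  -- boundary.
  have key : ∀ j : ℕ, UpEq R N (|N| + j) := by
    intro j
    induction j with
    | zero =>
      rcases abs_cases N with ⟨h, h'⟩ | ⟨h, h'⟩
      · obtain ⟨k, rfl⟩ := Int.eq_ofNat_of_zero_le h'
        simpa using upEq_right_boundary hR hsq hst k
      · obtain ⟨k, hk⟩ := Int.eq_ofNat_of_zero_le (show 0 ≤ -N by omega)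
        obtain rfl : N = -k := by omega
        simpa using upEq_left_boundary hR hsq hst k
    | succ j ih =>
      have hN := neg_abs_le N
      have hN' := le_abs_self N
      have hd := downEq_of_upEq hR (hsq _ _ (by omega) (by omega))
        (hsq _ _ (by omega) (by omega)) ih
      have hr := hst N (|N| + j + 1) (by omega) (by omega)
      have := upEq_of_angleEq hR (angleEq_of_downEq_of_rightEq (by omega) hd hr) hr
      push_cast
      rwa [← add_assoc]
  have := key (M - |N|).toNat
  rwa [Int.toNat_of_nonneg (by rcases abs_cases N with h | h <;> omega), add_sub_cancel] at this

lemma angleEq_of_mem (N M : ℤ) (h1 : -M < N) (h2 : N < M) : AngleEq R N M := by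
  have hd := downEq_of_upEq hR (hsq N (M - 1) (by omega) (by omega))
    (hsq (N - 1) (M - 1) (by omega) (by omega))
    (upEq_of_mem hR hsq hst N (M - 1) (by omega) (by omega))
  rw [sub_add_cancel] at hd
  exact angleEq_of_downEq_of_rightEq h2 hd (hst N M h1 h2)

end

open Complex

/-! ### Right kites -/

/-- `A B C D` is a kite with axis `A C` and right angles at `B` and `D`; its orientation is given by the
square root `J` of `-1`. -/
def Kite (J A B C D : ℂ) : Prop :=
  A ≠ B ∧ ∃ t : ℝ, 0 < t ∧ C - B = J * t * (B - A) ∧ C - D = -(J * t * (D - A))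

lemma eq_I_or_neg_I {J : ℂ} (hJ : J * J = -1) : J = I ∨ J = -I := by
  have : (J - I) * (J + I) = 0 := by linear_combination hJ - I_mul_I
  rcases mul_eq_zero.1 this with h | h
  · exact Or.inl (sub_eq_zero.1 h)
  · exact Or.inr (eq_neg_of_add_eq_zero_left h)

lemma conj_of_sq {J : ℂ} (hJ : J * J = -1) : (starRingEnd ℂ) J = -J := by
  rcases eq_I_or_neg_I hJ with rfl | rfl <;> simp

lemma norm_of_sq {J : ℂ} (hJ : J * J = -1) : ‖J‖ = 1 := by
  rcases eq_I_or_neg_I hJ with rfl | rfl <;> simp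

lemma ne_zero_of_sq {J : ℂ} (hJ : J * J = -1) : J ≠ 0 := by
  rintro rfl; simp at hJ

lemma re_of_sq {J : ℂ} (hJ : J * J = -1) : J.re = 0 := by
  rcases eq_I_or_neg_I hJ with rfl | rfl <;> simp

lemma im_of_sq {J : ℂ} (hJ : J * J = -1) : J.im ≠ 0 := by
  rcases eq_I_or_neg_I hJ with rfl | rfl <;> simp

/-- Real and imaginary parts with respect to a square root `J` of `-1`. -/
lemma add_mul_eq_zero_iff {J : ℂ} (hJ : J * J = -1) (x y : ℝ) :
    (x : ℂ) + J * y = 0 ↔ x = 0 ∧ y = 0 := by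
  rw [Complex.ext_iff]
  simp [re_of_sq hJ, im_of_sq hJ]

lemma add_mul_ne_zero {J : ℂ} (hJ : J * J = -1) {x : ℝ} (hx : x ≠ 0) (y : ℝ) :
    (x : ℂ) + J * y ≠ 0 := fun h => hx ((add_mul_eq_zero_iff hJ x y).1 h).1

lemma sub_mul_ne_zero {J : ℂ} (hJ : J * J = -1) {x : ℝ} (hx : x ≠ 0) (y : ℝ) :
    (x : ℂ) - J * y ≠ 0 := by
  have := add_mul_ne_zero hJ hx (-y)
  push_cast at this
  rwa [mul_neg, ← sub_eq_add_neg] at this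

lemma norm_add_mul {J : ℂ} (hJ : J * J = -1) (x y : ℝ) : ‖(x : ℂ) + J * y‖ ^ 2 = x ^ 2 + y ^ 2 := by
  rw [← Complex.normSq_eq_norm_sq, Complex.normSq_apply]
  rcases eq_I_or_neg_I hJ with rfl | rfl <;> simp <;> ring

namespace Kite

variable {J A B C D : ℂ} (hJ : J * J = -1)
include hJ

lemma swap (h : Kite J A B C D) : Kite (-J) A D C B := by
  obtain ⟨hAB, t, ht, h1, h2⟩ := h
  refine ⟨?_, t, ht, by linear_combination h2, by linear_combination h1⟩
  rintro rfl
  have := mul_ne_zero (add_mul_ne_zero hJ one_ne_zero t) (sub_ne_zero.2 hAB)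
  apply this
  push_cast
  linear_combination h1 - h2

lemma flip (h : Kite J A B C D) : Kite (-J) C B A D := by
  obtain ⟨hAB, t, ht, h1, h2⟩ := h
  have ht' : (t : ℂ) ≠ 0 := by exact_mod_cast ht.ne'
  refine ⟨?_, t⁻¹, by positivity, ?_, ?_⟩
  · rintro rfl
    have := mul_ne_zero (mul_ne_zero (ne_zero_of_sq hJ) ht') (sub_ne_zero.2 hAB.symm)
    apply this
    linear_combination -h1
  · push_cast
    field_simp
    linear_combination (-J) * h1 - t * (B - A) * hJ
  · push_cast
    field_simp
    linear_combination J * h2 - t * (D - A) * hJ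

lemma rot (h : Kite J A B C D) : Kite J C D A B := by
  simpa using (h.flip hJ).swap (by linear_combination hJ)

lemma norm_left (h : Kite J A B C D) : ‖B - A‖ = ‖D - A‖ := by
  obtain ⟨hAB, t, ht, h1, h2⟩ := h
  -- Both sides are `C - A`; the two factors are conjugate and have the same modulus.
  have e : ((1 : ℝ) + J * t) * (B - A) = ((1 : ℝ) + J * ((-t : ℝ))) * (D - A) := by
    push_cast
    linear_combination h2 - h1
  have e' := congrArg (fun x => ‖x‖ ^ 2) e
  simp only [norm_mul, mul_pow, norm_add_mul hJ] at e'
  have : 0 < (1 : ℝ) ^ 2 + t ^ 2 := by positivity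
  have e2 : ‖B - A‖ ^ 2 = ‖D - A‖ ^ 2 := by
    refine mul_left_cancel₀ this.ne' ?_
    rw [e']; ring
  exact (pow_left_inj₀ (norm_nonneg _) (norm_nonneg _) two_ne_zero).1 e2

lemma crossRatio (h : Kite J A B C D) :
    ((A - B) * (C - D)) / ((B - C) * (D - A)) = -1 := by
  have hD := (h.swap hJ).1
  have hC := (h.flip hJ).1
  obtain ⟨hAB, t, ht, h1, h2⟩ := h
  rw [div_eq_iff (mul_ne_zero (sub_ne_zero.2 hC.symm) (sub_ne_zero.2 hD.symm))]
  linear_combination (A - B) * h2 - (D - A) * h1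

/-- A kite lies on one side of each of its edges. -/
lemma nonneg_of_mem (h : Kite J A B C D) {x : ℂ} (hx : x ∈ convexHull ℝ {A, B, C, D}) :
    0 ≤ ((x - A) * (starRingEnd ℂ) (J * (B - A))).re := by
  have hconv : Convex ℝ {x : ℂ | 0 ≤ ((x - A) * (starRingEnd ℂ) (J * (B - A))).re} := by
    intro x hx y hy a b ha hb hab
    simp only [Set.mem_ofPred_eq] at *
    have : a • x + b • y - A = a • (x - A) + b • (y - A) := by
      simp only [real_smul]
      have : (a : ℂ) + b = 1 := by exact_mod_cast hab
      linear_combination A * this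
    rw [this, add_mul, smul_mul_assoc, smul_mul_assoc, add_re, real_smul, real_smul, re_ofReal_mul,
      re_ofReal_mul]
    positivity
  refine convexHull_min ?_ hconv hx
  obtain ⟨hAB, t, ht, h1, h2⟩ := h
  have hp : 0 ≤ ‖B - A‖ ^ 2 := by positivity
  -- In the coordinates `p + J q` with origin `A` and unit `B - A`, the tested real part is `q * ‖B
  -- - A‖ ^ 2`.
  have key : ∀ p q : ℝ, ∀ y : ℂ, y - A = (p + J * q) * (B - A) → 0 ≤ q →
      0 ≤ ((y - A) * (starRingEnd ℂ) (J * (B - A))).re := by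
    intro p q y hy hq
    have : (y - A) * (starRingEnd ℂ) (J * (B - A)) =
        ((‖B - A‖ ^ 2 * q : ℝ) : ℂ) - J * ((‖B - A‖ ^ 2 * p : ℝ) : ℂ) := by
      rw [hy, map_mul, conj_of_sq hJ]
      have := Complex.mul_conj' (B - A)
      push_cast
      linear_combination (p + J * q) * (-J) * this - q * ‖B - A‖ ^ 2 * hJ
    rw [this]
    simp [re_of_sq hJ]
    rw [← ofReal_pow, ofReal_re, ofReal_im]
    simpa using mul_nonneg hp hq
  intro y hy
  simp only [Set.mem_insert_iff, Set.mem_singleton_iff] at hy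
  rcases hy with rfl | rfl | rfl | rfl
  · simp
  · exact key 1 0 _ (by push_cast; ring) le_rfl
  · exact key 1 t _ (by push_cast; linear_combination h1) ht.le
  -- `D` is the mirror image of `B` in the axis `A C`, so its coordinate is `(1 + J t) ^ 2 / (1 + t
  -- ^ 2)`.
  · refine key ((1 - t ^ 2) / (1 + t ^ 2)) (2 * t / (1 + t ^ 2)) _ ?_ (by positivity)
    have h3 : (1 : ℂ) + t ^ 2 ≠ 0 := by
      have : (1 : ℝ) + t ^ 2 ≠ 0 := by positivity
      exact_mod_cast this
    push_cast
    field_simp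
    linear_combination (1 + J * t) * (h1 - h2) + (t ^ 2 * (y - A) + t ^ 2 * (B - A)) * hJ

omit hJ in
lemma disjoint_interior_of_separated {s t : Set ℂ} {A w : ℂ} (hw : w ≠ 0)
    (hs : ∀ x ∈ s, 0 ≤ ((x - A) * w).re) (ht : ∀ x ∈ t, ((x - A) * w).re ≤ 0) :
    Disjoint (interior s) (interior t) := by
  rw [Set.disjoint_iff_inter_eq_empty, Set.eq_empty_iff_forall_notMem]
  intro x hx
  obtain ⟨ε, hε, hb⟩ := Metric.isOpen_iff.1 (isOpen_interior.inter isOpen_interior) x hx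
  have hw' : 0 < ‖w‖ := norm_pos_iff.2 hw
  -- A shift by `d` times the conjugate of `w` raises the separating functional by `d * ‖w‖ ^ 2` and
  -- stays inside the ball.
  set d : ℝ := ε / 2 / ‖w‖ with hd
  have hdp : 0 < d := by positivity
  have hmem : x + d * (starRingEnd ℂ) w ∈ Metric.ball x ε := by
    rw [Metric.mem_ball, dist_eq, add_sub_cancel_left, norm_mul, RCLike.norm_conj, norm_real,
      Real.norm_of_nonneg hdp.le, hd, div_mul_cancel₀ _ hw'.ne']
    linarith
  have h1 := ht _ (interior_subset (hb hmem).2)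
  have h2 := hs _ (interior_subset hx.1)
  have e : (x + d * (starRingEnd ℂ) w - A) * w = (x - A) * w + ((d * ‖w‖ ^ 2 : ℝ) : ℂ) := by
    have := Complex.mul_conj' w
    push_cast
    linear_combination d * this
  rw [e, add_re, ofReal_re] at h1
  have : 0 < d * ‖w‖ ^ 2 := by positivity
  linarith

lemma disjoint_interior {C' D' : ℂ} (h : Kite J A B C D) (h' : Kite (-J) A B C' D') :
    Disjoint (interior (convexHull ℝ {A, B, C, D})) (interior (convexHull ℝ {A, B, C', D'})) := by
  have hw : (starRingEnd ℂ) (J * (B - A)) ≠ 0 := by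
    rw [map_ne_zero]
    exact mul_ne_zero (ne_zero_of_sq hJ) (sub_ne_zero.2 h.1.symm)
  refine disjoint_interior_of_separated hw (fun x hx => h.nonneg_of_mem hJ hx) fun x hx => ?_
  have := h'.nonneg_of_mem (by linear_combination hJ) hx
  simp only [neg_mul, map_neg, mul_neg, neg_re] at this
  linarith

omit hJ in
-- With origin `B` and unit `B - A`, the vertices `A`, `B`, `C` have coordinates `-1`, `0`, `J t`,
-- and the point `x + J y` has the barycentric weights `-x`, `1 + x - y / t`, `y / t`.
lemma triangle_subset {S : Set ℂ} (hA : A ∈ S) (hB : B ∈ S) {t : ℝ} (ht : 0 < t)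
    (hC : B + J * t * (B - A) ∈ S) {x y : ℝ} (hx : x < 0) (hy : 0 < y) (hxy : -x + y / t < 1) :
    B + (x + J * y) * (B - A) ∈ convexHull ℝ S := by
  have h1 := (convex_convexHull ℝ S).sum_mem (t := Finset.univ)
    (w := ![1 + x - y / t, -x, y / t]) (z := ![B, A, B + J * t * (B - A)])
    (by
      have := div_pos hy ht
      intro i _
      fin_cases i <;> simp <;> linarith)
    (by simp [Fin.sum_univ_three]; ring)
    (by intro i _; fin_cases i <;> simp <;> exact subset_convexHull ℝ S (by assumption))
  convert h1 using 1
  simp only [Fin.sum_univ_three, real_smul, Matrix.cons_val]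
  push_cast
  have : (t : ℂ) ≠ 0 := by exact_mod_cast ht.ne'
  field_simp
  ring

/-- Two kites on the same side of a common edge overlap. -/
lemma not_disjoint_interior {C' D' : ℂ} (h : Kite J A B C D) (h' : Kite J A B C' D') :
    ¬ Disjoint (interior (convexHull ℝ {A, B, C, D})) (interior (convexHull ℝ {A, B, C', D'})) := by
  obtain ⟨hAB, t, ht, h1, -⟩ := h
  obtain ⟨-, t', ht', h1', -⟩ := h'
  have hBA : B - A ≠ 0 := sub_ne_zero.2 hAB.symm
  -- The intersection of the open right triangles `A B C` and `A B C'`, written in the coordinate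
  -- with origin `B` and unit `B - A`.
  set O : Set ℂ := {z | ((z - B) / (B - A)).re < 0 ∧ 0 < (-J * ((z - B) / (B - A))).re ∧
    -((z - B) / (B - A)).re + (-J * ((z - B) / (B - A))).re / t < 1 ∧
    -((z - B) / (B - A)).re + (-J * ((z - B) / (B - A))).re / t' < 1} with hO
  have hopen : IsOpen O := by
    refine (isOpen_lt ?_ ?_).and ((isOpen_lt ?_ ?_).and ((isOpen_lt ?_ ?_).and (isOpen_lt ?_ ?_)))
    all_goals fun_prop
  have hdec : ∀ z : ℂ, z = B + ((((z - B) / (B - A)).re : ℝ) +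
      J * ((-J * ((z - B) / (B - A))).re : ℝ)) * (B - A) := by
    intro z
    have e : ((((z - B) / (B - A)).re : ℝ) : ℂ) + J * ((-J * ((z - B) / (B - A))).re : ℝ) =
        (z - B) / (B - A) := by
      rcases eq_I_or_neg_I hJ with rfl | rfl <;> apply Complex.ext <;> simp
    rw [e, div_mul_cancel₀ _ hBA]
    ring
  have hsub : O ⊆ convexHull ℝ {A, B, C, D} := by
    rintro z ⟨a, b, c, -⟩
    rw [hdec z]
    refine triangle_subset (by simp) (by simp) ht ?_ a b c
    rw [← h1]; simp
  have hsub' : O ⊆ convexHull ℝ {A, B, C', D'} := by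
    rintro z ⟨a, b, -, c⟩
    rw [hdec z]
    refine triangle_subset (by simp) (by simp) ht' ?_ a b c
    rw [← h1']; simp
  rw [Set.not_disjoint_iff]
  -- The point `-1/2 + J y` lies in both triangles, since `1/2 + y / t` and `1/2 + y / t'` are at
  -- most `3/4`.
  set y : ℝ := min t t' / 4
  have hy : 0 < y := by positivity
  refine ⟨B + (((-1 / 2 : ℝ) : ℂ) + J * (y : ℝ)) * (B - A), interior_maximal hsub hopen ?_,
    interior_maximal hsub' hopen ?_⟩
  all_goals
    have e1 : (B + (((-1 / 2 : ℝ) : ℂ) + J * (y : ℝ)) * (B - A) - B) / (B - A) =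
        ((-1 / 2 : ℝ) : ℂ) + J * (y : ℝ) := by
      rw [add_sub_cancel_left, mul_div_cancel_right₀ _ hBA]
    have e2 : -J * (((-1 / 2 : ℝ) : ℂ) + J * (y : ℝ)) = (y : ℂ) + J * ((1 / 2 : ℝ) : ℂ) := by
      push_cast
      linear_combination (-y : ℂ) * hJ
    have e3 : ∀ p q : ℝ, ((p : ℂ) + J * q).re = p := by intro p q; simp [re_of_sq hJ]
    have l1 : y ≤ t / 4 := by simp only [y]; gcongr; exact min_le_left _ _
    have l2 : y ≤ t' / 4 := by simp only [y]; gcongr; exact min_le_right _ _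
    have l3 : y / t ≤ 1 / 4 := by rw [div_le_iff₀ ht]; linarith
    have l4 : y / t' ≤ 1 / 4 := by rw [div_le_iff₀ ht']; linarith
    simp only [hO, Set.mem_ofPred_eq, e1, e2, e3]
    refine ⟨by norm_num, hy, by linarith, by linarith⟩

end Kite

/-! ### Maps that consist of right kites -/

/-- The elementary quadrilateral at `(n, m)` is a right kite of orientation `J` with an axis that joins
the two vertices with even sum of the indices. -/
def QuadKite (J : ℂ) (f : ℤ → ℤ → ℂ) (n m : ℤ) : Prop :=
  (Even (n + m) → Kite J (f n m) (f (n + 1) m) (f (n + 1) (m + 1)) (f n (m + 1))) ∧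
    (¬ Even (n + m) → Kite J (f (n + 1) m) (f (n + 1) (m + 1)) (f n (m + 1)) (f n m))

/-- All elementary quadrilaterals of `f` are right kites of orientation `J`. -/
def IsKiteMap (J : ℂ) (f : ℤ → ℤ → ℂ) : Prop :=
  ∀ n m : ℤ, 0 ≤ n → 0 ≤ m → QuadKite J f n m

lemma quad_eq_of_insert_eq (f : ℤ → ℤ → ℂ) (n m : ℤ) {A B C D : ℂ}
    (h : ({A, B, C, D} : Set ℂ) = {f n m, f (n + 1) m, f (n + 1) (m + 1), f n (m + 1)}) :
    quad f n m = convexHull ℝ {A, B, C, D} := by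
  unfold quad; rw [h]

section
variable {J J' : ℂ} {f : ℤ → ℤ → ℂ} (hJ : J * J = -1) (hJ' : J' * J' = -1)
include hJ

lemma QuadKite.crossRatio {n m : ℤ} (h : QuadKite J f n m) :
    ((f n m - f (n + 1) m) * (f (n + 1) (m + 1) - f n (m + 1))) /
      ((f (n + 1) m - f (n + 1) (m + 1)) * (f n (m + 1) - f n m)) = -1 := by
  by_cases he : Even (n + m)
  · exact (h.1 he).crossRatio hJ
  · have := (h.2 he).crossRatio hJ
    rw [← inv_div, mul_comm (f n m - f (n + 1) m), this]
    norm_num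

include hJ'

/-- The kites at two horizontal neighbours, seen from their common edge. -/
lemma QuadKite.right {n m : ℤ} (h : QuadKite J f n m) (h' : QuadKite J' f (n + 1) m) :
    ∃ A B C D C' D' σ : ℂ, (σ = 1 ∨ σ = -1) ∧ Kite (σ * J) A B C D ∧ Kite (-(σ * J')) A B C' D' ∧
      quad f n m = convexHull ℝ {A, B, C, D} ∧
      quad f (n + 1) m = convexHull ℝ {A, B, C', D'} := by
  -- Bringing the common edge into the position `A B` may require a reflection of the vertex order,
  -- which reverses the orientation; `σ` records this. For `J' = J` the two kites then lie on
  -- opposite sides of the edge.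
  by_cases he : Even (n + m)
  · have k1 := (h.1 he).flip hJ
    have k2 := (h'.2 (by grind)).rot hJ'
    refine ⟨_, _, _, _, _, _, -1, Or.inr rfl, by simpa using k1, by simpa using k2,
      quad_eq_of_insert_eq _ _ _ ?_, quad_eq_of_insert_eq _ _ _ ?_⟩
    all_goals (ext; simp; try tauto)
  · have k1 := h.2 he
    have k2 := (h'.1 (by grind)).swap hJ'
    refine ⟨_, _, _, _, _, _, 1, Or.inl rfl, by simpa using k1, by simpa using k2,
      quad_eq_of_insert_eq _ _ _ ?_, quad_eq_of_insert_eq _ _ _ ?_⟩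
    all_goals (ext; simp; try tauto)

/-- The kites at two vertical neighbours, seen from their common edge. -/
lemma QuadKite.up {n m : ℤ} (h : QuadKite J f n m) (h' : QuadKite J' f n (m + 1)) :
    ∃ A B C D C' D' σ : ℂ, (σ = 1 ∨ σ = -1) ∧ Kite (σ * J) A B C D ∧ Kite (-(σ * J')) A B C' D' ∧
      quad f n m = convexHull ℝ {A, B, C, D} ∧
      quad f n (m + 1) = convexHull ℝ {A, B, C', D'} := by
  by_cases he : Even (n + m)
  · have k1 := (h.1 he).rot hJ
    have k2 := (h'.2 (by grind)).swap hJ'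
    refine ⟨_, _, _, _, _, _, 1, Or.inl rfl, by simpa using k1, by simpa using k2,
      quad_eq_of_insert_eq _ _ _ ?_, quad_eq_of_insert_eq _ _ _ ?_⟩
    all_goals (ext; simp; try tauto)
  · have k1 := ((h.2 he).rot hJ).swap hJ
    have k2 := h'.1 (by grind)
    refine ⟨_, _, _, _, _, _, -1, Or.inr rfl, by simpa using k1, by simpa using k2,
      quad_eq_of_insert_eq _ _ _ ?_, quad_eq_of_insert_eq _ _ _ ?_⟩
    all_goals (ext; simp; try tauto)

omit hJ'

lemma sq_of_sign {σ : ℂ} (hσ : σ = 1 ∨ σ = -1) : σ * J * (σ * J) = -1 := by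
  rcases hσ with rfl | rfl <;> simp [hJ]

lemma IsKiteMap.isDiscreteConformal (h : IsKiteMap J f) : IsDiscreteConformal f :=
  fun n m hn hm => (h n m hn hm).crossRatio hJ

lemma IsKiteMap.isImmersion (h : IsKiteMap J f) : IsImmersion f := by
  intro n m hn hm
  constructor
  · obtain ⟨A, B, C, D, C', D', σ, hσ, k1, k2, e1, e2⟩ :=
      (h n m hn hm).right hJ hJ (h (n + 1) m (by omega) hm)
    rw [e1, e2]
    exact k1.disjoint_interior (sq_of_sign hJ hσ) k2
  · obtain ⟨A, B, C, D, C', D', σ, hσ, k1, k2, e1, e2⟩ :=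
      (h n m hn hm).up hJ hJ (h n (m + 1) hn (by omega))
    rw [e1, e2]
    exact k1.disjoint_interior (sq_of_sign hJ hσ) k2

include hJ'

/-- With opposite orientations both kites would lie on the same side of their common edge and
overlap. -/
lemma eq_of_disjoint {A B C D C' D' σ : ℂ} (hσ : σ = 1 ∨ σ = -1) (k1 : Kite (σ * J) A B C D)
    (k2 : Kite (-(σ * J')) A B C' D')
    (hd : Disjoint (interior (convexHull ℝ {A, B, C, D})) (interior (convexHull ℝ {A, B, C', D'}))) :
    J' = J := by
  by_contra hne
  have : J' = -J := by
    rcases eq_I_or_neg_I hJ with rfl | rfl <;> rcases eq_I_or_neg_I hJ' with rfl | rfl <;> simp_all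
  subst this
  rw [mul_neg, neg_neg] at k2
  exact k1.not_disjoint_interior (sq_of_sign hJ hσ) k2 hd

omit hJ hJ'

/-- In an immersion all kites have the same orientation. -/
lemma IsImmersion.exists_isKiteMap (hf : IsImmersion f)
    (h : ∀ n m : ℤ, 0 ≤ n → 0 ≤ m → ∃ J, J * J = -1 ∧ QuadKite J f n m) :
    ∃ J, J * J = -1 ∧ IsKiteMap J f := by
  obtain ⟨J, hJ, h0⟩ := h 0 0 le_rfl le_rfl
  have hrow : ∀ n : ℕ, QuadKite J f n 0 := by
    intro n
    induction n with
    | zero => exact h0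
    | succ n ih =>
      obtain ⟨J', hJ', h'⟩ := h (n + 1) 0 (by omega) le_rfl
      obtain ⟨A, B, C, D, C', D', σ, hσ, k1, k2, e1, e2⟩ := ih.right hJ hJ' h'
      have hd := (hf n 0 (by omega) le_rfl).1
      rw [e1, e2] at hd
      obtain rfl := eq_of_disjoint hJ hJ' hσ k1 k2 hd
      exact_mod_cast h'
  have hall : ∀ n m : ℕ, QuadKite J f n m := by
    intro n m
    induction m with
    | zero => exact_mod_cast hrow n
    | succ m ih =>
      obtain ⟨J', hJ', h'⟩ := h n (m + 1) (by omega) (by omega)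
      obtain ⟨A, B, C, D, C', D', σ, hσ, k1, k2, e1, e2⟩ := ih.up hJ hJ' h'
      have hd := (hf n m (by omega) (by omega)).2
      rw [e1, e2] at hd
      obtain rfl := eq_of_disjoint hJ hJ' hσ k1 k2 hd
      exact_mod_cast h'
  refine ⟨J, hJ, fun n m hn hm => ?_⟩
  lift n to ℕ using hn
  lift m to ℕ using hm
  exact hall n m

end

/-! ### Crosses -/

/-- The circles with centers `c` and radii `R` meet at the points `g N M` in crosses: the centers with the
labels `z`, `z + 1`, `z + 1 + i`, `z + i` lie in the directions `-u`, `-J u`, `u`, `J u` from `g z`. -/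
structure IsCrossField (J : ℂ) (R : ℤ → ℤ → ℝ) (c g u : ℤ → ℤ → ℂ) : Prop where
  norm : ∀ N M : ℤ, -M - 1 ≤ N → N ≤ M → ‖u N M‖ = 1
  base : ∀ N M : ℤ, -M ≤ N → N ≤ M → c N M = g N M - R N M * u N M
  right : ∀ N M : ℤ, -M - 1 ≤ N → N + 1 ≤ M → c (N + 1) M = g N M - J * R (N + 1) M * u N M
  diag : ∀ N M : ℤ, -M - 1 ≤ N → N ≤ M →
    c (N + 1) (M + 1) = g N M + R (N + 1) (M + 1) * u N M
  top : ∀ N M : ℤ, -M - 1 ≤ N → N ≤ M → c N (M + 1) = g N M + J * R N (M + 1) * u N M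

/-- The directions at neighbouring points are related by the reflections in the edges of the pattern. -/
structure IsDirection (J : ℂ) (R : ℤ → ℤ → ℝ) (u : ℤ → ℤ → ℂ) : Prop where
  norm : ∀ N M : ℤ, -M - 1 ≤ N → N ≤ M → ‖u N M‖ = 1
  vert : ∀ N M : ℤ, -M ≤ N → N ≤ M →
    u (N - 1) M * (R N (M + 1) + J * R N M) = u N M * (R N M + J * R N (M + 1))
  horiz : ∀ N M : ℤ, -M ≤ N → N + 1 ≤ M →
    u N (M - 1) * (R (N + 1) M - J * R N M) = u N M * (R N M - J * R (N + 1) M)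

lemma IsDirection.ne_zero {J : ℂ} {R : ℤ → ℤ → ℝ} {u : ℤ → ℤ → ℂ} (h : IsDirection J R u) {N M : ℤ}
    (h1 : -M - 1 ≤ N) (h2 : N ≤ M) : u N M ≠ 0 := by
  have := h.norm N M h1 h2
  intro h0
  simp [h0] at this

/-- A function on the odd points that takes the same value at neighbours is constant. -/
lemma const_of_adj {α : Type*} {F : ℤ → ℤ → α}
    (hv : ∀ N M : ℤ, -M ≤ N → N ≤ M → F (N - 1) M = F N M)
    (hh : ∀ M : ℤ, 1 ≤ M → F 0 (M - 1) = F 0 M) (N M : ℤ) (h1 : -M - 1 ≤ N) (h2 : N ≤ M) :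
    F N M = F 0 0 := by
  have h0 : ∀ k : ℕ, F 0 k = F 0 0 := by
    intro k
    induction k with
    | zero => rfl
    | succ k ih =>
      rw [← ih]
      have := hh (k + 1) (by omega)
      rw [add_sub_cancel_right] at this
      exact_mod_cast this.symm
  -- Each row is connected through its even points; the rows are joined to each other along the
  -- column `N = 0` alone.
  have hrow : ∀ j : ℕ, (j : ℤ) ≤ 2 * M + 1 → F (M - j) M = F M M := by
    intro j
    induction j with
    | zero => simp
    | succ j ih =>
      intro hj
      rw [← ih (by omega), ← hv (M - j) M (by push_cast at hj; omega) (by omega)]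
      congr 1; push_cast; ring
  have e1 := hrow (M - N).toNat (by omega)
  have e2 := hrow M.toNat (by omega)
  have e3 := h0 M.toNat
  rw [Int.toNat_of_nonneg (by omega)] at e1 e2 e3
  rw [sub_sub_cancel] at e1
  rw [sub_self] at e2
  rw [e1, ← e2, e3]

namespace IsCrossField

variable {J : ℂ} {R : ℤ → ℤ → ℝ} {c g u : ℤ → ℤ → ℂ} (hJ : J * J = -1)
  (h : IsCrossField J R c g u)
include h

lemma u_ne_zero {N M : ℤ} (h1 : -M - 1 ≤ N) (h2 : N ≤ M) : u N M ≠ 0 := by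
  have := h.norm N M h1 h2
  intro h0
  simp [h0] at this

lemma isDirection : IsDirection J R u where
  norm := h.norm
  vert N M h1 h2 := by
    have e1 := h.base N M h1 h2
    have e2 := h.top N M (by omega) h2
    have e3 := h.right (N - 1) M (by omega) (by omega)
    have e4 := h.diag (N - 1) M (by omega) (by omega)
    rw [sub_add_cancel] at e3 e4
    linear_combination e2 - e1 + e3 - e4
  horiz N M h1 h2 := by
    have e1 := h.base N M h1 (by omega)
    have e2 := h.right N M (by omega) h2
    have e3 := h.top N (M - 1) (by omega) (by omega)
    have e4 := h.diag N (M - 1) (by omega) (by omega)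
    rw [sub_add_cancel] at e3 e4
    linear_combination e2 - e1 + e3 - e4

variable (hR : ∀ N M, 0 < R N M)
include hR hJ

lemma kite_even {N M : ℤ} (h1 : -M ≤ N) (h2 : N ≤ M) :
    Kite J (c N M) (g N M) (c N (M + 1)) (g (N - 1) M) := by
  have e1 := h.base N M h1 h2
  have e2 := h.top N M (by omega) h2
  have e3 := h.right (N - 1) M (by omega) (by omega)
  have e4 := h.diag (N - 1) M (by omega) (by omega)
  rw [sub_add_cancel] at e3 e4
  have hr : (R N M : ℂ) ≠ 0 := by exact_mod_cast (hR N M).ne'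
  refine ⟨?_, R N (M + 1) / R N M, div_pos (hR _ _) (hR _ _), ?_, ?_⟩
  · intro h0
    apply mul_ne_zero hr (h.u_ne_zero (by omega) h2)
    linear_combination e1 - h0
  · push_cast
    rw [e1, e2]
    field_simp
    ring
  · push_cast
    rw [e3, e4]
    field_simp
    linear_combination (R N (M + 1) * u (N - 1) M * R N M) * hJ

lemma kite_odd {N M : ℤ} (h1 : -M - 1 ≤ N) (h2 : N ≤ M) :
    Kite J (c (N + 1) (M + 1)) (g N (M + 1)) (c N (M + 1)) (g N M) := by
  have e1 := h.base N (M + 1) (by omega) (by omega)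
  have e2 := h.top N M h1 h2
  have e3 := h.right N (M + 1) (by omega) (by omega)
  have e4 := h.diag N M h1 h2
  have hr : (R (N + 1) (M + 1) : ℂ) ≠ 0 := by exact_mod_cast (hR _ _).ne'
  refine ⟨?_, R N (M + 1) / R (N + 1) (M + 1), div_pos (hR _ _) (hR _ _), ?_, ?_⟩
  · intro h0
    apply mul_ne_zero (mul_ne_zero (ne_zero_of_sq hJ) hr)
      (h.u_ne_zero (N := N) (M := M + 1) (by omega) (by omega))
    linear_combination e3 - h0
  · push_cast
    rw [e1, e3]
    field_simp
    linear_combination (-(R N (M + 1) * u N (M + 1) * R (N + 1) (M + 1))) * hJ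
  · push_cast
    rw [e2, e4]
    field_simp
    ring

lemma isKiteMap {f : ℤ → ℤ → ℂ} (hc : ∀ N M : ℤ, -M ≤ N → N ≤ M → f (N + M) (M - N) = c N M)
    (hg : ∀ N M : ℤ, -M - 1 ≤ N → N ≤ M → f (N + M + 1) (M - N) = g N M) : IsKiteMap J f := by
  intro n m hn hm
  constructor
  · rintro ⟨M, hM⟩
    obtain ⟨N, rfl⟩ : ∃ N, n = N + M := ⟨n - M, by ring⟩
    obtain rfl : m = M - N := by omega
    have := h.kite_even hJ hR (N := N) (M := M) (by omega) (by omega)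
    rw [← hc N M (by omega) (by omega), ← hg N M (by omega) (by omega),
      ← hg (N - 1) M (by omega) (by omega), ← hc N (M + 1) (by omega) (by omega)] at this
    convert this using 2 <;> ring
  · intro he
    obtain ⟨M, hM⟩ := Int.not_even_iff_odd.1 he
    obtain ⟨N, rfl⟩ : ∃ N, n = N + M + 1 := ⟨n - M - 1, by ring⟩
    obtain rfl : m = M - N := by omega
    have := h.kite_odd hJ hR (N := N) (M := M) (by omega) (by omega)
    rw [← hc (N + 1) (M + 1) (by omega) (by omega), ← hg N M (by omega) (by omega),
      ← hg N (M + 1) (by omega) (by omega), ← hc N (M + 1) (by omega) (by omega)] at this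
    convert this using 2 <;> ring

end IsCrossField

/-! ### The constraint in a cross field -/

/-- Since `1/x = P' / (u P)` and `1/y = Q' / (u Q)`, the half harmonic mean of `x` and `y` is `u P Q
/ (P Q' + P' Q)`. -/
lemma harmonic_of_rotation {x y u P P' Q Q' k : ℂ} (hx : x * P' = u * P) (hy : y * Q' = u * Q)
    (hk : P * Q' + P' * Q = k) (hk0 : k ≠ 0) (hu : u ≠ 0) (hP : P' ≠ 0) (hQ : Q' ≠ 0) :
    x + y ≠ 0 ∧ k * (x * y / (x + y)) = u * P * Q := by
  have e : (x + y) * (P' * Q') = u * k := by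
    linear_combination Q' * hx + P' * hy + u * hk
  have hne : x + y ≠ 0 := by
    intro h0
    rw [h0, zero_mul] at e
    exact mul_ne_zero hu hk0 e.symm
  refine ⟨hne, ?_⟩
  rw [mul_div_assoc', div_eq_iff hne]
  refine mul_right_cancel₀ (mul_ne_zero hP hQ) ?_
  linear_combination k * y * Q' * hx + k * u * P * hy - u * P * Q * e

/-- The right-hand side of the constraint at the odd point `g N M`. -/
noncomputable def phi (J : ℂ) (R : ℤ → ℤ → ℝ) (u : ℤ → ℤ → ℂ) (N M : ℤ) : ℂ :=
  2 * ((N : ℂ) + M + 1) * u N M *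
      (R N M * R (N + 1) (M + 1) / (R N M + R (N + 1) (M + 1))) +
    2 * ((M : ℂ) - N) * J * u N M *
      (R (N + 1) M * R N (M + 1) / (R (N + 1) M + R N (M + 1)))

/-- The right-hand side of the constraint at the even point `c N M`. -/
noncomputable def psi (J : ℂ) (R : ℤ → ℤ → ℝ) (u : ℤ → ℤ → ℂ) (N M : ℤ) : ℂ :=
  ((N : ℂ) + M) * u N M * ((R N M + J * R N (M + 1)) * (R (N - 1) M - J * R N M) /
      (R N (M + 1) + R (N - 1) M)) +
    ((M : ℂ) - N) * J * u N M * ((R N M + J * R N (M + 1)) * (R N M - J * R (N + 1) M) /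
      (R (N + 1) M + R N (M + 1)))

section
variable {J : ℂ} {R : ℤ → ℤ → ℝ} {u : ℤ → ℤ → ℂ} (hR : ∀ N M, 0 < R N M)
include hR

omit hR in
lemma ofReal_mul_div_eq (a b : ℝ) (ha : 0 < a) (hb : 0 < b) :
    2 * ((a : ℂ) * b / (a + b)) = a * (1 + (dq b a : ℝ)) := by
  have : (a : ℂ) + b ≠ 0 := by
    have : a + b ≠ 0 := by positivity
    exact_mod_cast this
  have h' : (b : ℂ) + a ≠ 0 := by rwa [add_comm]
  unfold dq
  push_cast
  field_simp
  ring

omit hR in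
lemma mul_one_add_dq {a b : ℝ} (ha : 0 < a) (hb : 0 < b) : a * (1 + dq b a) = b * (1 - dq b a) := by
  unfold dq
  have : b + a ≠ 0 := by positivity
  field_simp
  ring

lemma phi_eq (N M : ℤ) : phi J R u N M =
    u N M * (((N : ℂ) + M + 1) * (R N M * (1 + (dq (R (N + 1) (M + 1)) (R N M) : ℝ))) +
      ((M : ℂ) - N) * J * (R N (M + 1) * (1 - (dq (R N (M + 1)) (R (N + 1) M) : ℝ)))) := by
  have e1 := ofReal_mul_div_eq _ _ (hR N M) (hR (N + 1) (M + 1))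
  have e2 := ofReal_mul_div_eq _ _ (hR N (M + 1)) (hR (N + 1) M)
  rw [dq_neg] at e2
  push_cast at e2
  unfold phi
  rw [mul_comm (R (N + 1) M : ℂ), add_comm (R (N + 1) M : ℂ)]
  linear_combination ((N : ℂ) + M + 1) * u N M * e1 + ((M : ℂ) - N) * J * u N M * e2

lemma psi_eq (hJ : J * J = -1) (N M : ℤ) : psi J R u N M =
    u N M * (((N : ℂ) + M) * (R N M - J * (cq (R N M) (R N (M + 1)) (R (N - 1) M) : ℝ)) +
      ((M : ℂ) - N) * (J * (cq (R N M) (R N (M + 1)) (R (N + 1) M) : ℝ) +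
        J * (R N (M + 1) * (1 - (dq (R N (M + 1)) (R (N + 1) M) : ℝ)))
        - R N M * (dq (R N (M + 1)) (R (N + 1) M) : ℝ))) := by
  have h1 : (R N (M + 1) : ℂ) + R (N - 1) M ≠ 0 := by
    have := add_pos (hR N (M + 1)) (hR (N - 1) M)
    exact_mod_cast this.ne'
  have h2 : (R (N + 1) M : ℂ) + R N (M + 1) ≠ 0 := by
    have := add_pos (hR (N + 1) M) (hR N (M + 1))
    exact_mod_cast this.ne'
  have h2' : (R N (M + 1) : ℂ) + R (N + 1) M ≠ 0 := by rwa [add_comm]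
  have e1 : (R N M + J * R N (M + 1)) * (R (N - 1) M - J * R N M) /
      (R N (M + 1) + R (N - 1) M) = R N M - J * (cq (R N M) (R N (M + 1)) (R (N - 1) M) : ℝ) := by
    unfold cq
    push_cast
    field_simp
    linear_combination (-(R N M : ℂ) * R N (M + 1)) * hJ
  have e2 : J * ((R N M + J * R N (M + 1)) * (R N M - J * R (N + 1) M) /
      (R (N + 1) M + R N (M + 1))) = J * (cq (R N M) (R N (M + 1)) (R (N + 1) M) : ℝ) +
        J * (R N (M + 1) * (1 - (dq (R N (M + 1)) (R (N + 1) M) : ℝ)))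
        - R N M * (dq (R N (M + 1)) (R (N + 1) M) : ℝ) := by
    unfold cq dq
    push_cast
    rw [add_comm (R (N + 1) M : ℂ)]
    field_simp
    linear_combination (R N M * (R N (M + 1) - R (N + 1) M)  - J * R N (M + 1) * R (N + 1) M : ℂ) * hJ
  unfold psi
  rw [e1]
  linear_combination ((M : ℂ) - N) * u N M * e2

/-- The constraints at the two ends of an edge. -/
lemma phi_sub_psi (hJ : J * J = -1) (γ : ℝ) (N M : ℤ) :
    phi J R u N M - psi J R u N M - γ * (R N M * u N M) = u N M *
      (((R N M * (((N : ℝ) + M + 1) * dq (R (N + 1) (M + 1)) (R N M) +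
        ((M : ℝ) - N) * dq (R N (M + 1)) (R (N + 1) M) - (γ - 1)) : ℝ) : ℂ) +
      J * ((((N : ℝ) + M) * cq (R N M) (R N (M + 1)) (R (N - 1) M) -
        ((M : ℝ) - N) * cq (R N M) (R N (M + 1)) (R (N + 1) M) : ℝ) : ℂ)) := by
  rw [phi_eq hR, psi_eq hR hJ]
  push_cast
  ring

/-- One complex equation splits into two real ones: after division by `u`, the real component is the
square equation and the `J` component is `UpEq`. -/
lemma phi_sub_psi_eq_iff (hJ : J * J = -1) (γ : ℝ) {N M : ℤ} (hu : u N M ≠ 0) :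
    phi J R u N M - psi J R u N M = γ * (R N M * u N M) ↔
      squareExpr γ R N M = 0 ∧ UpEq R N M := by
  rw [← sub_eq_zero, phi_sub_psi hR hJ, mul_eq_zero, or_iff_right hu, add_mul_eq_zero_iff hJ,
    mul_eq_zero, or_iff_right (hR N M).ne', sub_eq_zero, sub_eq_zero,
    squareExpr_eq_zero_iff hR]
  rfl

/-- Given the square equation and `UpEq` at `(N, M)`, all that survives is the residual of the
square equation at `(N - 1, M)`. The identity can therefore be used in both directions. -/
lemma phi_sub_phi_vert_aux (hJ : J * J = -1) (γ : ℝ) {N M : ℤ}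
    (hu : u (N - 1) M * (R N (M + 1) + J * R N M) = u N M * (R N M + J * R N (M + 1)))
    (h1 : squareExpr γ R N M = 0) (h3 : UpEq R N M) :
    phi J R u N M - phi J R u (N - 1) M - γ * (R N M * (u N M - J * u (N - 1) M)) =
      -(J * R N M * u (N - 1) M) *
        (((N : ℝ) + M) * dq (R N (M + 1)) (R (N - 1) M) +
          ((M : ℝ) - N + 1) * dq (R (N - 1) (M + 1)) (R N M) - (γ - 1) : ℝ) := by
  rw [squareExpr_eq_zero_iff hR] at h1
  rw [upEq_iff hR] at h3
  rw [phi_eq hR, phi_eq hR]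
  have hr := hR N M
  have hr2 := hR N (M + 1)
  simp only [sub_add_cancel] at *
  have i1 := congrArg (fun x : ℝ => (x : ℂ)) (mul_one_add_dq (hR (N - 1) M) (hR N (M + 1)))
  have i2 := congrArg (fun x : ℝ => (x : ℂ)) (mul_one_add_dq (hR N M) (hR (N - 1) (M + 1)))
  have h1' := congrArg (fun x : ℝ => (x : ℂ)) h1
  have h3' := congrArg (fun x : ℝ => (x : ℂ)) h3
  push_cast at h1' h3' i1 i2 ⊢
  set r : ℂ := ((R N M : ℝ) : ℂ)
  set r2 : ℂ := ((R N (M + 1) : ℝ) : ℂ)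
  have hne : r - J * r2 ≠ 0 := sub_mul_ne_zero hJ hr.ne' _
  -- By `hu` the two directions are one multiple `s` of the conjugates of `r + J r2` and `r2 + J r`;
  -- in terms of `s` the claim is polynomial.
  obtain ⟨s, hs⟩ : ∃ s, u N M = s * (r - J * r2) := ⟨u N M / (r - J * r2), by field_simp⟩
  have hs' : u (N - 1) M = s * (r2 - J * r) := by
    have hne' : r2 + J * r ≠ 0 := add_mul_ne_zero hJ hr2.ne' _
    refine mul_right_cancel₀ hne' ?_
    rw [hu, hs]
    linear_combination s * (r ^ 2 - r2 ^ 2) * hJ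
  rw [hs, hs']
  linear_combination (s * (r - J * r2) * r) * h1' + s * h3' -
    s * (r2 - J * r) * (N + M) * i1 + s * (r2 - J * r) * (M - N + 1) * J * i2 +
    s * (-(M - N) * r2 ^ 2 + (M - N) * (dq (R N (M + 1)) (R (N + 1) M) : ℝ) * r2 ^ 2 +
      (M - N) * r ^ 2 - (N + M) * (dq (R N (M + 1)) (R (N - 1) M) : ℝ) * r ^ 2) * hJ

/-- The difference of the right-hand sides of the constraint at the two odd ends of a vertical kite. -/
lemma phi_sub_phi_vert (hJ : J * J = -1) (γ : ℝ) {N M : ℤ}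
    (hu : u (N - 1) M * (R N (M + 1) + J * R N M) = u N M * (R N M + J * R N (M + 1)))
    (h1 : squareExpr γ R N M = 0) (h2 : squareExpr γ R (N - 1) M = 0) (h3 : UpEq R N M) :
    phi J R u N M - phi J R u (N - 1) M = γ * (R N M * (u N M - J * u (N - 1) M)) := by
  rw [← sub_eq_zero, phi_sub_phi_vert_aux hR hJ γ hu h1 h3, neg_mul, neg_eq_zero, mul_eq_zero]
  right
  rw [squareExpr_eq_zero_iff hR, sub_add_cancel] at h2
  push_cast at h2
  rw [ofReal_eq_zero]
  linear_combination h2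

/-- Needed for the squares at `(-M - 1, M)`: their lower left vertex is not in `V`, so `phi` cannot
be compared with `psi` along an edge there. -/
lemma squareExpr_of_phi_sub_phi (hJ : J * J = -1) (γ : ℝ) {N M : ℤ}
    (hu : u (N - 1) M * (R N (M + 1) + J * R N M) = u N M * (R N M + J * R N (M + 1)))
    (h1 : squareExpr γ R N M = 0) (h3 : UpEq R N M) (hu0 : u (N - 1) M ≠ 0)
    (h : phi J R u N M - phi J R u (N - 1) M = γ * (R N M * (u N M - J * u (N - 1) M))) :
    squareExpr γ R (N - 1) M = 0 := by
  have hr : (R N M : ℂ) ≠ 0 := by exact_mod_cast (hR N M).ne'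
  rw [← sub_eq_zero, phi_sub_phi_vert_aux hR hJ γ hu h1 h3, mul_eq_zero, ofReal_eq_zero] at h
  have h := h.resolve_left (neg_ne_zero.2 (mul_ne_zero (mul_ne_zero (ne_zero_of_sq hJ) hr) hu0))
  rw [squareExpr_eq_zero_iff hR, sub_add_cancel]
  push_cast
  linear_combination h

/-- The odd points `g N M` and `g N (M - 1)` are the right and lower neighbours of the center `c N
M`. The two square equations eliminate `γ`, and `RightEq` in its `dq` form remains. -/
lemma phi_sub_phi_horiz_aux (hJ : J * J = -1) (γ : ℝ) {N M : ℤ}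
    (hu : u N (M - 1) * (R (N + 1) M - J * R N M) = u N M * (R N M - J * R (N + 1) M))
    (h1 : squareExpr γ R N M = 0) (h2 : squareExpr γ R N (M - 1) = 0) :
    phi J R u N M - phi J R u N (M - 1) - γ * (R N M * (u N M + J * u N (M - 1))) =
      u N M / (R N M + J * R (N + 1) M) * (2 * (M : ℝ) * (R N M ^ 2 - R (N + 1) M ^ 2) +
      (((N : ℝ) + M) * dq (R (N + 1) M) (R N (M - 1)) -
        ((M : ℝ) - N) * dq (R N (M + 1)) (R (N + 1) M)) * (R N M ^ 2 + R (N + 1) M ^ 2) : ℝ) := by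
  rw [squareExpr_eq_zero_iff hR] at h1 h2
  rw [phi_eq hR]
  have e1 := ofReal_mul_div_eq _ _ (hR (N + 1) M) (hR N (M - 1))
  have e2 := ofReal_mul_div_eq _ _ (hR N M) (hR (N + 1) (M - 1))
  rw [dq_neg] at e1 e2
  have hr := hR N M
  have hr2 := hR (N + 1) M
  have e3 : phi J R u N (M - 1) = u N (M - 1) *
      ((N + M) * (R (N + 1) M * (1 - (dq (R (N + 1) M) (R N (M - 1)) : ℝ))) +
        (M - 1 - N) * J * (R N M * (1 - (dq (R N M) (R (N + 1) (M - 1)) : ℝ)))) := by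
    unfold phi
    push_cast at e1 e2 ⊢
    rw [sub_add_cancel, mul_comm (R N (M - 1) : ℂ), add_comm (R N (M - 1) : ℂ),
      mul_comm (R (N + 1) (M - 1) : ℂ), add_comm (R (N + 1) (M - 1) : ℂ)]
    linear_combination (N + M) * u N (M - 1) * e1 + (M - 1 - N) * J * u N (M - 1) * e2
  simp only [sub_add_cancel] at *
  have h1' := congrArg (fun x : ℝ => (x : ℂ)) h1
  have h2' := congrArg (fun x : ℝ => (x : ℂ)) h2
  have i1 := congrArg (fun x : ℝ => (x : ℂ)) (mul_one_add_dq (hR (N + 1) M) (hR N (M + 1)))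
  push_cast at h1' h2' e3 i1 ⊢
  rw [e3]
  set r : ℂ := ((R N M : ℝ) : ℂ)
  set r1 : ℂ := ((R (N + 1) M : ℝ) : ℂ)
  have hne : r + J * r1 ≠ 0 := add_mul_ne_zero hJ hr.ne' _
  obtain ⟨s, hs⟩ : ∃ s, u N M = s * (r + J * r1) := ⟨u N M / (r + J * r1), by field_simp⟩
  have hs' : u N (M - 1) = s * (r1 + J * r) := by
    have hne' : r1 - J * r ≠ 0 := sub_mul_ne_zero hJ hr2.ne' _
    refine mul_right_cancel₀ hne' ?_
    rw [hu, hs]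
    linear_combination s * (r ^ 2 - r1 ^ 2) * hJ
  rw [hs, hs', mul_div_cancel_right₀ _ hne]
  linear_combination s * (r + J * r1) * r * h1' + s * (r1 + J * r) * J * r * h2' -
    s * (r + J * r1) * (M - N) * J * i1 +
    s * ((M - N) * r1 ^ 2 + (M - N) * (dq (R N (M + 1)) (R (N + 1) M) : ℝ) * r1 ^ 2 -
      (M - N) * r ^ 2 - (N + M) * (dq (R (N + 1) M) (R N (M - 1)) : ℝ) * r ^ 2) * hJ

/-- The difference of the right-hand sides of the constraint at the two odd ends of a horizontal kite. -/
lemma phi_sub_phi_horiz_iff (hJ : J * J = -1) (γ : ℝ) {N M : ℤ}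
    (hu : u N (M - 1) * (R (N + 1) M - J * R N M) = u N M * (R N M - J * R (N + 1) M))
    (h1 : squareExpr γ R N M = 0) (h2 : squareExpr γ R N (M - 1) = 0) (hu0 : u N M ≠ 0) :
    phi J R u N M - phi J R u N (M - 1) = γ * (R N M * (u N M + J * u N (M - 1))) ↔
      RightEq R N M := by
  rw [← sub_eq_zero, phi_sub_phi_horiz_aux hR hJ γ hu h1 h2, mul_eq_zero, ofReal_eq_zero,
    or_iff_right (div_ne_zero hu0 (add_mul_ne_zero hJ (hR _ _).ne' _)), rightEq_iff hR]

end

namespace IsCrossField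

variable {J : ℂ} {R : ℤ → ℤ → ℝ} {c g u : ℤ → ℤ → ℂ} {f : ℤ → ℤ → ℂ} (hJ : J * J = -1)
  (h : IsCrossField J R c g u) (hR : ∀ N M, 0 < R N M)
  (hc : ∀ N M : ℤ, -M ≤ N → N ≤ M → f (N + M) (M - N) = c N M)
  (hg : ∀ N M : ℤ, -M - 1 ≤ N → N ≤ M → f (N + M + 1) (M - N) = g N M)
include h hJ hR hc hg

/-- Opposite neighbours of an odd point are collinear with it, in the directions `±u` and `±J u`, so
each fraction is half a harmonic mean of two radii times a direction. -/
lemma constraint_odd {N M : ℤ} (h1 : -M - 1 ≤ N) (h2 : N ≤ M) {n m : ℤ} (hn : n = N + M + 1)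
    (hm : m = M - N) :
    (n ≠ 0 → f (n + 1) m - f (n - 1) m ≠ 0) ∧ (m ≠ 0 → f n (m + 1) - f n (m - 1) ≠ 0) ∧
      2 * (n : ℂ) * (((f (n + 1) m - f n m) * (f n m - f (n - 1) m)) / (f (n + 1) m - f (n - 1) m)) +
      2 * (m : ℂ) * (((f n (m + 1) - f n m) * (f n m - f n (m - 1))) / (f n (m + 1) - f n (m - 1)))
      = phi J R u N M := by
  have hu := h.u_ne_zero h1 h2
  have e0 : f n m = g N M := by rw [hn, hm, hg N M h1 h2]
  have er : f (n + 1) m = c (N + 1) (M + 1) := by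
    rw [← hc _ _ (by omega) (by omega)]; congr 1 <;> omega
  have et : f n (m + 1) = c N (M + 1) := by
    rw [← hc _ _ (by omega) (by omega)]; congr 1 <;> omega
  have dr := h.diag N M h1 h2
  have dt := h.top N M h1 h2
  have s1 : (R N M : ℂ) + R (N + 1) (M + 1) ≠ 0 := by
    have := add_pos (hR N M) (hR (N + 1) (M + 1))
    exact_mod_cast this.ne'
  have s2 : (R (N + 1) M : ℂ) + R N (M + 1) ≠ 0 := by
    have := add_pos (hR (N + 1) M) (hR N (M + 1))
    exact_mod_cast this.ne'
  have H : n ≠ 0 → f (n + 1) m - f (n - 1) m ≠ 0 ∧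
      ((f (n + 1) m - f n m) * (f n m - f (n - 1) m)) / (f (n + 1) m - f (n - 1) m) =
        u N M * (R N M * R (N + 1) (M + 1) / (R N M + R (N + 1) (M + 1))) := by
    intro hn0
    have el : f (n - 1) m = c N M := by
      rw [← hc _ _ (by omega) (by omega)]; congr 1; omega
    have dl := h.base N M (by omega) h2
    have e : f (n + 1) m - f (n - 1) m = (R N M + R (N + 1) (M + 1)) * u N M := by
      rw [er, el, dr, dl]; ring
    refine ⟨by rw [e]; exact mul_ne_zero s1 hu, ?_⟩
    rw [e, er, el, e0, dr, dl]
    field_simp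
    ring
  have V : m ≠ 0 → f n (m + 1) - f n (m - 1) ≠ 0 ∧
      ((f n (m + 1) - f n m) * (f n m - f n (m - 1))) / (f n (m + 1) - f n (m - 1)) =
        J * u N M * (R (N + 1) M * R N (M + 1) / (R (N + 1) M + R N (M + 1))) := by
    intro hm0
    have el : f n (m - 1) = c (N + 1) M := by
      rw [← hc _ _ (by omega) (by omega)]; congr 1 <;> omega
    have dl := h.right N M h1 (by omega)
    have e : f n (m + 1) - f n (m - 1) = (R (N + 1) M + R N (M + 1)) * (J * u N M) := by
      rw [et, el, dt, dl]; ring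
    have hJu := mul_ne_zero (ne_zero_of_sq hJ) hu
    refine ⟨by rw [e]; exact mul_ne_zero s2 hJu, ?_⟩
    rw [e, et, el, e0, dt, dl]
    have hJ0 := ne_zero_of_sq hJ
    field_simp
    ring
  refine ⟨fun x => (H x).1, fun x => (V x).1, ?_⟩
  unfold phi
  congr 1
  -- On the boundary the vanishing coefficient removes the term in both expressions, whatever values
  -- stand outside of the quadrant.
  · by_cases hn0 : n = 0
    · have : (N : ℂ) + M + 1 = 0 := by rw [hn] at hn0; exact_mod_cast hn0
      rw [this, hn0]; simp
    · rw [(H hn0).2, hn]; push_cast; ring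
  · by_cases hm0 : m = 0
    · have : (M : ℂ) - N = 0 := by rw [hm] at hm0; exact_mod_cast hm0
      rw [this, hm0]; simp
    · rw [(V hm0).2, hm]; push_cast; ring

/-- The neighbours of an even point lie on a circle around it. `IsDirection` expresses the other
three radius vectors through `u N M`, and `harmonic_of_rotation` evaluates the fractions. -/
lemma constraint_even {N M : ℤ} (h1 : -M ≤ N) (h2 : N ≤ M) {n m : ℤ} (hn : n = N + M)
    (hm : m = M - N) :
    (n ≠ 0 → f (n + 1) m - f (n - 1) m ≠ 0) ∧ (m ≠ 0 → f n (m + 1) - f n (m - 1) ≠ 0) ∧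
      2 * (n : ℂ) * (((f (n + 1) m - f n m) * (f n m - f (n - 1) m)) / (f (n + 1) m - f (n - 1) m)) +
      2 * (m : ℂ) * (((f n (m + 1) - f n m) * (f n m - f n (m - 1))) / (f n (m + 1) - f n (m - 1)))
      = psi J R u N M := by
  have hd := h.isDirection
  have hu := h.u_ne_zero (N := N) (M := M) (by omega) h2
  have hr : (R N M : ℂ) ≠ 0 := by exact_mod_cast (hR N M).ne'
  have e0 : f n m = c N M := by rw [hn, hm, hc N M h1 h2]
  have er : f (n + 1) m = g N M := by
    rw [← hg _ _ (by omega) (by omega)]; congr 1; omega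
  have et : f n (m + 1) = g (N - 1) M := by
    rw [← hg _ _ (by omega) (by omega)]; congr 1 <;> omega
  have dr := h.base N M h1 h2
  have dt := h.right (N - 1) M (by omega) (by omega)
  have hv := hd.vert N M h1 h2
  rw [sub_add_cancel] at dt
  have s1 : (R N (M + 1) : ℂ) + R (N - 1) M ≠ 0 := by
    have := add_pos (hR N (M + 1)) (hR (N - 1) M)
    exact_mod_cast this.ne'
  have s2 : (R (N + 1) M : ℂ) + R N (M + 1) ≠ 0 := by
    have := add_pos (hR (N + 1) M) (hR N (M + 1))
    exact_mod_cast this.ne'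
  have H : n ≠ 0 → f (n + 1) m - f (n - 1) m ≠ 0 ∧
      2 * (((f (n + 1) m - f n m) * (f n m - f (n - 1) m)) / (f (n + 1) m - f (n - 1) m)) =
        u N M * ((R N M + J * R N (M + 1)) * (R (N - 1) M - J * R N M) /
          (R N (M + 1) + R (N - 1) M)) := by
    intro hn0
    have el : f (n - 1) m = g (N - 1) (M - 1) := by
      rw [← hg _ _ (by omega) (by omega)]; congr 1 <;> omega
    have dl := h.diag (N - 1) (M - 1) (by omega) (by omega)
    have hh := hd.horiz (N - 1) M (by omega) (by omega)
    rw [sub_add_cancel] at hh dl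
    rw [sub_add_cancel] at dl
    -- The turn from the right to the left neighbour is composed of two turns, through the upper
    -- neighbour.
    have hl : u (N - 1) (M - 1) * ((R N (M + 1) + J * R N M) * (R N M - J * R (N - 1) M)) =
        u N M * ((R N M + J * R N (M + 1)) * (R (N - 1) M - J * R N M)) := by
      linear_combination (R N (M + 1) + J * R N M) * hh + (R (N - 1) M - J * R N M) * hv
    obtain ⟨k1, k2⟩ := harmonic_of_rotation (x := u N M) (y := u (N - 1) (M - 1)) (u := u N M)
      (P := 1) (P' := 1) (k := 2 * R N M * (R N (M + 1) + R (N - 1) M)) rfl hl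
      (by linear_combination (-(R N M * (R N (M + 1) + R (N - 1) M)) : ℂ) * hJ)
      (by simp [hr, s1]) hu one_ne_zero
      (mul_ne_zero (add_mul_ne_zero hJ (hR _ _).ne' _) (sub_mul_ne_zero hJ (hR _ _).ne' _))
    have e : f (n + 1) m - f (n - 1) m = R N M * (u N M + u (N - 1) (M - 1)) := by
      rw [er, el]; linear_combination dl - dr
    have eA : f (n + 1) m - f n m = R N M * u N M := by rw [er, e0, dr]; ring
    have eB : f n m - f (n - 1) m = R N M * u (N - 1) (M - 1) := by rw [e0, el, dl]; ring
    refine ⟨by rw [e]; exact mul_ne_zero hr k1, ?_⟩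
    have e' : (R N M * u N M) * (R N M * u (N - 1) (M - 1)) /
        (R N M * (u N M + u (N - 1) (M - 1))) =
        R N M * (u N M * u (N - 1) (M - 1) / (u N M + u (N - 1) (M - 1))) := by field_simp
    rw [e, eA, eB, e', ← mul_div_assoc (u N M), eq_div_iff s1]
    linear_combination k2
  have V : m ≠ 0 → f n (m + 1) - f n (m - 1) ≠ 0 ∧
      2 * (((f n (m + 1) - f n m) * (f n m - f n (m - 1))) / (f n (m + 1) - f n (m - 1))) =
        J * u N M * ((R N M + J * R N (M + 1)) * (R N M - J * R (N + 1) M) /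
          (R (N + 1) M + R N (M + 1))) := by
    intro hm0
    have el : f n (m - 1) = g N (M - 1) := by
      rw [← hg _ _ (by omega) (by omega)]; congr 1 <;> omega
    have dl := h.top N (M - 1) (by omega) (by omega)
    have hh := hd.horiz N M (by omega) (by omega)
    rw [sub_add_cancel] at dl
    obtain ⟨k1, k2⟩ := harmonic_of_rotation (k := 2 * R N M * (R (N + 1) M + R N (M + 1))) hv hh
      (by linear_combination (-(R N M * (R (N + 1) M + R N (M + 1))) : ℂ) * hJ)
      (by simp [hr, s2]) hu
      (add_mul_ne_zero hJ (hR _ _).ne' _) (sub_mul_ne_zero hJ (hR _ _).ne' _)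
    have hJ0 := ne_zero_of_sq hJ
    have e : f n (m + 1) - f n (m - 1) = J * R N M * (u (N - 1) M + u N (M - 1)) := by
      rw [et, el]; linear_combination dl - dt
    have eA : f n (m + 1) - f n m = J * R N M * u (N - 1) M := by rw [et, e0, dt]; ring
    have eB : f n m - f n (m - 1) = J * R N M * u N (M - 1) := by rw [e0, el, dl]; ring
    refine ⟨by rw [e]; exact mul_ne_zero (mul_ne_zero hJ0 hr) k1, ?_⟩
    have e' : (J * R N M * u (N - 1) M) * (J * R N M * u N (M - 1)) /
        (J * R N M * (u (N - 1) M + u N (M - 1))) =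
        J * R N M * (u (N - 1) M * u N (M - 1) / (u (N - 1) M + u N (M - 1))) := by field_simp
    rw [e, eA, eB, e', ← mul_div_assoc (J * u N M), eq_div_iff s2]
    linear_combination J * k2
  refine ⟨fun x => (H x).1, fun x => (V x).1, ?_⟩
  unfold psi
  congr 1
  · by_cases hn0 : n = 0
    · have : (N : ℂ) + M = 0 := by rw [hn] at hn0; exact_mod_cast hn0
      rw [this, hn0]; simp
    · rw [mul_comm 2 (n : ℂ), mul_assoc, (H hn0).2, hn]; push_cast; ring
  · by_cases hm0 : m = 0
    · have : (M : ℂ) - N = 0 := by rw [hm] at hm0; exact_mod_cast hm0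
      rw [this, hm0]; simp
    · rw [mul_comm 2 (m : ℂ), mul_assoc, (V hm0).2, hm]; push_cast; ring

end IsCrossField

/-! ### From the radii to the pattern -/

section
variable {γ : ℝ} {R : ℤ → ℤ → ℝ} (hR : ∀ N M, 0 < R N M)
  (hsq : ∀ N M : ℤ, -M - 1 ≤ N → N ≤ M → squareExpr γ R N M = 0)
  (hst : ∀ N M : ℤ, -M < N → N < M → RightEq R N M)
include hR hsq

/-- For `γ = 0` the square equation at the origin would be a vanishing sum of two positive terms. -/
lemma gamma_ne_zero : γ ≠ 0 := by
  rintro rfl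
  have h := hsq 0 0 (by norm_num) le_rfl
  unfold squareExpr at h
  norm_num at h
  have h1 := hR 1 0
  have h2 := hR 0 1
  have h3 := hR 1 1
  have : 0 < R 1 0 * R 1 1 * 2 + R 1 1 * R 0 1 * 2 := by positivity
  linarith

include hst

lemma rightEq_of_mem (N M : ℤ) (h1 : -M ≤ N) (h2 : N < M) : RightEq R N M := by
  rcases h1.lt_or_eq with h | rfl
  · exact hst N M h h2
  · have := upEq_of_mem hR hsq hst (-M) M le_rfl h2.le
    unfold UpEq at this
    unfold RightEq
    push_cast at *
    rw [cq_comm _ (R _ (M + 1)) (R (_ + 1) M)] at this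
    linear_combination -this

/-- `UpEq` with `N = M` says that a cotangent vanishes. Geometrically, the two kites at this center
fill a straight angle, so that the boundary row of the map is straight. -/
lemma sq_eq_of_right_boundary {M : ℤ} (hM : 0 < M) :
    R M M ^ 2 = R M (M + 1) * R (M - 1) M := by
  have := upEq_of_mem hR hsq hst M M (by omega) le_rfl
  unfold UpEq cq at this
  have hs : 0 < R M (M + 1) + R (M - 1) M := add_pos (hR _ _) (hR _ _)
  have hM' : (0 : ℝ) < M := by exact_mod_cast hM
  rw [sub_self, zero_mul, mul_eq_zero, div_eq_zero_iff] at this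
  rcases this with h | h | h <;> linarith

end

/-- The directions along the row with imaginary part `M`, from right to left. -/
noncomputable def rowDir (J : ℂ) (R : ℤ → ℤ → ℝ) (M : ℤ) : ℕ → ℂ
  -- All rows start with the same direction because the boundary row of the map is a straight line.
  | 0 => 1
  | j + 1 => rowDir J R M j *
      ((R (M - j) M + J * R (M - j) (M + 1)) / (R (M - j) (M + 1) + J * R (M - j) M))

/-- Directions that belong to the radii `R`. -/
noncomputable def dir (J : ℂ) (R : ℤ → ℤ → ℝ) (N M : ℤ) : ℂ := rowDir J R M (M - N).toNat

lemma dir_vert {J : ℂ} (hJ : J * J = -1) {R : ℤ → ℤ → ℝ} (hR : ∀ N M, 0 < R N M) {N M : ℤ}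
    (h : N ≤ M) : dir J R (N - 1) M * (R N (M + 1) + J * R N M) =
      dir J R N M * (R N M + J * R N (M + 1)) := by
  have e : (M - (N - 1)).toNat = (M - N).toNat + 1 := by omega
  have e' : M - ((M - N).toNat : ℤ) = N := by omega
  unfold dir
  rw [e, rowDir, e', mul_assoc, div_mul_cancel₀ _ (add_mul_ne_zero hJ (hR _ _).ne' _)]

lemma norm_rowDir {J : ℂ} (hJ : J * J = -1) {R : ℤ → ℤ → ℝ} (hR : ∀ N M, 0 < R N M) (M : ℤ)
    (j : ℕ) : ‖rowDir J R M j‖ = 1 := by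
  induction j with
  | zero => simp [rowDir]
  | succ j ih =>
    rw [rowDir, norm_mul, ih, one_mul, norm_div, div_eq_one_iff_eq]
    · refine (pow_left_inj₀ (norm_nonneg _) (norm_nonneg _) two_ne_zero).1 ?_
      rw [norm_add_mul hJ, norm_add_mul hJ, add_comm]
    · rw [norm_ne_zero_iff]
      exact add_mul_ne_zero hJ (hR _ _).ne' _

/-- The vertical relation holds by construction, and this one is a compatibility condition. It is
proved from the right end of the row leftwards: the base is the straightness of the boundary, and in
the step the four turns around an even vertex cancel by the angle equation. -/
lemma dir_horiz {J : ℂ} (hJ : J * J = -1) {R : ℤ → ℤ → ℝ} (hR : ∀ N M, 0 < R N M)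
    (hb : ∀ M : ℤ, 0 < M → R M M ^ 2 = R M (M + 1) * R (M - 1) M)
    (ha : ∀ N M : ℤ, -M < N → N < M → AngleEq R N M) {M : ℤ} (j : ℕ) {N : ℤ} (hj : N + 1 + j = M)
    (h1 : -M ≤ N) : dir J R N (M - 1) * (R (N + 1) M - J * R N M) =
      dir J R N M * (R N M - J * R (N + 1) M) := by
  induction j generalizing N with
  | zero =>
    obtain rfl : N = M - 1 := by push_cast at hj; omega
    have e : dir J R (M - 1) (M - 1) = dir J R M M := by simp [dir, rowDir]
    have hv := dir_vert hJ hR (le_refl M)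
    have hq := congrArg (fun x : ℝ => (x : ℂ)) (hb M (by omega))
    push_cast at hq
    rw [sub_add_cancel, e]
    refine mul_right_cancel₀ (add_mul_ne_zero hJ (hR M (M + 1)).ne' (R M M)) ?_
    linear_combination (-(R (M - 1) M - J * R M M) : ℂ) * hv + dir J R M M * 2 * J * hq +
      dir J R M M * R M M * (R M (M + 1) - R (M - 1) M) * hJ
  | succ j ih =>
    have h := ih (N := N + 1) (by push_cast at hj; omega) (by omega)
    have hv := dir_vert hJ hR (N := N + 1) (M := M) (by omega)
    have hv' := dir_vert hJ hR (N := N + 1) (M := M - 1) (by omega)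
    have hA := ha (N + 1) M (by omega) (by omega)
    unfold AngleEq at hA
    rw [cq_add_eq_zero_iff (hR _ _) (hR _ _) (hR _ _) (hR _ _)] at hA
    have hA' := congrArg (fun x : ℝ => (x : ℂ)) hA
    rw [add_sub_cancel_right] at hv hv' hA'
    rw [sub_add_cancel] at hv'
    push_cast at hA'
    set r : ℂ := ((R (N + 1) M : ℝ) : ℂ)
    set r1 : ℂ := ((R (N + 1 + 1) M : ℝ) : ℂ)
    set r2 : ℂ := ((R (N + 1) (M + 1) : ℝ) : ℂ)
    set r4 : ℂ := ((R N M : ℝ) : ℂ)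
    set r5 : ℂ := ((R (N + 1) (M - 1) : ℝ) : ℂ)
    have n1 : r2 + J * r ≠ 0 := add_mul_ne_zero hJ (hR _ _).ne' _
    have n2 : r + J * r5 ≠ 0 := add_mul_ne_zero hJ (hR _ _).ne' _
    have n3 : r1 - J * r ≠ 0 := sub_mul_ne_zero hJ (hR _ _).ne' _
    refine mul_right_cancel₀ (mul_ne_zero (mul_ne_zero n1 n2) n3) ?_
    -- Apart from a common factor `J ^ 2`, the sides are the products of `r - J r_k` and of `r + J
    -- r_k` over the four neighbours. They are conjugate, and the vanishing of the imaginary part is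
    -- the angle equation.
    have key : (r5 + J * r) * (r - J * r1) * (r - J * r4) * (r2 + J * r) =
        (r + J * r2) * (r4 - J * r) * (r + J * r5) * (r1 - J * r) := by
      have k1 : r5 + J * r = J * (r - J * r5) := by linear_combination r5 * hJ
      have k2 : r2 + J * r = J * (r - J * r2) := by linear_combination r2 * hJ
      have k3 : r4 - J * r = -J * (r + J * r4) := by linear_combination r4 * hJ
      have k4 : r1 - J * r = -J * (r + J * r1) := by linear_combination r1 * hJ
      rw [k1, k2, k3, k4]
      linear_combination (-2 * J ^ 3 * r) * hA' -
        2 * J ^ 3 * r * (r1 * r2 * r4 + r1 * r2 * r5 + r1 * r4 * r5 + r2 * r4 * r5) * hJ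
    linear_combination (r - J * r4) * (r2 + J * r) * (r1 - J * r) * hv' +
      (r5 + J * r) * (r - J * r4) * (r2 + J * r) * h -
      (r4 - J * r) * (r + J * r5) * (r1 - J * r) * hv + dir J R (N + 1) M * key

lemma phi_zero {γ : ℝ} {J : ℂ} {R : ℤ → ℤ → ℝ} {u : ℤ → ℤ → ℂ} (hR : ∀ N M, 0 < R N M)
    (h : squareExpr γ R 0 0 = 0) : phi J R u 0 0 = γ * (R 0 0 * u 0 0) := by
  rw [squareExpr_eq_zero_iff hR] at h
  have h' := congrArg (fun x : ℝ => (x : ℂ)) h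
  rw [phi_eq hR]
  push_cast at h' ⊢
  linear_combination u 0 0 * R 0 0 * h'

section
variable {γ : ℝ} {R : ℤ → ℤ → ℝ} (hR : ∀ N M, 0 < R N M)
  (hsq : ∀ N M : ℤ, -M - 1 ≤ N → N ≤ M → squareExpr γ R N M = 0)
  (hst : ∀ N M : ℤ, -M < N → N < M → RightEq R N M)
include hR hsq hst

lemma isDirection_dir {J : ℂ} (hJ : J * J = -1) : IsDirection J R (dir J R) where
  norm _ _ _ _ := norm_rowDir hJ hR _ _
  vert _ _ _ h2 := dir_vert hJ hR h2
  horiz N M h1 h2 := dir_horiz hJ hR (fun _ => sq_eq_of_right_boundary hR hsq hst)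
    (angleEq_of_mem hR hsq hst) (M - (N + 1)).toNat (by omega) h1

/-- The constraint integrates a field of directions to a pattern. -/
lemma IsDirection.exists_isCrossField {J : ℂ} (hJ : J * J = -1) {u : ℤ → ℤ → ℂ}
    (hu : IsDirection J R u) : ∃ c g : ℤ → ℤ → ℂ, c 0 0 = 0 ∧ IsCrossField J R c g u := by
  have hγ : (γ : ℂ) ≠ 0 := by exact_mod_cast gamma_ne_zero hR hsq
  have hv : ∀ N M : ℤ, -M ≤ N → N ≤ M → phi J R u N M / γ - phi J R u (N - 1) M / γ =
      R N M * (u N M - J * u (N - 1) M) := by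
    intro N M h1 h2
    rw [← sub_div, phi_sub_phi_vert hR hJ γ (hu.vert N M h1 h2) (hsq _ _ (by omega) h2)
      (hsq _ _ (by omega) (by omega)) (upEq_of_mem hR hsq hst N M h1 h2), mul_div_cancel_left₀ _ hγ]
  have hh : ∀ N M : ℤ, -M ≤ N → N + 1 ≤ M → phi J R u N M / γ - phi J R u N (M - 1) / γ =
      R N M * (u N M + J * u N (M - 1)) := by
    intro N M h1 h2
    rw [← sub_div, (phi_sub_phi_horiz_iff hR hJ γ (hu.horiz N M h1 h2)
      (hsq _ _ (by omega) (by omega)) (hsq _ _ (by omega) (by omega))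
      (hu.ne_zero (by omega) (by omega))).2 (rightEq_of_mem hR hsq hst N M h1 (by omega)),
      mul_div_cancel_left₀ _ hγ]
  -- The constraint `γ g = phi` at odd points is solved for `g`; `hv` and `hh` say that the
  -- increments are those of a cross field.
  refine ⟨fun N M => phi J R u N M / γ - R N M * u N M, fun N M => phi J R u N M / γ, ?_, ?_⟩
  · simp only
    rw [phi_zero hR (hsq 0 0 (by norm_num) le_rfl), mul_div_cancel_left₀ _ hγ, sub_self]
  · refine ⟨hu.norm, fun _ _ _ _ => rfl, fun N M h1 h2 => ?_, fun N M h1 h2 => ?_,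
      fun N M h1 h2 => ?_⟩
    · have := hv (N + 1) M (by omega) h2
      rw [add_sub_cancel_right] at this
      linear_combination this
    · have e1 := hv (N + 1) (M + 1) (by omega) (by omega)
      have e2 := hh N (M + 1) (by omega) (by omega)
      have e3 := hu.horiz N (M + 1) (by omega) (by omega)
      rw [add_sub_cancel_right] at e1 e2 e3
      linear_combination e1 + e2 - e3
    · have := hh N (M + 1) (by omega) (by omega)
      rw [add_sub_cancel_right] at this
      linear_combination this

/-- In a pattern with the center `0` at the origin the constraint holds. -/
lemma IsCrossField.satisfiesConstraint {J : ℂ} (hJ : J * J = -1) {c g u f : ℤ → ℤ → ℂ}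
    (h : IsCrossField J R c g u)
    (hc : ∀ N M : ℤ, -M ≤ N → N ≤ M → f (N + M) (M - N) = c N M)
    (hg : ∀ N M : ℤ, -M - 1 ≤ N → N ≤ M → f (N + M + 1) (M - N) = g N M) (h0 : c 0 0 = 0) :
    SatisfiesConstraint γ f := by
  have hu := h.isDirection
  -- `γ g` and `phi` have the same increments across each even point, so their difference is
  -- constant; at the origin it vanishes because of `c 0 0 = 0`.
  have hodd : ∀ N M : ℤ, -M - 1 ≤ N → N ≤ M → γ * g N M - phi J R u N M = 0 := by
    intro N M h1 h2
    rw [const_of_adj (F := fun N M => γ * g N M - phi J R u N M) ?_ ?_ N M h1 h2]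
    · have := h.base 0 0 (by norm_num) le_rfl
      rw [phi_zero hR (hsq 0 0 (by norm_num) le_rfl)]
      linear_combination γ * h0 - γ * this
    · intro N M h1 h2
      have e := phi_sub_phi_vert hR hJ γ (hu.vert N M h1 h2) (hsq _ _ (by omega) h2)
        (hsq _ _ (by omega) (by omega)) (upEq_of_mem hR hsq hst N M h1 h2)
      have e1 := h.base N M h1 h2
      have e2 := h.right (N - 1) M (by omega) (by omega)
      rw [sub_add_cancel] at e2
      linear_combination e + γ * e1 - γ * e2
    · intro M hM
      have e := (phi_sub_phi_horiz_iff hR hJ γ (hu.horiz 0 M (by omega) (by omega))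
        (hsq _ _ (by omega) (by omega)) (hsq _ _ (by omega) (by omega))
        (h.u_ne_zero (by omega) (by omega))).2 (rightEq_of_mem hR hsq hst 0 M (by omega) (by omega))
      have e1 := h.base 0 M (by omega) (by omega)
      have e2 := h.top 0 (M - 1) (by omega) (by omega)
      rw [sub_add_cancel] at e2
      linear_combination e + γ * e1 - γ * e2
  intro n m hn hm
  by_cases he : Even (n + m)
  · obtain ⟨M, hM⟩ := he
    obtain ⟨N, rfl⟩ : ∃ N, n = N + M := ⟨n - M, by ring⟩
    obtain rfl : m = M - N := by omega
    obtain ⟨k1, k2, k3⟩ := h.constraint_even hJ hR hc hg (N := N) (M := M) (by omega) (by omega)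
      rfl rfl
    refine ⟨k1, k2, ?_⟩
    rw [k3, hc N M (by omega) (by omega)]
    have e := (phi_sub_psi_eq_iff (u := u) hR hJ γ (h.u_ne_zero (N := N) (M := M) (by omega)
      (by omega))).2 ⟨hsq N M (by omega) (by omega), upEq_of_mem hR hsq hst N M (by omega) (by omega)⟩
    have e1 := h.base N M (by omega) (by omega)
    have e2 := hodd N M (by omega) (by omega)
    linear_combination γ * e1 + e2 + e
  · obtain ⟨M, hM⟩ := Int.not_even_iff_odd.1 he
    obtain ⟨N, rfl⟩ : ∃ N, n = N + M + 1 := ⟨n - M - 1, by ring⟩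
    obtain rfl : m = M - N := by omega
    obtain ⟨k1, k2, k3⟩ := h.constraint_odd hJ hR hc hg (N := N) (M := M) (by omega) (by omega)
      rfl rfl
    refine ⟨k1, k2, ?_⟩
    rw [k3, hg N M (by omega) (by omega)]
    have e2 := hodd N M (by omega) (by omega)
    linear_combination e2

end

/-! ### Cross fields and circle patterns -/

/-- Two externally tangent circles have exactly one common point. -/
lemma sphere_inter_sphere {p v : ℂ} (hv : ‖v‖ = 1) {r s : ℝ} (hr : 0 < r) (hs : 0 < s) :
    Metric.sphere (p - r * v) r ∩ Metric.sphere (p + s * v) s = {p} := by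
  have hn := Complex.mul_conj' v
  rw [hv] at hn
  ext x
  simp only [Set.mem_inter_iff, Metric.mem_sphere, dist_eq, Set.mem_singleton_iff]
  constructor
  · rintro ⟨h1, h2⟩
    have h1' := Complex.mul_conj' (x - (p - r * v))
    have h2' := Complex.mul_conj' (x - (p + s * v))
    rw [h1] at h1'
    rw [h2] at h2'
    simp only [map_sub, map_add, map_mul, conj_ofReal] at h1' h2' hn
    -- In `s` times the first circle equation plus `r` times the second the terms linear in `x - p`
    -- cancel, leaving `(s + r) * |x - p| ^ 2 = 0`.
    have h3 : ((s : ℂ) + r) * ((x - p) * (starRingEnd ℂ) (x - p)) = 0 := by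
      simp only [map_sub]
      push_cast at hn
      linear_combination (s : ℂ) * h1' + r * h2' - (s * r ^ 2 + r * s ^ 2 : ℂ) * hn
    have h4 : (s : ℂ) + r ≠ 0 := by exact_mod_cast (add_pos hs hr).ne'
    have h5 := (mul_eq_zero.1 h3).resolve_left h4
    rw [Complex.mul_conj, ofReal_eq_zero, normSq_eq_zero] at h5
    exact sub_eq_zero.1 h5
  · rintro rfl
    constructor
    · rw [sub_sub_cancel, norm_mul, hv, norm_real, Real.norm_of_nonneg hr.le, mul_one]
    · rw [sub_add_cancel_left, norm_neg, norm_mul, hv, norm_real, Real.norm_of_nonneg hs.le, mul_one]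

lemma disjoint_balls {p v : ℂ} (hv : ‖v‖ = 1) {r s : ℝ} (hr : 0 < r) (hs : 0 < s) :
    Disjoint (Metric.ball (p - r * v) r) (Metric.ball (p + s * v) s) := by
  refine Metric.ball_disjoint_ball ?_
  have : p - r * v - (p + s * v) = -(((r + s : ℝ) : ℂ) * v) := by push_cast; ring
  rw [dist_eq, this, norm_neg, norm_mul, hv, norm_real, Real.norm_of_nonneg (by positivity), mul_one]

namespace IsCrossField

variable {J : ℂ} {R : ℤ → ℤ → ℝ} {c g u : ℤ → ℤ → ℂ} (hJ : J * J = -1)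
  (h : IsCrossField J R c g u) (hR : ∀ N M, 0 < R N M)
include h hR

lemma circ_inter_diag {N M : ℤ} (h1 : -M ≤ N) (h2 : N ≤ M) :
    circ c R N M ∩ circ c R (N + 1) (M + 1) = {g N M} := by
  unfold circ
  rw [h.base N M h1 h2, h.diag N M (by omega) h2]
  exact sphere_inter_sphere (h.norm N M (by omega) h2) (hR _ _) (hR _ _)

lemma disjoint_diag {N M : ℤ} (h1 : -M ≤ N) (h2 : N ≤ M) :
    Disjoint (Metric.ball (c N M) (R N M)) (Metric.ball (c (N + 1) (M + 1)) (R (N + 1) (M + 1))) := by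
  rw [h.base N M h1 h2, h.diag N M (by omega) h2]
  exact disjoint_balls (h.norm N M (by omega) h2) (hR _ _) (hR _ _)

include hJ

omit hR in
lemma norm_J_mul {N M : ℤ} (h1 : -M - 1 ≤ N) (h2 : N ≤ M) : ‖J * u N M‖ = 1 := by
  rw [norm_mul, norm_of_sq hJ, h.norm N M h1 h2, one_mul]

lemma circ_inter_antidiag {N M : ℤ} (h1 : -M - 1 ≤ N) (h2 : N + 1 ≤ M) :
    circ c R (N + 1) M ∩ circ c R N (M + 1) = {g N M} := by
  unfold circ
  have e1 : c (N + 1) M = g N M - R (N + 1) M * (J * u N M) := by rw [h.right N M h1 h2]; ring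
  have e2 : c N (M + 1) = g N M + R N (M + 1) * (J * u N M) := by
    rw [h.top N M h1 (by omega)]; ring
  rw [e1, e2]
  exact sphere_inter_sphere (h.norm_J_mul hJ h1 (by omega)) (hR _ _) (hR _ _)

lemma disjoint_antidiag {N M : ℤ} (h1 : -M - 1 ≤ N) (h2 : N + 1 ≤ M) :
    Disjoint (Metric.ball (c (N + 1) M) (R (N + 1) M)) (Metric.ball (c N (M + 1)) (R N (M + 1))) := by
  have e1 : c (N + 1) M = g N M - R (N + 1) M * (J * u N M) := by rw [h.right N M h1 h2]; ring
  have e2 : c N (M + 1) = g N M + R N (M + 1) * (J * u N M) := by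
    rw [h.top N M h1 (by omega)]; ring
  rw [e1, e2]
  exact disjoint_balls (h.norm_J_mul hJ h1 (by omega)) (hR _ _) (hR _ _)

omit hR in
lemma dist_vert {N M : ℤ} (h1 : -M ≤ N) (h2 : N ≤ M) :
    dist (c N M) (c N (M + 1)) ^ 2 = R N M ^ 2 + R N (M + 1) ^ 2 := by
  have : c N M - c N (M + 1) = -((R N M + J * R N (M + 1)) * u N M) := by
    rw [h.base N M h1 h2, h.top N M (by omega) h2]; ring
  rw [dist_eq, this, norm_neg, norm_mul, h.norm N M (by omega) h2, mul_one, norm_add_mul hJ]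

omit hR in
lemma dist_horiz {N M : ℤ} (h1 : -M ≤ N) (h2 : N + 1 ≤ M) :
    dist (c N M) (c (N + 1) M) ^ 2 = R N M ^ 2 + R (N + 1) M ^ 2 := by
  have : c N M - c (N + 1) M = -((R N M + J * (-R (N + 1) M : ℝ)) * u N M) := by
    rw [h.base N M h1 (by omega), h.right N M (by omega) h2]; push_cast; ring
  rw [dist_eq, this, norm_neg, norm_mul, h.norm N M (by omega) (by omega), mul_one, norm_add_mul hJ,
    neg_sq]

/-- The two odd corners of a kite are points where one circle is touched by two others; that they
differ is what the no-fold condition requires. -/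
lemma g_ne_vert {N M : ℤ} (h1 : -M ≤ N) (h2 : N ≤ M) : g N M ≠ g (N - 1) M := by
  intro h0
  have k := h.kite_even hJ hR h1 h2
  obtain ⟨hne, t, ht, e1, e2⟩ := k
  rw [← h0] at e2
  have : J * t * (g N M - c N M) = 0 := by linear_combination (e2 - e1) / 2
  have ht' : (t : ℂ) ≠ 0 := by exact_mod_cast ht.ne'
  exact mul_ne_zero (mul_ne_zero (ne_zero_of_sq hJ) ht') (sub_ne_zero.2 hne.symm) this

lemma g_ne_horiz {N M : ℤ} (h1 : -M ≤ N) (h2 : N + 1 ≤ M) : g N M ≠ g N (M - 1) := by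
  intro h0
  have k := h.kite_odd hJ hR (N := N) (M := M - 1) (by omega) (by omega)
  rw [sub_add_cancel] at k
  obtain ⟨hne, t, ht, e1, e2⟩ := k
  rw [← h0] at e2
  have : J * t * (g N M - c (N + 1) M) = 0 := by linear_combination (e2 - e1) / 2
  have ht' : (t : ℂ) ≠ 0 := by exact_mod_cast ht.ne'
  exact mul_ne_zero (mul_ne_zero (ne_zero_of_sq hJ) ht') (sub_ne_zero.2 hne.symm) this

end IsCrossField

/-! ### Index ranges and lattice vectors -/

lemma inV_iff {N M : ℤ} : InV N M ↔ -M ≤ N ∧ N ≤ M := abs_le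

lemma inVl_iff {N M : ℤ} : InVl N M ↔ -M - 1 ≤ N ∧ N ≤ M := by
  unfold InVl
  rw [inV_iff]
  constructor
  · rintro (h | ⟨k, hk, rfl, rfl⟩) <;> omega
  · rintro ⟨h1, h2⟩
    by_cases h : -M ≤ N
    · exact Or.inl ⟨h, h2⟩
    · exact Or.inr ⟨(M + 1).toNat, by omega, by omega, by omega⟩

lemma inVint_iff {N M : ℤ} : InVint N M ↔ -M < N ∧ N < M := by
  unfold InVint
  rw [inV_iff]
  constructor
  · rintro ⟨⟨h1, h2⟩, h3⟩
    have : ¬ (N = M ∨ N = -M) := fun h => h3 ⟨M.toNat, by omega, by omega⟩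
    omega
  · rintro ⟨h1, h2⟩
    refine ⟨by omega, ?_⟩
    rintro ⟨k, h, h'⟩
    omega

lemma int_unit {a b : ℤ} (h : a ^ 2 + b ^ 2 = 1) :
    (a = 1 ∧ b = 0) ∨ (a = -1 ∧ b = 0) ∨ (a = 0 ∧ b = 1) ∨ (a = 0 ∧ b = -1) := by
  have h1 : -1 ≤ a := by nlinarith [sq_nonneg b]
  have h2 : a ≤ 1 := by nlinarith [sq_nonneg b]
  have h3 : -1 ≤ b := by nlinarith [sq_nonneg a]
  have h4 : b ≤ 1 := by nlinarith [sq_nonneg a]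
  interval_cases a <;> interval_cases b <;> simp_all

lemma int_diagonal {a b : ℤ} (h : a ^ 2 + b ^ 2 = 2) :
    (a = 1 ∧ b = 1) ∨ (a = -1 ∧ b = -1) ∨ (a = 1 ∧ b = -1) ∨ (a = -1 ∧ b = 1) := by
  have h1 : -1 ≤ a := by nlinarith [sq_nonneg b]
  have h2 : a ≤ 1 := by nlinarith [sq_nonneg b]
  have h3 : -1 ≤ b := by nlinarith [sq_nonneg a]
  have h4 : b ≤ 1 := by nlinarith [sq_nonneg a]
  interval_cases a <;> interval_cases b <;> simp_all

section
variable {J : ℂ} {R : ℤ → ℤ → ℝ} {c g u : ℤ → ℤ → ℂ}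

lemma IsCrossField.isImmersedPattern (hJ : J * J = -1) (h : IsCrossField J R c g u)
    (hR : ∀ N M, 0 < R N M) : IsImmersedPattern c R where
  pos N M _ := hR N M
  orthogonal N M N' M' h1 h2 he := by
    rw [inV_iff] at h1 h2
    rcases int_unit he with ⟨ha, hb⟩ | ⟨ha, hb⟩ | ⟨ha, hb⟩ | ⟨ha, hb⟩
    · obtain rfl : N = N' + 1 := by omega
      obtain rfl : M = M' := by omega
      rw [dist_comm, h.dist_horiz hJ h2.1 h1.2, add_comm]
    · obtain rfl : N' = N + 1 := by omega
      obtain rfl : M = M' := by omega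
      exact h.dist_horiz hJ h1.1 h2.2
    · obtain rfl : M = M' + 1 := by omega
      obtain rfl : N = N' := by omega
      rw [dist_comm, h.dist_vert hJ h2.1 h2.2, add_comm]
    · obtain rfl : M' = M + 1 := by omega
      obtain rfl : N = N' := by omega
      exact h.dist_vert hJ h1.1 h1.2
  tangent N M N' M' h1 h2 he := by
    rw [inV_iff] at h1 h2
    rcases int_diagonal he with ⟨ha, hb⟩ | ⟨ha, hb⟩ | ⟨ha, hb⟩ | ⟨ha, hb⟩
    · obtain rfl : N = N' + 1 := by omega
      obtain rfl : M = M' + 1 := by omega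
      rw [Set.inter_comm]
      exact ⟨_, h.circ_inter_diag hR h2.1 h2.2⟩
    · obtain rfl : N' = N + 1 := by omega
      obtain rfl : M' = M + 1 := by omega
      exact ⟨_, h.circ_inter_diag hR h1.1 h1.2⟩
    · obtain rfl : N = N' + 1 := by omega
      obtain rfl : M' = M + 1 := by omega
      exact ⟨_, h.circ_inter_antidiag hJ hR (by omega) h1.2⟩
    · obtain rfl : N' = N + 1 := by omega
      obtain rfl : M = M' + 1 := by omega
      rw [Set.inter_comm]
      exact ⟨_, h.circ_inter_antidiag hJ hR (by omega) h2.2⟩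
  disjoint_discs N M N' M' h1 h2 he := by
    rw [inV_iff] at h1 h2
    rcases int_diagonal he with ⟨ha, hb⟩ | ⟨ha, hb⟩ | ⟨ha, hb⟩ | ⟨ha, hb⟩
    · obtain rfl : N = N' + 1 := by omega
      obtain rfl : M = M' + 1 := by omega
      exact (h.disjoint_diag hR h2.1 h2.2).symm
    · obtain rfl : N' = N + 1 := by omega
      obtain rfl : M' = M + 1 := by omega
      exact h.disjoint_diag hR h1.1 h1.2
    · obtain rfl : N = N' + 1 := by omega
      obtain rfl : M' = M + 1 := by omega
      exact h.disjoint_antidiag hJ hR (by omega) h1.2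
    · obtain rfl : N' = N + 1 := by omega
      obtain rfl : M = M' + 1 := by omega
      exact (h.disjoint_antidiag hJ hR (by omega) h2.2).symm
  no_fold N M a b he h0 h1 h2 h3 := by
    have key : ∀ {A B C : Set ℂ} {p q : ℂ}, A ∩ B = {p} → C ∩ B = {q} → p ≠ q →
        A ∩ B ∩ C = ∅ := by
      intro A B C p q hp hq hne
      rw [Set.eq_empty_iff_forall_notMem]
      rintro x ⟨hx, hx'⟩
      have e1 : x ∈ ({p} : Set ℂ) := hp ▸ hx
      have e2 : x ∈ ({q} : Set ℂ) := hq ▸ ⟨hx', hx.2⟩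
      exact hne (e1.symm.trans e2)
    rw [inV_iff] at h0 h1 h2 h3
    rcases int_unit he with ⟨rfl, rfl⟩ | ⟨rfl, rfl⟩ | ⟨rfl, rfl⟩ | ⟨rfl, rfl⟩
    · simp only [add_zero, sub_zero] at *
      refine key (h.circ_inter_antidiag hJ hR (by omega) h1.2) ?_ (h.g_ne_vert hJ hR h0.1 h0.2)
      have := h.circ_inter_diag hR h3.1 h3.2
      rwa [sub_add_cancel] at this
    · simp only [add_zero, sub_zero, sub_neg_eq_add, ← sub_eq_add_neg] at *
      have e1 := h.circ_inter_antidiag hJ hR (N := N - 1) (M := M - 1) (by omega) (by omega)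
      have e2 := h.circ_inter_diag hR h2.1 h2.2
      rw [sub_add_cancel] at e1 e2
      rw [sub_add_cancel] at e1
      rw [Set.inter_comm] at e1 e2
      exact key e1 e2 (h.g_ne_vert hJ hR h2.1 h2.2).symm
    · simp only [add_zero, sub_zero] at *
      have e1 := h.circ_inter_diag hR h2.1 h2.2
      have e2 := h.circ_inter_antidiag hJ hR (N := N - 1) (M := M - 1) (by omega) (by omega)
      rw [sub_add_cancel] at e1 e2
      rw [sub_add_cancel] at e2
      rw [Set.inter_comm] at e1
      exact key e1 e2 (h.g_ne_horiz hJ hR (by omega) (by omega))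
    · simp only [add_zero, sub_zero, sub_neg_eq_add, ← sub_eq_add_neg] at *
      have e1 := h.circ_inter_diag hR h1.1 h1.2
      have e2 := h.circ_inter_antidiag hJ hR (N := N) (M := M) (by omega) (by omega)
      rw [sub_add_cancel] at e1
      rw [Set.inter_comm] at e2
      exact key e1 e2 (h.g_ne_horiz hJ hR (by omega) (by omega)).symm

/-- The map of a pattern consists of the centers and of the points where the circles touch. -/
lemma IsCrossField.isMapOfPattern_iff (hJ : J * J = -1) (h : IsCrossField J R c g u)
    (hR : ∀ N M, 0 < R N M) (f : ℤ → ℤ → ℂ) : IsMapOfPattern c R f ↔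
      (∀ N M : ℤ, -M ≤ N → N ≤ M → f (N + M) (M - N) = c N M) ∧
      (∀ N M : ℤ, -M - 1 ≤ N → N ≤ M → f (N + M + 1) (M - N) = g N M) := by
  have hd : ∀ {N M : ℤ}, -M ≤ N → N ≤ M →
      circ c R N M ∩ circ c R (N - 1) (M + 1) = {g (N - 1) M} := by
    intro N M h1 h2
    have := h.circ_inter_antidiag hJ hR (N := N - 1) (M := M) (by omega) (by omega)
    rwa [sub_add_cancel] at this
  constructor
  · intro H
    refine ⟨fun N M h1 h2 => (H N M (inV_iff.2 ⟨h1, h2⟩)).1, fun N M h1 h2 => ?_⟩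
    by_cases hN : -M ≤ N
    · have := (H N M (inV_iff.2 ⟨hN, h2⟩)).2.1
      rw [h.circ_inter_diag hR hN h2, Set.singleton_eq_singleton_iff] at this
      exact this.symm
    · have := (H (N + 1) M (inV_iff.2 (by omega))).2.2
      rw [hd (by omega) (by omega), Set.singleton_eq_singleton_iff, add_sub_cancel_right] at this
      rw [this]; congr 1 <;> ring
  · rintro ⟨hc, hg⟩ N M hV
    rw [inV_iff] at hV
    refine ⟨hc N M hV.1 hV.2, ?_, ?_⟩
    · rw [h.circ_inter_diag hR hV.1 hV.2, hg N M (by omega) hV.2]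
    · rw [hd hV.1 hV.2, ← hg (N - 1) M (by omega) (by omega)]
      congr 2 <;> ring

lemma exists_map (c g : ℤ → ℤ → ℂ) : ∃ f : ℤ → ℤ → ℂ,
    (∀ N M : ℤ, f (N + M) (M - N) = c N M) ∧ ∀ N M : ℤ, f (N + M + 1) (M - N) = g N M := by
  refine ⟨fun n m => if Even (n + m) then c ((n - m) / 2) ((n + m) / 2) else
    g ((n - 1 - m) / 2) ((n - 1 + m) / 2), fun N M => ?_, fun N M => ?_⟩
  · have : Even (N + M + (M - N)) := ⟨M, by ring⟩
    simp only [this, if_true]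
    congr 1 <;> omega
  · have : ¬ Even (N + M + 1 + (M - N)) := by
      rw [Int.not_even_iff_odd]; exact ⟨M, by ring⟩
    simp only [this, if_false]
    congr 1 <;> omega

end

/-! ### From a circle pattern to a cross field -/

lemma exists_tangency {c₀ c₃ : ℂ} {r₀ r₃ : ℝ} (h0 : 0 < r₀) (h3 : 0 < r₃)
    (h : dist c₀ c₃ = r₀ + r₃) :
    ∃ p u : ℂ, ‖u‖ = 1 ∧ c₀ = p - r₀ * u ∧ c₃ = p + r₃ * u := by
  have hs : (0 : ℝ) < r₀ + r₃ := by positivity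
  have hs' : (r₀ : ℂ) + r₃ ≠ 0 := by exact_mod_cast hs.ne'
  refine ⟨c₀ + r₀ * ((c₃ - c₀) / (r₀ + r₃)), (c₃ - c₀) / (r₀ + r₃), ?_, by ring, ?_⟩
  · rw [norm_div, ← dist_eq, dist_comm, h, ← ofReal_add, norm_real, Real.norm_of_nonneg hs.le,
      div_self hs.ne']
  · field_simp
    ring

/-- In the coordinate `w = (c - p) / u` the difference of the two orthogonality relations gives
`w.re = 0`, and then either of them gives `w.im = ± r`. -/
lemma exists_normal {p u c : ℂ} (hu : ‖u‖ = 1) {r₀ r₃ r : ℝ} (h0 : 0 < r₀) (h3 : 0 < r₃)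
    (h1 : dist (p - r₀ * u) c ^ 2 = r₀ ^ 2 + r ^ 2) (h2 : dist (p + r₃ * u) c ^ 2 = r₃ ^ 2 + r ^ 2) :
    ∃ J : ℂ, J * J = -1 ∧ c = p + J * r * u := by
  have hu0 : u ≠ 0 := by rintro rfl; simp at hu
  obtain ⟨w, hw⟩ : ∃ w, c = p + w * u := ⟨(c - p) / u, by field_simp; ring⟩
  have e1 : p - r₀ * u - c = -((r₀ + w) * u) := by rw [hw]; ring
  have e2 : p + r₃ * u - c = (r₃ - w) * u := by rw [hw]; ring
  rw [dist_eq, e1, norm_neg, norm_mul, hu, mul_one, ← normSq_eq_norm_sq, normSq_apply] at h1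
  rw [dist_eq, e2, norm_mul, hu, mul_one, ← normSq_eq_norm_sq, normSq_apply] at h2
  simp only [add_re, add_im, sub_re, sub_im, ofReal_re, ofReal_im] at h1 h2
  have hre : w.re = 0 := by
    have : 2 * (r₀ + r₃) * w.re = 0 := by linear_combination h1 - h2
    have hs : (2 : ℝ) * (r₀ + r₃) ≠ 0 := by positivity
    exact (mul_eq_zero.1 this).resolve_left hs
  have him : (w.im - r) * (w.im + r) = 0 := by
    rw [hre] at h1
    linear_combination h1
  rcases mul_eq_zero.1 him with h | h
  · refine ⟨I, I_mul_I, ?_⟩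
    have : w = I * r := by apply Complex.ext <;> simp [hre]; linarith
    rw [hw, this]
  · refine ⟨-I, by simp, ?_⟩
    have : w = -I * r := by apply Complex.ext <;> simp [hre]; linarith
    rw [hw, this]

/-- On the same side of the line, the centers would be at distance `|r - r'|`, which is less than `r
+ r'`. -/
lemma eq_neg_of_opposite {p u J J' : ℂ} (hJ : J * J = -1) (hJ' : J' * J' = -1) (hu : ‖u‖ = 1)
    {r r' : ℝ} (hr : 0 < r) (hr' : 0 < r')
    (h : dist (p + J * r * u) (p + J' * r' * u) = r + r') : J' = -J := by
  by_contra hne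
  have hJJ : J' = J := by
    rcases eq_I_or_neg_I hJ with rfl | rfl <;> rcases eq_I_or_neg_I hJ' with rfl | rfl <;> simp_all
  subst hJJ
  have : p + J' * r * u - (p + J' * r' * u) = J' * ((r - r' : ℝ) : ℂ) * u := by push_cast; ring
  rw [dist_eq, this, norm_mul, norm_mul, hu, norm_of_sq hJ, norm_real, one_mul, mul_one,
    Real.norm_eq_abs] at h
  rcases abs_cases (r - r') with h' | h' <;> linarith

namespace IsImmersedPattern

variable {R : ℤ → ℤ → ℝ} {c : ℤ → ℤ → ℂ} (h : IsImmersedPattern c R)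
include h

lemma dist_of_diagonal {N M N' M' : ℤ} (h1 : InV N M) (h2 : InV N' M')
    (he : (N - N') ^ 2 + (M - M') ^ 2 = 2) : dist (c N M) (c N' M') = R N M + R N' M' := by
  refine le_antisymm ?_ ?_
  · obtain ⟨p, hp⟩ := h.tangent N M N' M' h1 h2 he
    have hm : p ∈ circ c R N M ∩ circ c R N' M' := by rw [hp]; rfl
    have e1 : dist p (c N M) = R N M := hm.1
    have e2 : dist p (c N' M') = R N' M' := hm.2
    rw [← e1, ← e2, dist_comm p (c N M)]
    exact dist_triangle _ _ _
  · exact (disjoint_ball_ball_iff (h.pos _ _ h1) (h.pos _ _ h2)).1 (h.disjoint_discs _ _ _ _ h1 h2 he)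

/-- Two tangent circles determine the point and the direction, and orthogonality puts the other
centers on the perpendicular. The orientation `J` is found for each point separately. -/
lemma exists_cross {N M : ℤ} (h1 : -M - 1 ≤ N) (h2 : N ≤ M) :
    ∃ J p u : ℂ, J * J = -1 ∧ ‖u‖ = 1 ∧ (-M ≤ N → c N M = p - R N M * u) ∧
      (N + 1 ≤ M → c (N + 1) M = p - J * R (N + 1) M * u) ∧
      c (N + 1) (M + 1) = p + R (N + 1) (M + 1) * u ∧ c N (M + 1) = p + J * R N (M + 1) * u := by
  have v3 : InV (N + 1) (M + 1) := inV_iff.2 (by omega)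
  have v2 : InV N (M + 1) := inV_iff.2 (by omega)
  have p3 := h.pos _ _ v3
  have p2 := h.pos _ _ v2
  have o23 := h.orthogonal _ _ _ _ v3 v2 (by ring)
  by_cases hN : -M ≤ N
  · have v0 : InV N M := inV_iff.2 (by omega)
    have p0 := h.pos _ _ v0
    obtain ⟨p, u, hu, e0, e3⟩ := exists_tangency p0 p3 (h.dist_of_diagonal v0 v3 (by ring))
    have o02 := h.orthogonal _ _ _ _ v0 v2 (by ring)
    rw [e0] at o02
    rw [e3] at o23
    obtain ⟨J, hJ, e2⟩ := exists_normal hu p0 p3 o02 o23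
    refine ⟨J, p, u, hJ, hu, fun _ => e0, fun hN' => ?_, e3, e2⟩
    have v1 : InV (N + 1) M := inV_iff.2 (by omega)
    have p1 := h.pos _ _ v1
    have o01 := h.orthogonal _ _ _ _ v0 v1 (by ring)
    have o31 := h.orthogonal _ _ _ _ v3 v1 (by ring)
    rw [e0] at o01
    rw [e3] at o31
    obtain ⟨J', hJ', e1⟩ := exists_normal hu p0 p3 o01 o31
    have d := h.dist_of_diagonal v2 v1 (by ring)
    rw [e2, e1] at d
    rw [e1, eq_neg_of_opposite hJ hJ' hu p2 p1 d]
    ring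
  · have v1 : InV (N + 1) M := inV_iff.2 (by omega)
    have p1 := h.pos _ _ v1
    obtain ⟨p, u, hu, e1, e2⟩ := exists_tangency p1 p2 (h.dist_of_diagonal v1 v2 (by ring))
    have o13 := h.orthogonal _ _ _ _ v1 v3 (by ring)
    have o23 := h.orthogonal _ _ _ _ v2 v3 (by ring)
    rw [e1] at o13
    rw [e2] at o23
    obtain ⟨J, hJ, e3⟩ := exists_normal hu p1 p2 o13 o23
    -- The center at `(N, M)` is missing here, so the cross was built on the other diagonal; a
    -- quarter turn brings it to the standard form.
    refine ⟨-J, p, J * u, by linear_combination hJ, by rw [norm_mul, norm_of_sq hJ, hu, one_mul],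
      fun h' => absurd h' hN, fun _ => ?_, ?_, ?_⟩
    · rw [e1]; linear_combination (-R (N + 1) M * u : ℂ) * hJ
    · rw [e3]; ring
    · rw [e2]; linear_combination (R N (M + 1) * u : ℂ) * hJ

/-- Every immersed pattern has a field of crosses. -/
lemma exists_isCrossField : ∃ (J : ℂ) (g u : ℤ → ℤ → ℂ), J * J = -1 ∧ IsCrossField J R c g u := by
  have H : ∀ N M : ℤ, ∃ J p u : ℂ, -M - 1 ≤ N → N ≤ M → (J * J = -1 ∧ ‖u‖ = 1 ∧
      (-M ≤ N → c N M = p - R N M * u) ∧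
      (N + 1 ≤ M → c (N + 1) M = p - J * R (N + 1) M * u) ∧
      c (N + 1) (M + 1) = p + R (N + 1) (M + 1) * u ∧
      c N (M + 1) = p + J * R N (M + 1) * u) := by
    intro N M
    by_cases h1 : -M - 1 ≤ N ∧ N ≤ M
    · obtain ⟨J, p, u, H⟩ := h.exists_cross h1.1 h1.2
      exact ⟨J, p, u, fun _ _ => H⟩
    · exact ⟨0, 0, 0, fun a b => absurd ⟨a, b⟩ h1⟩
  choose J g u H using H
  have mem : ∀ {x p v : ℂ} {r : ℝ}, 0 < r → ‖v‖ = 1 → x = p + r * v → dist p x = r := by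
    intro x p v r hr hv hx
    rw [hx, dist_eq, sub_add_cancel_left, norm_neg, norm_mul, hv, norm_real,
      Real.norm_of_nonneg hr.le, mul_one]
  -- If `J` changed sign between neighbouring odd points, the two crosses would force these points
  -- to coincide. Three successive circles around a vertex would then meet there, against `no_fold`.
  have hconst : ∀ N M : ℤ, -M - 1 ≤ N → N ≤ M → J N M = J 0 0 := by
    refine fun N M => const_of_adj ?_ ?_ N M
    · intro N M h1 h2
      obtain ⟨hJ, hu, a0, a1, a3, a2⟩ := H N M (by omega) h2
      obtain ⟨hJ', hu', b0, b1, b3, b2⟩ := H (N - 1) M (by omega) (by omega)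
      rw [sub_add_cancel] at b1 b3
      have a0 := a0 h1
      have b1 := b1 h2
      by_contra hne
      have hneg : J (N - 1) M = -J N M := by
        rcases eq_I_or_neg_I hJ with e | e <;> rcases eq_I_or_neg_I hJ' with e' | e' <;> simp_all
      rw [hneg] at b1 b2
      have v0 : InV N M := inV_iff.2 ⟨h1, h2⟩
      have v2 : InV N (M + 1) := inV_iff.2 (by omega)
      have v3 : InV (N + 1) (M + 1) := inV_iff.2 (by omega)
      have v4 : InV (N - 1) (M + 1) := inV_iff.2 (by omega)
      have huu : u N M = -(J N M * u (N - 1) M) := by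
        refine mul_left_cancel₀ (add_mul_ne_zero hJ (h.pos _ _ v0).ne' (R N (M + 1))) ?_
        linear_combination a0 - a2 + b3 - b1 + (R N (M + 1) * u (N - 1) M : ℂ) * hJ
      have hp : g N M = g (N - 1) M := by
        linear_combination b1 - a0 + (R N M : ℂ) * huu
      have hf := h.no_fold N (M + 1) (-1) 0 (by norm_num) v2 (by simpa [← sub_eq_add_neg] using v4) (by simpa using v0)
        (by simpa using v3)
      rw [Set.eq_empty_iff_forall_notMem] at hf
      refine hf (g N M) ⟨⟨?_, ?_⟩, ?_⟩
      · rw [hp]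
        simp only [add_zero, ← sub_eq_add_neg]
        exact mem (h.pos _ _ v4) (v := -J N M * u (N - 1) M)
          (by rw [norm_mul, norm_neg, norm_of_sq hJ, hu', one_mul]) (by rw [b2]; ring)
      · simp only [sub_zero, add_neg_cancel_right]
        exact mem (h.pos _ _ v0) (v := -u N M) (by rw [norm_neg, hu]) (by rw [a0]; ring)
      · simp only [sub_zero, sub_neg_eq_add]
        exact mem (h.pos _ _ v3) hu a3
    · intro M hM
      obtain ⟨hJ, hu, a0, a1, a3, a2⟩ := H 0 M (by omega) (by omega)
      obtain ⟨hJ', hu', b0, b1, b3, b2⟩ := H 0 (M - 1) (by omega) (by omega)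
      rw [sub_add_cancel] at b2 b3
      have a0 := a0 (by omega)
      have a1 := a1 (by omega)
      have b0 := b0 (by omega)
      by_contra hne
      have hneg : J 0 (M - 1) = -J 0 M := by
        rcases eq_I_or_neg_I hJ with e | e <;> rcases eq_I_or_neg_I hJ' with e' | e' <;> simp_all
      rw [hneg] at b2
      have v0 : InV 0 M := inV_iff.2 (by omega)
      have v1 : InV (0 + 1) M := inV_iff.2 (by omega)
      have v2 : InV 0 (M + 1) := inV_iff.2 (by omega)
      have v5 : InV 0 (M - 1) := inV_iff.2 (by omega)
      have huu : u 0 M = J 0 M * u 0 (M - 1) := by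
        refine mul_left_cancel₀ (sub_mul_ne_zero hJ (h.pos _ _ v0).ne' (R (0 + 1) M)) ?_
        linear_combination a0 - a1 + b3 - b2 + (R (0 + 1) M * u 0 (M - 1) : ℂ) * hJ
      have hp : g 0 M = g 0 (M - 1) := by
        linear_combination b2 - a0 + (R 0 M : ℂ) * huu
      have hf := h.no_fold 0 M 0 (-1) (by norm_num) v0 (by simpa [← sub_eq_add_neg] using v5) (by simpa using v1)
        (by simpa using v2)
      rw [Set.eq_empty_iff_forall_notMem] at hf
      refine hf (g 0 M) ⟨⟨?_, ?_⟩, ?_⟩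
      · rw [hp]
        simp only [add_zero, ← sub_eq_add_neg]
        exact mem (h.pos _ _ v5) (v := -u 0 (M - 1)) (by rw [norm_neg, hu']) (by rw [b0]; ring)
      · simp only [add_zero, sub_neg_eq_add]
        exact mem (h.pos _ _ v1) (v := -(J 0 M * u 0 M))
          (by rw [norm_neg, norm_mul, norm_of_sq hJ, hu, one_mul]) (by rw [a1]; ring)
      · simp only [sub_zero, sub_neg_eq_add]
        exact mem (h.pos _ _ v2) (v := J 0 M * u 0 M)
          (by rw [norm_mul, norm_of_sq hJ, hu, one_mul]) (by rw [a2]; ring)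
  refine ⟨J 0 0, g, u, (H 0 0 (by norm_num) le_rfl).1, ⟨?_, ?_, ?_, ?_, ?_⟩⟩
  · exact fun N M h1 h2 => (H N M h1 h2).2.1
  · exact fun N M h1 h2 => (H N M (by omega) h2).2.2.1 h1
  · intro N M h1 h2
    rw [← hconst N M h1 (by omega)]
    exact (H N M h1 (by omega)).2.2.2.1 h2
  · exact fun N M h1 h2 => (H N M h1 h2).2.2.2.2.1
  · intro N M h1 h2
    rw [← hconst N M h1 h2]
    exact (H N M h1 h2).2.2.2.2.2

end IsImmersedPattern

/-! ### Uniqueness -/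

section
variable {J : ℂ} {R : ℤ → ℤ → ℝ} {c g u c' g' u' : ℤ → ℤ → ℂ}

lemma IsCrossField.conj (hJ : J * J = -1) (h : IsCrossField J R c g u) :
    IsCrossField (-J) R (fun N M => (starRingEnd ℂ) (c N M)) (fun N M => (starRingEnd ℂ) (g N M))
      (fun N M => (starRingEnd ℂ) (u N M)) where
  norm N M h1 h2 := by rw [RCLike.norm_conj, h.norm N M h1 h2]
  base N M h1 h2 := by simp [h.base N M h1 h2]
  right N M h1 h2 := by simp [h.right N M h1 h2, conj_of_sq hJ]
  diag N M h1 h2 := by simp [h.diag N M h1 h2]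
  top N M h1 h2 := by simp [h.top N M h1 h2, conj_of_sq hJ]

/-- The radii and `J` determine the ratio of neighbouring directions, so `u' / u` is a constant `ζ`
of modulus one; then `g' - ζ g` is constant as well. -/
lemma IsCrossField.exists_rotation (hJ : J * J = -1) (hR : ∀ N M, 0 < R N M)
    (h : IsCrossField J R c g u) (h' : IsCrossField J R c' g' u') :
    ∃ g : ℂ ≃ᵢ ℂ, ∀ N M : ℤ, InV N M → c' N M = g (c N M) := by
  have d := h.isDirection
  have d' := h'.isDirection
  have hu : ∀ N M : ℤ, -M - 1 ≤ N → N ≤ M → u' N M / u N M = u' 0 0 / u 0 0 := by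
    refine fun N M => const_of_adj (F := fun N M => u' N M / u N M) ?_ ?_ N M
    · intro N M h1 h2
      have e := d.vert N M h1 h2
      have e' := d'.vert N M h1 h2
      rw [div_eq_div_iff (h.u_ne_zero (by omega) (by omega)) (h.u_ne_zero (by omega) (by omega))]
      have n1 := add_mul_ne_zero hJ (hR N (M + 1)).ne' (R N M)
      refine mul_right_cancel₀ n1 ?_
      linear_combination u N M * e' - u' N M * e
    · intro M hM
      have e := d.horiz 0 M (by omega) (by omega)
      have e' := d'.horiz 0 M (by omega) (by omega)
      rw [div_eq_div_iff (h.u_ne_zero (by omega) (by omega)) (h.u_ne_zero (by omega) (by omega))]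
      have n1 := sub_mul_ne_zero hJ (hR (0 + 1) M).ne' (R 0 M)
      refine mul_right_cancel₀ n1 ?_
      linear_combination u 0 M * e' - u' 0 M * e
  set ζ := u' 0 0 / u 0 0 with hζ
  have hζ1 : ‖ζ‖ = 1 := by
    rw [hζ, norm_div, h.norm 0 0 (by norm_num) le_rfl, h'.norm 0 0 (by norm_num) le_rfl, div_one]
  have hu' : ∀ N M : ℤ, -M - 1 ≤ N → N ≤ M → u' N M = ζ * u N M := by
    intro N M h1 h2
    rw [← hu N M h1 h2, div_mul_cancel₀ _ (h.u_ne_zero h1 h2)]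
  have hg : ∀ N M : ℤ, -M - 1 ≤ N → N ≤ M → g' N M - ζ * g N M = g' 0 0 - ζ * g 0 0 := by
    refine fun N M => const_of_adj (F := fun N M => g' N M - ζ * g N M) ?_ ?_ N M
    · intro N M h1 h2
      have e1 := h.base N M h1 h2
      have e2 := h.right (N - 1) M (by omega) (by omega)
      have e3 := h'.base N M h1 h2
      have e4 := h'.right (N - 1) M (by omega) (by omega)
      rw [sub_add_cancel] at e2 e4
      rw [hu' _ _ (by omega) h2] at e3
      rw [hu' _ _ (by omega) (by omega)] at e4
      linear_combination ζ * (e2 - e1) + e3 - e4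
    · intro M hM
      have e1 := h.base 0 M (by omega) (by omega)
      have e2 := h.top 0 (M - 1) (by omega) (by omega)
      have e3 := h'.base 0 M (by omega) (by omega)
      have e4 := h'.top 0 (M - 1) (by omega) (by omega)
      rw [sub_add_cancel] at e2 e4
      rw [hu' _ _ (by omega) (by omega)] at e3
      rw [hu' _ _ (by omega) (by omega)] at e4
      linear_combination ζ * (e2 - e1) + e3 - e4
  refine ⟨(rotation ⟨ζ, by simpa [Submonoid.unitSphere] using hζ1⟩).toIsometryEquiv.trans
    (IsometryEquiv.addRight (g' 0 0 - ζ * g 0 0)), fun N M hV => ?_⟩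
  rw [inV_iff] at hV
  have e1 := h.base N M hV.1 hV.2
  have e2 := h'.base N M hV.1 hV.2
  have e3 := hg N M (by omega) hV.2
  rw [hu' _ _ (by omega) hV.2] at e2
  have : c' N M = ζ * c N M + (g' 0 0 - ζ * g 0 0) := by linear_combination e2 - ζ * e1 + e3
  exact this

lemma IsImmersedPattern.exists_isometry (hR : ∀ N M, 0 < R N M) (h : IsImmersedPattern c R)
    (h' : IsImmersedPattern c' R) :
    ∃ g : ℂ ≃ᵢ ℂ, ∀ N M : ℤ, InV N M → c' N M = g (c N M) := by
  obtain ⟨J, g, u, hJ, k⟩ := h.exists_isCrossField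
  obtain ⟨J', g', u', hJ', k'⟩ := h'.exists_isCrossField
  have : J' = J ∨ J' = -J := by
    rcases eq_I_or_neg_I hJ with rfl | rfl <;> rcases eq_I_or_neg_I hJ' with rfl | rfl <;> simp
  rcases this with rfl | rfl
  · exact k.exists_rotation hJ hR k'
  -- For opposite orientations, complex conjugation is applied first.
  · obtain ⟨T, hT⟩ := (k.conj hJ).exists_rotation hJ' hR k'
    exact ⟨conjLIE.toIsometryEquiv.trans T, fun N M hV => hT N M hV⟩

end

/-! ### From a discrete conformal map to the radii -/

/-- The constraint along a boundary line. -/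
lemma boundary_steps {γ : ℝ} {x : ℤ → ℂ} (h0 : x 0 = 0) (hne : ∀ n : ℤ, 0 ≤ n → x n ≠ x (n + 1))
    (hc : ∀ n : ℤ, 0 < n → x (n + 1) - x (n - 1) ≠ 0 ∧ (γ : ℂ) * x n =
      2 * (n : ℂ) * (((x (n + 1) - x n) * (x n - x (n - 1))) / (x (n + 1) - x (n - 1)))) (k : ℕ) :
    (γ : ℂ) * x (2 * k) = 2 * k * (x (2 * k + 1) - x (2 * k)) ∧
    x (2 * k + 3) - x (2 * k + 2) = x (2 * k + 2) - x (2 * k + 1) ∧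
    ∃ s : ℝ, x (2 * k + 2) - x (2 * k + 1) = s * (x (2 * k + 1) - x (2 * k)) := by
  have hc' : ∀ n : ℤ, 0 < n → γ * x n * (x (n + 1) - x (n - 1)) =
      2 * n * ((x (n + 1) - x n) * (x n - x (n - 1))) := by
    intro n hn
    obtain ⟨h1, h2⟩ := hc n hn
    rw [h2]
    field_simp
  -- The relation at `2 k` lets a step be cancelled in the constraint at `2 k + 1`, which gives the
  -- ratio of the two steps there. This yields the relation at `2 k + 2`, and then the constraint
  -- there makes its two steps equal.
  have key : ∀ k : ℕ, (γ : ℂ) * x (2 * k) = 2 * k * (x (2 * k + 1) - x (2 * k)) →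
      ((2 * k + γ) * (x (2 * k + 1) - x (2 * k)) =
        (2 * k + 2 - γ) * (x (2 * k + 2) - x (2 * k + 1))) ∧
      x (2 * k + 3) - x (2 * k + 2) = x (2 * k + 2) - x (2 * k + 1) ∧
      (γ : ℂ) * x (2 * k + 2) = (2 * k + 2) * (x (2 * k + 3) - x (2 * k + 2)) := by
    intro k hk
    have e1 := hc' (2 * k + 1) (by omega)
    have e2 := hc' (2 * k + 2) (by omega)
    rw [add_sub_cancel_right, show (2 * k + 1 + 1 : ℤ) = 2 * k + 2 by ring] at e1
    rw [show (2 * k + 2 + 1 : ℤ) = 2 * k + 3 by ring, show (2 * k + 2 - 1 : ℤ) = 2 * k + 1 by ring] at e2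
    have n1 : x (2 * k + 1) - x (2 * k) ≠ 0 := sub_ne_zero.2 (hne _ (by omega)).symm
    have n2 : x (2 * k + 2) - x (2 * k + 1) ≠ 0 := by
      have := hne (2 * k + 1) (by omega)
      rw [show (2 * k + 1 + 1 : ℤ) = 2 * k + 2 by ring] at this
      exact sub_ne_zero.2 this.symm
    have hk0 : (2 * (k : ℂ) + 2) ≠ 0 := by norm_cast
    push_cast at e1 e2
    have s1 : (2 * k + γ) * (x (2 * k + 1) - x (2 * k)) =
        (2 * k + 2 - γ) * (x (2 * k + 2) - x (2 * k + 1)) := by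
      refine mul_left_cancel₀ n1 ?_
      linear_combination e1 - (x (2 * k + 2) - x (2 * k)) * hk
    have s2 : (γ : ℂ) * x (2 * k + 2) = (2 * k + 2) * (x (2 * k + 2) - x (2 * k + 1)) := by
      linear_combination hk + s1
    have s3 : x (2 * k + 3) - x (2 * k + 2) = x (2 * k + 2) - x (2 * k + 1) := by
      refine mul_left_cancel₀ (mul_ne_zero hk0 n2) ?_
      linear_combination (x (2 * k + 3) - x (2 * k + 1)) * s2 - e2
    exact ⟨s1, s3, by rw [s3, s2]⟩
  have main : ∀ k : ℕ, (γ : ℂ) * x (2 * k) = 2 * k * (x (2 * k + 1) - x (2 * k)) := by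
    intro k
    induction k with
    | zero => simp [h0]
    | succ k ih =>
      have := (key k ih).2.2
      push_cast
      rw [show (2 * ((k : ℤ) + 1)) = 2 * k + 2 by ring, show (2 * (k : ℤ) + 2 + 1) = 2 * k + 3 by ring,
        this]
      ring
  refine ⟨main k, (key k (main k)).2.1, (2 * k + γ) / (2 * k + 2 - γ), ?_⟩
  have s1 := (key k (main k)).1
  have n1 : x (2 * k + 1) - x (2 * k) ≠ 0 := sub_ne_zero.2 (hne _ (by omega)).symm
  -- If `γ = 2 k + 2`, the step relation would also give `γ = -2 k`, hence `4 k + 2 = 0`.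
  have hd : (2 * (k : ℂ) + 2 - γ) ≠ 0 := by
    intro hd
    rw [hd, zero_mul] at s1
    have := (mul_eq_zero.1 s1).resolve_right n1
    have h4 : (4 * (k : ℂ) + 2) = 0 := by linear_combination this + hd
    norm_cast at h4
  push_cast
  rw [div_mul_eq_mul_div, s1, mul_div_cancel_left₀ _ hd]

/-- `y` is perpendicular to `x`, and both are nonzero. -/
def Perp (x y : ℂ) : Prop := x ≠ 0 ∧ ∃ s : ℝ, s ≠ 0 ∧ y = I * s * x

/-- `y` is parallel to `x`, and both are nonzero. -/
def Para (x y : ℂ) : Prop := x ≠ 0 ∧ ∃ s : ℝ, s ≠ 0 ∧ y = s * x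

lemma Perp.right_ne {x y : ℂ} (h : Perp x y) : y ≠ 0 := by
  obtain ⟨hx, s, hs, rfl⟩ := h
  have : (s : ℂ) ≠ 0 := by exact_mod_cast hs
  simp [hx, this]

lemma Perp.symm {x y : ℂ} (h : Perp x y) : Perp y x := by
  refine ⟨h.right_ne, ?_⟩
  obtain ⟨hx, s, hs, rfl⟩ := h
  refine ⟨-s⁻¹, by simpa using hs, ?_⟩
  have : (s : ℂ) ≠ 0 := by exact_mod_cast hs
  push_cast
  field_simp
  linear_combination I_sq

lemma Perp.trans {x y z : ℂ} (h : Perp x y) (h' : Perp y z) : Para x z := by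
  obtain ⟨hx, s, hs, rfl⟩ := h
  obtain ⟨-, t, ht, rfl⟩ := h'
  refine ⟨hx, -(t * s), by simp [hs, ht], ?_⟩
  push_cast
  linear_combination (t * s * x : ℂ) * I_mul_I

lemma Para.trans_perp {x y z : ℂ} (h : Para x y) (h' : Perp y z) : Perp x z := by
  obtain ⟨hx, s, hs, rfl⟩ := h
  obtain ⟨-, t, ht, rfl⟩ := h'
  exact ⟨hx, t * s, by simp [hs, ht], by push_cast; ring⟩

lemma Para.symm {x y : ℂ} (h : Para x y) : Para y x := by
  obtain ⟨hx, s, hs, rfl⟩ := h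
  have : (s : ℂ) ≠ 0 := by exact_mod_cast hs
  exact ⟨by simp [hx, this], s⁻¹, by simpa using hs, by push_cast; field_simp⟩

lemma Perp.of_sq {J x y : ℂ} (hJ : J * J = -1) {t : ℝ} (hx : x ≠ 0) (ht : t ≠ 0)
    (h : y = J * t * x) : Perp x y := by
  rcases eq_I_or_neg_I hJ with rfl | rfl
  · exact ⟨hx, t, ht, h⟩
  · exact ⟨hx, -t, by simpa using ht, by rw [h]; push_cast; ring⟩

lemma Kite.perp {J A B C D : ℂ} (hJ : J * J = -1) (h : Kite J A B C D) : Perp (A - B) (C - B) := by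
  obtain ⟨hAB, t, ht, h1, -⟩ := h
  exact .of_sq (J := -J) (by linear_combination hJ) (sub_ne_zero.2 hAB) ht.ne'
    (by rw [h1]; ring)

lemma Kite.perp' {J A B C D : ℂ} (hJ : J * J = -1) (h : Kite J A B C D) : Perp (A - D) (C - D) :=
  (h.swap hJ).perp (by linear_combination hJ)

lemma Kite.norm_right {J A B C D : ℂ} (hJ : J * J = -1) (h : Kite J A B C D) :
    ‖B - C‖ = ‖D - C‖ := ((h.rot hJ).norm_left hJ).symm

/-! ### Kites forced by the cross-ratio -/

section
variable {A B C D : ℂ}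

lemma exists_kite {τ : ℂ} (hτ : τ.re = 0) (hAB : A ≠ B) (hBC : B ≠ C) (h1 : C - B = τ * (B - A))
    (h2 : C - D = -(τ * (D - A))) : ∃ J, J * J = -1 ∧ Kite J A B C D := by
  have hτ' : τ = I * τ.im := by apply Complex.ext <;> simp [hτ]
  have him : τ.im ≠ 0 := by
    intro h0
    rw [hτ', h0] at h1
    apply hBC
    simp only [ofReal_zero, mul_zero, zero_mul] at h1
    exact (sub_eq_zero.1 h1).symm
  rcases him.lt_or_gt with h | h
  · refine ⟨-I, by simp, hAB, -τ.im, by linarith, ?_, ?_⟩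
    · rw [h1, hτ']; simp
    · rw [h2, hτ']; simp
  · refine ⟨I, by simp, hAB, τ.im, h, ?_, ?_⟩
    · rw [h1, ← hτ']
    · rw [h2, ← hτ']

variable (hq : ((A - B) * (C - D)) / ((B - C) * (D - A)) = -1)
include hq

lemma edges_ne : A ≠ B ∧ B ≠ C ∧ C ≠ D ∧ D ≠ A := by
  refine ⟨?_, ?_, ?_, ?_⟩ <;> rintro rfl <;> simp at hq

lemma crossRatio_mul : (A - B) * (C - D) = -((B - C) * (D - A)) := by
  obtain ⟨-, h2, -, h4⟩ := edges_ne hq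
  rw [div_eq_iff (mul_ne_zero (sub_ne_zero.2 h2) (sub_ne_zero.2 h4))] at hq
  linear_combination hq

/-- For `τ = (C - B) / (B - A)` the cross-ratio gives `C - D = -τ (D - A)`, hence `(1 + τ) (B - A) =
(1 - τ) (D - A)`. Equal edges at `A` mean `|1 + τ| = |1 - τ|`, so `τ` is imaginary. -/
lemma exists_kite_of_norm_eq (h : ‖B - A‖ = ‖D - A‖) : ∃ J, J * J = -1 ∧ Kite J A B C D := by
  obtain ⟨h1, h2, -, h4⟩ := edges_ne hq
  have hm := crossRatio_mul hq
  have hBA := sub_ne_zero.2 h1.symm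
  obtain ⟨τ, hτ⟩ : ∃ τ, C - B = τ * (B - A) := ⟨(C - B) / (B - A), by field_simp⟩
  have hτ2 : C - D = -(τ * (D - A)) := by
    refine mul_left_cancel₀ hBA ?_
    linear_combination -hm + (D - A) * (-hτ)
  refine exists_kite ?_ h1 h2 hτ hτ2
  have e : (1 + τ) * (B - A) = (1 - τ) * (D - A) := by linear_combination hτ2 - hτ
  have e' := congrArg norm e
  rw [norm_mul, norm_mul, ← h] at e'
  have e2 := mul_right_cancel₀ (norm_ne_zero_iff.2 hBA) e'
  have e3 := congrArg (· ^ 2) e2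
  simp only [← normSq_eq_norm_sq, normSq_apply] at e3
  simp at e3
  linarith

/-- A right angle at `A` is carried by the cross-ratio to the opposite vertex `C`, so the axis of
the kite is `B D`. -/
lemma exists_kite_of_perp (h : Perp (B - A) (D - A)) : ∃ J, J * J = -1 ∧ Kite J B C D A := by
  obtain ⟨h1, h2, h3, h4⟩ := edges_ne hq
  have hm := crossRatio_mul hq
  obtain ⟨hBA, s, hs, e⟩ := h
  refine exists_kite (τ := I * s) (by simp) h2 h3 ?_ (by rw [e]; ring)
  refine mul_left_cancel₀ hBA ?_
  linear_combination hm + (C - B) * e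

end

/-! ### Induction over the quadrant: every quadrilateral is a kite -/

section
variable {f : ℤ → ℤ → ℂ} (hf : IsDiscreteConformal f)
include hf

lemma exists_quadKite_of_norm_eq {n m : ℤ} (hn : 0 ≤ n) (hm : 0 ≤ m) (he : Even (n + m))
    (h : ‖f (n + 1) m - f n m‖ = ‖f n (m + 1) - f n m‖) : ∃ J, J * J = -1 ∧ QuadKite J f n m := by
  obtain ⟨J, hJ, k⟩ := exists_kite_of_norm_eq (hf n m hn hm) h
  exact ⟨J, hJ, fun _ => k, fun h => absurd he h⟩

lemma exists_quadKite_of_perp {n m : ℤ} (hn : 0 ≤ n) (hm : 0 ≤ m) (he : ¬ Even (n + m))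
    (h : Perp (f (n + 1) m - f n m) (f n (m + 1) - f n m)) : ∃ J, J * J = -1 ∧ QuadKite J f n m := by
  obtain ⟨J, hJ, k⟩ := exists_kite_of_perp (hf n m hn hm) h
  exact ⟨J, hJ, fun h => absurd h he, fun _ => k⟩

/-- Three kites around an inner point force the fourth. -/
lemma exists_quadKite_succ_succ {n m : ℤ} (hn : 0 ≤ n) (hm : 0 ≤ m)
    (h1 : ∃ J, J * J = -1 ∧ QuadKite J f n (m + 1)) (h2 : ∃ J, J * J = -1 ∧ QuadKite J f (n + 1) m)
    (h3 : ∃ J, J * J = -1 ∧ QuadKite J f n m) :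
    ∃ J, J * J = -1 ∧ QuadKite J f (n + 1) (m + 1) := by
  obtain ⟨J₁, hJ₁, k1⟩ := h1
  obtain ⟨J₂, hJ₂, k2⟩ := h2
  obtain ⟨J₃, hJ₃, k3⟩ := h3
  by_cases he : Even (n + m)
  · refine exists_quadKite_of_norm_eq hf (by omega) (by omega) (by grind) ?_
    rw [(k2.2 (by grind)).norm_right hJ₂, (k3.1 he).norm_right hJ₃, (k1.2 (by grind)).norm_left hJ₁]
  · refine exists_quadKite_of_perp hf (by omega) (by omega) (by grind) ?_
    exact (((k2.1 (by grind)).perp' hJ₂).symm.trans ((k3.2 he).perp hJ₃)).trans_perp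
      ((k1.1 (by grind)).perp hJ₁)

end

lemma Para.of_steps {x y z : ℂ} {s : ℝ} (hxy : x ≠ y) (hyz : y ≠ z) (h : z - y = s * (y - x)) :
    Para (x - y) (z - y) := by
  refine ⟨sub_ne_zero.2 hxy, -s, ?_, by rw [h]; push_cast; ring⟩
  rw [neg_ne_zero]
  rintro rfl
  apply hyz
  rw [ofReal_zero, zero_mul] at h
  exact (sub_eq_zero.1 h).symm

section
variable {γ : ℝ} {f : ℤ → ℤ → ℂ} (hf : IsDiscreteConformal f) (hc : SatisfiesConstraint γ f)
  (h0 : f 0 0 = 0)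
include hf hc h0

/-- At the common boundary vertex `boundary_steps` carries the property over: at an odd vertex the
steps are parallel, so the right angle passes to the next quadrilateral; at an even vertex the steps
are equal, so the equality of edges does. -/
lemma exists_quadKite_succ_zero {n : ℕ} (h : ∃ J, J * J = -1 ∧ QuadKite J f n 0) :
    ∃ J, J * J = -1 ∧ QuadKite J f (n + 1) 0 := by
  have hne : ∀ n : ℤ, 0 ≤ n → f n 0 ≠ f (n + 1) 0 := fun n hn => (edges_ne (hf n 0 hn le_rfl)).1
  have row := boundary_steps (γ := γ) (x := fun n => f n 0) h0 hne (fun n hn => by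
    obtain ⟨a, -, b⟩ := hc n 0 hn.le le_rfl
    exact ⟨a hn.ne', by simpa using b⟩)
  obtain ⟨J, hJ, k⟩ := h
  rcases Nat.even_or_odd' n with ⟨j, rfl | rfl⟩
  · refine exists_quadKite_of_perp hf (by omega) le_rfl (by grind) ?_
    have k := (k.1 (by simp)).perp hJ
    obtain ⟨s, hs⟩ := (row j).2.2
    have n2 := hne (2 * j + 1) (by omega)
    rw [show (2 * (j : ℤ) + 1 + 1) = 2 * j + 2 by ring] at n2
    have := Para.of_steps (hne (2 * j) (by omega)) n2 hs
    push_cast at *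
    rw [show (2 * (j : ℤ) + 1 + 1) = 2 * j + 2 by ring]
    exact this.symm.trans_perp k
  · refine exists_quadKite_of_norm_eq hf (by omega) le_rfl (by grind) ?_
    have k := (k.2 (by simp)).norm_left hJ
    have hs := (row j).2.1
    push_cast at *
    rw [k, show (2 * (j : ℤ) + 1 + 1) = 2 * j + 2 by ring,
      show (2 * (j : ℤ) + 2 + 1) = 2 * j + 3 by ring, hs, norm_sub_rev]

lemma exists_quadKite_zero_succ {m : ℕ} (h : ∃ J, J * J = -1 ∧ QuadKite J f 0 m) :
    ∃ J, J * J = -1 ∧ QuadKite J f 0 (m + 1) := by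
  have hne : ∀ m : ℤ, 0 ≤ m → f 0 m ≠ f 0 (m + 1) :=
    fun m hm => (edges_ne (hf 0 m le_rfl hm)).2.2.2.symm
  have col := boundary_steps (γ := γ) (x := fun m => f 0 m) h0 hne (fun m hm => by
    obtain ⟨-, a, b⟩ := hc 0 m le_rfl hm.le
    exact ⟨a hm.ne', by simpa using b⟩)
  obtain ⟨J, hJ, k⟩ := h
  rcases Nat.even_or_odd' m with ⟨j, rfl | rfl⟩
  · refine exists_quadKite_of_perp hf le_rfl (by omega) (by grind) ?_
    have k := (k.1 (by simp)).perp' hJ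
    obtain ⟨s, hs⟩ := (col j).2.2
    have n2 := hne (2 * j + 1) (by omega)
    rw [show (2 * (j : ℤ) + 1 + 1) = 2 * j + 2 by ring] at n2
    have := Para.of_steps (hne (2 * j) (by omega)) n2 hs
    push_cast at *
    rw [show (2 * (j : ℤ) + 1 + 1) = 2 * j + 2 by ring]
    exact (this.symm.trans_perp k).symm
  · refine exists_quadKite_of_norm_eq hf le_rfl (by omega) (by grind) ?_
    have k := (k.2 (by simp)).norm_right hJ
    have hs := (col j).2.1
    push_cast at *
    rw [k, show (2 * (j : ℤ) + 1 + 1) = 2 * j + 2 by ring,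
      show (2 * (j : ℤ) + 2 + 1) = 2 * j + 3 by ring, hs, norm_sub_rev]

lemma exists_quadKite (h1 : ‖f 1 0‖ = ‖f 0 1‖) (n m : ℕ) : ∃ J, J * J = -1 ∧ QuadKite J f n m := by
  induction n generalizing m with
  | zero =>
    induction m with
    | zero => exact exists_quadKite_of_norm_eq hf le_rfl le_rfl (by simp) (by simpa [h0] using h1)
    | succ m ih => exact_mod_cast exists_quadKite_zero_succ hf hc h0 ih
  | succ n ihn =>
    induction m with
    | zero => exact_mod_cast exists_quadKite_succ_zero hf hc h0 (ihn 0)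
    | succ m ih =>
      exact_mod_cast exists_quadKite_succ_succ hf (by omega) (by omega) (ihn (m + 1)) ih (ihn m)

/-- The elementary quadrilaterals of `f` are right kites of the same orientation. -/
lemma IsImmersion.exists_isKiteMap_of_constraint (hi : IsImmersion f) (h1 : ‖f 1 0‖ = ‖f 0 1‖) :
    ∃ J, J * J = -1 ∧ IsKiteMap J f := by
  refine hi.exists_isKiteMap fun n m hn hm => ?_
  obtain ⟨n, rfl⟩ := Int.eq_ofNat_of_zero_le hn
  obtain ⟨m, rfl⟩ := Int.eq_ofNat_of_zero_le hm
  exact exists_quadKite hf hc h0 h1 n m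

end

lemma IsKiteMap.norm_eq {J : ℂ} (hJ : J * J = -1) {f : ℤ → ℤ → ℂ} (h : IsKiteMap J f) {n m : ℤ}
    (hn : 0 ≤ n) (hm : 0 ≤ m) (he : Even (n + m)) :
    ‖f n m - f (n + 1) m‖ = ‖f n m - f n (m + 1)‖ ∧
    (1 ≤ n → ‖f n m - f (n + 1) m‖ = ‖f n m - f (n - 1) m‖) ∧
    (1 ≤ m → ‖f n m - f (n + 1) m‖ = ‖f n m - f n (m - 1)‖) := by
  have e1 := ((h n m hn hm).1 he).norm_left hJ
  rw [norm_sub_rev, norm_sub_rev (f n (m + 1))] at e1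
  refine ⟨e1, fun hn' => ?_, fun hm' => ?_⟩
  · have e2 := ((h (n - 1) m (by omega) hm).2 (by grind)).norm_left hJ
    rw [sub_add_cancel, norm_sub_rev, norm_sub_rev (f (n - 1) m)] at e2
    rw [e1, e2]
  · have e2 := ((h n (m - 1) hn (by omega)).2 (by grind)).norm_right hJ
    rw [sub_add_cancel, norm_sub_rev, norm_sub_rev (f n (m - 1))] at e2
    rw [e2]

/-- The four directions at an odd point of a map that consists of kites. -/
lemma IsKiteMap.cross {J : ℂ} (hJ : J * J = -1) {f : ℤ → ℤ → ℂ} (h : IsKiteMap J f) {a b : ℤ}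
    (ha : 0 ≤ a) (hb : 0 ≤ b) (he : ¬ Even (a + b)) {r₀ r₁ r₂ r₃ : ℝ} (p0 : 0 < r₀) (p1 : 0 < r₁)
    (p2 : 0 < r₂) (p3 : 0 < r₃)
    (n3 : ‖f (a + 1) b - f a b‖ = r₃) (n2 : ‖f a (b + 1) - f a b‖ = r₂)
    (n0 : 1 ≤ a → ‖f (a - 1) b - f a b‖ = r₀) (n1 : 1 ≤ b → ‖f a (b - 1) - f a b‖ = r₁) :
    ∃ u : ℂ, ‖u‖ = 1 ∧ f (a + 1) b = f a b + r₃ * u ∧ f a (b + 1) = f a b + J * r₂ * u ∧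
      (1 ≤ a → f (a - 1) b = f a b - r₀ * u) ∧ (1 ≤ b → f a (b - 1) = f a b - J * r₁ * u) := by
  have hJ0 := ne_zero_of_sq hJ
  have p3' : (r₃ : ℂ) ≠ 0 := by exact_mod_cast p3.ne'
  obtain ⟨u, hu3⟩ : ∃ u, f (a + 1) b = f a b + r₃ * u :=
    ⟨(f (a + 1) b - f a b) / r₃, by field_simp; ring⟩
  have hu : ‖u‖ = 1 := by
    rw [hu3, add_sub_cancel_left, norm_mul, norm_real, Real.norm_of_nonneg p3.le] at n3
    exact mul_left_cancel₀ p3.ne' (by rw [n3, mul_one])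
  have scale : ∀ {r s : ℝ} {v w : ℂ}, ‖v‖ = 1 → 0 < r → 0 ≤ s → w = s * v → ‖w‖ = r → w = r * v := by
    intro r s v w hv hr hs hw hn
    rw [hw, norm_mul, hv, mul_one, norm_real, Real.norm_of_nonneg hs] at hn
    rw [hw, hn]
  have hJu : ‖J * u‖ = 1 := by rw [norm_mul, norm_of_sq hJ, hu, one_mul]
  have hu2 : f a (b + 1) = f a b + J * r₂ * u := by
    obtain ⟨-, t, ht, -, k⟩ := (h a b ha hb).2 he
    have := scale (w := f a (b + 1) - f a b) hJu p2 (s := t * r₃) (by positivity)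
      (by rw [k, hu3]; push_cast; ring) n2
    linear_combination this
  refine ⟨u, hu, hu3, hu2, fun ha' => ?_, fun hb' => ?_⟩
  · obtain ⟨-, t, ht, k, -⟩ := (h (a - 1) b (by omega) hb).1 (by grind)
    rw [sub_add_cancel, hu2] at k
    have ht' : (t : ℂ) ≠ 0 := by exact_mod_cast ht.ne'
    have := scale (w := f a b - f (a - 1) b) hu p0 (s := r₂ / t) (by positivity)
      (by
        refine mul_left_cancel₀ (mul_ne_zero hJ0 ht') ?_
        have e : (t : ℂ) * ((r₂ / t : ℝ) : ℂ) = r₂ := by push_cast; field_simp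
        linear_combination -k - J * u * e) (by rw [norm_sub_rev, n0 ha'])
    linear_combination -this
  · obtain ⟨-, t, ht, -, k⟩ := (h a (b - 1) ha (by omega)).1 (by grind)
    rw [sub_add_cancel, hu3] at k
    have ht' : (t : ℂ) ≠ 0 := by exact_mod_cast ht.ne'
    have := scale (w := f a b - f a (b - 1)) hJu p1 (s := r₃ / t) (by positivity)
      (by
        refine mul_left_cancel₀ (mul_ne_zero hJ0 ht') ?_
        have e : (t : ℂ) * ((r₃ / t : ℝ) : ℂ) = r₃ := by push_cast; field_simp
        linear_combination k - J * J * u * e - r₃ * u * hJ) (by rw [norm_sub_rev, n1 hb'])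
    linear_combination -this

/-! ### The equations do not depend on the values outside of `V` -/

lemma squareExpr_right_boundary (γ : ℝ) (R : ℤ → ℤ → ℝ) (M : ℤ) : squareExpr γ R M M =
    (R (M + 1) M + R M (M + 1)) *
      (R (M + 1) (M + 1) * (2 * ((M : ℝ) + 1) - γ) - R M M * (2 * M + γ)) := by
  unfold squareExpr; ring

lemma squareExpr_left_boundary (γ : ℝ) (R : ℤ → ℤ → ℝ) (M : ℤ) : squareExpr γ R (-M - 1) M =
    (R (-M - 1) M + R (-M - 1 + 1) (M + 1)) *
      (R (-M - 1) (M + 1) * (2 * ((M : ℝ) + 1) - γ) - R (-M - 1 + 1) M * (2 * M + γ)) := by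
  unfold squareExpr; push_cast; ring

/-- On a boundary square the expression is a product in which the missing value enters only the
first factor. A positive extension makes that factor nonzero, so the second vanishes, and this
suffices for every extension. -/
lemma satisfiesSquare_of_pos {γ : ℝ} {R : ℤ → ℤ → ℝ} (hR : ∀ N M, 0 < R N M)
    (hsq : ∀ N M : ℤ, -M - 1 ≤ N → N ≤ M → squareExpr γ R N M = 0) : SatisfiesSquare γ R := by
  intro R' hR' N M hV
  have hR' : ∀ N M : ℤ, -M ≤ N → N ≤ M → R' N M = R N M := fun N M h1 h2 => hR' N M (inV_iff.2 ⟨h1, h2⟩)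
  obtain ⟨h1, h2⟩ := inVl_iff.1 hV
  have h := hsq N M h1 h2
  rcases h2.lt_or_eq with h2 | rfl
  · rcases h1.lt_or_eq with h1 | rfl
    · unfold squareExpr at *
      rwa [hR' N M (by omega) (by omega), hR' (N + 1) M (by omega) (by omega),
        hR' N (M + 1) (by omega) (by omega), hR' (N + 1) (M + 1) (by omega) (by omega)]
    · rw [squareExpr_left_boundary, mul_eq_zero,
        or_iff_right (add_pos (hR _ _) (hR _ _)).ne'] at h
      rw [squareExpr_left_boundary, hR' (-M - 1) (M + 1) (by omega) (by omega),
        hR' (-M - 1 + 1) M (by omega) (by omega), h, mul_zero]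
  · rw [squareExpr_right_boundary, mul_eq_zero,
      or_iff_right (add_pos (hR _ _) (hR _ _)).ne'] at h
    rw [squareExpr_right_boundary, hR' N N (by omega) (by omega),
      hR' (N + 1) (N + 1) (by omega) (by omega), h, mul_zero]

open Classical in
/-- The function that agrees with `R` on `V` and is `1` elsewhere. -/
noncomputable def extendOne (R : ℤ → ℤ → ℝ) (N M : ℤ) : ℝ := if InV N M then R N M else 1

lemma extendOne_of_inV {R : ℤ → ℤ → ℝ} {N M : ℤ} (h : InV N M) : extendOne R N M = R N M := if_pos h

lemma extendOne_pos {R : ℤ → ℤ → ℝ} (hR : ∀ N M, InV N M → 0 < R N M) (N M : ℤ) :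
    0 < extendOne R N M := by
  unfold extendOne
  split_ifs with h
  · exact hR N M h
  · exact one_pos

lemma starExpr_extendOne (R : ℤ → ℤ → ℝ) {N M : ℤ} (h1 : -M < N) (h2 : N < M) :
    starExpr (extendOne R) N M = starExpr R N M := by
  unfold starExpr
  rw [extendOne_of_inV (inV_iff.2 (by omega)), extendOne_of_inV (inV_iff.2 (by omega)),
    extendOne_of_inV (inV_iff.2 (by omega)), extendOne_of_inV (inV_iff.2 (by omega))]

/-- The equations are required for every extension of `R`, so in particular for the positive one
used in the algebra. -/
lemma SatisfiesSquare.squareExpr_extendOne {γ : ℝ} {R : ℤ → ℤ → ℝ} (h : SatisfiesSquare γ R)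
    (N M : ℤ) (h1 : -M - 1 ≤ N) (h2 : N ≤ M) : squareExpr γ (extendOne R) N M = 0 :=
  h _ (fun _ _ => extendOne_of_inV) N M (inVl_iff.2 ⟨h1, h2⟩)

lemma SatisfiesStar.rightEq_extendOne {R : ℤ → ℤ → ℝ} (hR : ∀ N M, InV N M → 0 < R N M)
    (h : SatisfiesStar R) (N M : ℤ) (h1 : -M < N) (h2 : N < M) : RightEq (extendOne R) N M := by
  rw [← starExpr_eq_zero_iff (extendOne_pos hR), starExpr_extendOne R h1 h2]
  exact h N M (inVint_iff.2 ⟨h1, h2⟩)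

lemma IsImmersedPattern.congr {c : ℤ → ℤ → ℂ} {R R' : ℤ → ℤ → ℝ} (h : IsImmersedPattern c R)
    (hR : ∀ N M, InV N M → R' N M = R N M) : IsImmersedPattern c R' where
  pos N M h1 := by rw [hR N M h1]; exact h.pos N M h1
  orthogonal N M N' M' h1 h2 := by rw [hR N M h1, hR N' M' h2]; exact h.orthogonal N M N' M' h1 h2
  tangent N M N' M' h1 h2 := by
    unfold circ; rw [hR N M h1, hR N' M' h2]; exact h.tangent N M N' M' h1 h2
  disjoint_discs N M N' M' h1 h2 := by
    rw [hR N M h1, hR N' M' h2]; exact h.disjoint_discs N M N' M' h1 h2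
  no_fold N M a b he h1 h2 h3 h4 := by
    unfold circ
    rw [hR _ _ h2, hR _ _ h3, hR _ _ h4]
    exact h.no_fold N M a b he h1 h2 h3 h4

lemma isMapOfPattern_congr {c : ℤ → ℤ → ℂ} {R R' : ℤ → ℤ → ℝ}
    (hR : ∀ N M, InV N M → R' N M = R N M) (f : ℤ → ℤ → ℂ) :
    IsMapOfPattern c R' f ↔ IsMapOfPattern c R f := by
  unfold IsMapOfPattern circ
  refine forall₃_congr fun N M h => ?_
  have h' := inV_iff.1 h
  rw [hR N M h, hR (N + 1) (M + 1) (inV_iff.2 (by omega)), hR (N - 1) (M + 1) (inV_iff.2 (by omega))]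

/-! ### The radii of a discrete conformal map -/

section
variable {f : ℤ → ℤ → ℂ}

/-- The distance between `f` at the lattice point with the label `N + iM` and at its right neighbour. -/
noncomputable def radius (f : ℤ → ℤ → ℂ) (N M : ℤ) : ℝ :=
  ‖f (N + M) (M - N) - f (N + M + 1) (M - N)‖

variable {J : ℂ} (hJ : J * J = -1) (h : IsKiteMap J f)
include hJ h

lemma IsKiteMap.ne_right {n m : ℤ} (hn : 0 ≤ n) (hm : 0 ≤ m) : f n m ≠ f (n + 1) m :=
  (edges_ne ((h n m hn hm).crossRatio hJ)).1

lemma IsKiteMap.radius_pos {N M : ℤ} (hV : InV N M) : 0 < radius f N M := by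
  rw [inV_iff] at hV
  exact norm_pos_iff.2 (sub_ne_zero.2 (h.ne_right hJ (by omega) (by omega)))

lemma IsKiteMap.isRadiusFunction : IsRadiusFunction f (radius f) := by
  intro N M hV
  obtain ⟨h1, h2, h3⟩ := h.norm_eq hJ (n := N + M) (m := M - N) (by rw [inV_iff] at hV; omega)
    (by rw [inV_iff] at hV; omega) ⟨M, by ring⟩
  exact ⟨h.radius_pos hJ hV, rfl, h1, h2, h3⟩

lemma IsKiteMap.exists_isCrossField : ∃ u : ℤ → ℤ → ℂ,
    IsCrossField J (extendOne (radius f)) (fun N M => f (N + M) (M - N))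
      (fun N M => f (N + M + 1) (M - N)) u := by
  have hr := h.isRadiusFunction hJ
  have hp := extendOne_pos fun N M hV => (hr N M hV).1
  have H : ∀ N M : ℤ, ∃ u : ℂ, -M - 1 ≤ N → N ≤ M → (‖u‖ = 1 ∧
      f (N + M + 1 + 1) (M - N) = f (N + M + 1) (M - N) + extendOne (radius f) (N + 1) (M + 1) * u ∧
      f (N + M + 1) (M - N + 1) = f (N + M + 1) (M - N) + J * extendOne (radius f) N (M + 1) * u ∧
      (1 ≤ N + M + 1 → f (N + M + 1 - 1) (M - N) =
        f (N + M + 1) (M - N) - extendOne (radius f) N M * u) ∧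
      (1 ≤ M - N → f (N + M + 1) (M - N - 1) =
        f (N + M + 1) (M - N) - J * extendOne (radius f) (N + 1) M * u)) := by
    intro N M
    by_cases hV : -M - 1 ≤ N ∧ N ≤ M
    · have n3 : ‖f (N + M + 1 + 1) (M - N) - f (N + M + 1) (M - N)‖ =
          extendOne (radius f) (N + 1) (M + 1) := by
        have := inV_iff.2 (show -(M + 1) ≤ N + 1 ∧ N + 1 ≤ M + 1 by omega)
        rw [extendOne_of_inV this, (hr _ _ this).2.2.2.1 (by omega)]
        congr 3 <;> ring
      have n2 : ‖f (N + M + 1) (M - N + 1) - f (N + M + 1) (M - N)‖ =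
          extendOne (radius f) N (M + 1) := by
        have := inV_iff.2 (show -(M + 1) ≤ N ∧ N ≤ M + 1 by omega)
        rw [extendOne_of_inV this, (hr _ _ this).2.2.2.2 (by omega)]
        congr 3 <;> ring
      have n0 : 1 ≤ N + M + 1 → ‖f (N + M + 1 - 1) (M - N) - f (N + M + 1) (M - N)‖ =
          extendOne (radius f) N M := by
        intro ha
        have := inV_iff.2 (show -M ≤ N ∧ N ≤ M by omega)
        rw [extendOne_of_inV this, (hr _ _ this).2.1, add_sub_cancel_right]
      have n1 : 1 ≤ M - N → ‖f (N + M + 1) (M - N - 1) - f (N + M + 1) (M - N)‖ =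
          extendOne (radius f) (N + 1) M := by
        intro hb
        have := inV_iff.2 (show -M ≤ N + 1 ∧ N + 1 ≤ M by omega)
        rw [extendOne_of_inV this, (hr _ _ this).2.2.1]
        congr 3 <;> ring
      obtain ⟨u, hu⟩ := h.cross hJ (by omega) (by omega)
        (by rw [Int.not_even_iff_odd]; exact ⟨M, by ring⟩) (hp N M) (hp (N + 1) M) (hp N (M + 1))
        (hp (N + 1) (M + 1)) n3 n2 n0 n1
      exact ⟨u, fun _ _ => hu⟩
    · exact ⟨0, fun a b => absurd ⟨a, b⟩ hV⟩
  choose u H using H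
  refine ⟨u, ?_, ?_, ?_, ?_, ?_⟩
  · exact fun N M h1 h2 => (H N M h1 h2).1
  · intro N M h1 h2
    have := (H N M (by omega) h2).2.2.2.1 (by omega)
    rwa [add_sub_cancel_right] at this
  · intro N M h1 h2
    have := (H N M h1 (by omega)).2.2.2.2 (by omega)
    rw [← this]
    congr 1 <;> ring
  · intro N M h1 h2
    rw [← (H N M h1 h2).2.1]
    congr 1 <;> ring
  · intro N M h1 h2
    rw [← (H N M h1 h2).2.2.1]
    congr 1 <;> ring

end

/-! ### The constraint gives the equations for the radii -/

section
variable {γ : ℝ} {J : ℂ} {R : ℤ → ℤ → ℝ} {c g u : ℤ → ℤ → ℂ} {f : ℤ → ℤ → ℂ} (hJ : J * J = -1)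
  (h : IsCrossField J R c g u) (hR : ∀ N M, 0 < R N M)
  (hc : ∀ N M : ℤ, -M ≤ N → N ≤ M → f (N + M) (M - N) = c N M)
  (hg : ∀ N M : ℤ, -M - 1 ≤ N → N ≤ M → f (N + M + 1) (M - N) = g N M)
  (hf : SatisfiesConstraint γ f)
include hJ h hR hc hg hf

lemma IsCrossField.phi_eq_of_constraint {N M : ℤ} (h1 : -M - 1 ≤ N) (h2 : N ≤ M) :
    phi J R u N M = γ * g N M := by
  rw [← (h.constraint_odd hJ hR hc hg h1 h2 rfl rfl).2.2, ← hg N M h1 h2]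
  exact (hf (N + M + 1) (M - N) (by omega) (by omega)).2.2.symm

lemma IsCrossField.psi_eq_of_constraint {N M : ℤ} (h1 : -M ≤ N) (h2 : N ≤ M) :
    psi J R u N M = γ * c N M := by
  rw [← (h.constraint_even hJ hR hc hg h1 h2 rfl rfl).2.2, ← hc N M h1 h2]
  exact (hf (N + M) (M - N) (by omega) (by omega)).2.2.symm

/-- The constraints at the two ends of the edge from `c N M` to `g N M` are subtracted; the edge
vector is `R N M * u N M`. -/
lemma IsCrossField.squareExpr_and_upEq {N M : ℤ} (h1 : -M ≤ N) (h2 : N ≤ M) :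
    squareExpr γ R N M = 0 ∧ UpEq R N M := by
  rw [← phi_sub_psi_eq_iff hR hJ γ (h.u_ne_zero (by omega) h2),
    h.phi_eq_of_constraint hJ hR hc hg hf (by omega) h2,
    h.psi_eq_of_constraint hJ hR hc hg hf h1 h2, h.base N M h1 h2]
  ring

lemma IsCrossField.squareExpr_eq_zero {N M : ℤ} (h1 : -M - 1 ≤ N) (h2 : N ≤ M) :
    squareExpr γ R N M = 0 := by
  by_cases hN : -M ≤ N
  · exact (h.squareExpr_and_upEq hJ hR hc hg hf hN h2).1
  -- Here `N = -M - 1`. The odd points `g (N + 1) M` and `g N M`, both next to the boundary center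
  -- `c (N + 1) M`, are compared instead.
  · by_cases hM : N + 1 ≤ M
    · obtain ⟨e1, e2⟩ := h.squareExpr_and_upEq hJ hR hc hg hf (N := N + 1) (M := M) (by omega) hM
      have := squareExpr_of_phi_sub_phi hR hJ γ (h.isDirection.vert (N + 1) M (by omega) hM) e1 e2
        (h.u_ne_zero (by omega) (by omega)) (by
          rw [add_sub_cancel_right, h.phi_eq_of_constraint hJ hR hc hg hf (by omega) hM,
            h.phi_eq_of_constraint hJ hR hc hg hf h1 h2]
          have b := h.base (N + 1) M (by omega) hM
          have r := h.right N M h1 hM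
          linear_combination γ * (r - b))
      rwa [add_sub_cancel_right] at this
    · omega

lemma IsCrossField.rightEq {N M : ℤ} (h1 : -M < N) (h2 : N < M) : RightEq R N M := by
  rw [← phi_sub_phi_horiz_iff hR hJ γ (h.isDirection.horiz N M (by omega) (by omega))
    (h.squareExpr_eq_zero hJ hR hc hg hf (by omega) (by omega))
    (h.squareExpr_eq_zero hJ hR hc hg hf (by omega) (by omega)) (h.u_ne_zero (by omega) (by omega)),
    h.phi_eq_of_constraint hJ hR hc hg hf (by omega) (by omega),
    h.phi_eq_of_constraint hJ hR hc hg hf (by omega) (by omega)]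
  have b := h.base N M (by omega) (by omega)
  have t := h.top N (M - 1) (by omega) (by omega)
  rw [sub_add_cancel] at t
  linear_combination γ * (t - b)

end

lemma SatisfiesSquare.congr {γ : ℝ} {R R' : ℤ → ℤ → ℝ} (h : SatisfiesSquare γ R)
    (hR : ∀ N M, InV N M → R N M = R' N M) : SatisfiesSquare γ R' :=
  fun S hS => h S fun N M hV => (hS N M hV).trans (hR N M hV).symm

/-- The radii of an immersed discrete conformal map that satisfies the constraint. -/
theorem exists_isRadiusFunction {γ : ℝ} {f : ℤ → ℤ → ℂ} (hf : IsDiscreteConformal f)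
    (hc : SatisfiesConstraint γ f) (h0 : f 0 0 = 0) (h1 : ‖f 1 0‖ = ‖f 0 1‖) (hi : IsImmersion f) :
    ∃ R : ℤ → ℤ → ℝ, IsRadiusFunction f R ∧ SatisfiesSquare γ R ∧ SatisfiesStar R := by
  obtain ⟨J, hJ, k⟩ := hi.exists_isKiteMap_of_constraint hf hc h0 h1
  obtain ⟨u, hu⟩ := k.exists_isCrossField hJ
  have hp := extendOne_pos fun N M hV => k.radius_pos hJ (N := N) (M := M) hV
  refine ⟨radius f, k.isRadiusFunction hJ, ?_, ?_⟩
  · exact (satisfiesSquare_of_pos hp fun N M h1 h2 => hu.squareExpr_eq_zero hJ hp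
      (fun _ _ _ _ => rfl) (fun _ _ _ _ => rfl) hc h1 h2).congr fun _ _ => extendOne_of_inV
  · intro N M hV
    obtain ⟨h1, h2⟩ := inVint_iff.1 hV
    rw [← starExpr_extendOne _ h1 h2, starExpr_eq_zero_iff hp]
    exact hu.rightEq hJ hp (fun _ _ _ _ => rfl) (fun _ _ _ _ => rfl) hc h1 h2

end SquareGridPattern

/-! ### Assembly of the two directions -/

theorem theorem3 (γ : ℝ) :
    (∀ (α : ℝ) (f : ℤ → ℤ → ℂ),
      IsDiscreteConformal f → SatisfiesConstraint γ f →
      f 0 0 = 0 → f 1 0 = 1 → f 0 1 = Complex.exp (Complex.I * (α : ℂ)) →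
      IsImmersion f →
      ∃ R : ℤ → ℤ → ℝ, IsRadiusFunction f R ∧ SatisfiesSquare γ R ∧ SatisfiesStar R) ∧
    (∀ R : ℤ → ℤ → ℝ,
      (∀ N M : ℤ, InV N M → 0 < R N M) → SatisfiesSquare γ R → SatisfiesStar R →
      (∃ c : ℤ → ℤ → ℂ, c 0 0 = 0 ∧ IsImmersedPattern c R) ∧
      (∀ c c' : ℤ → ℤ → ℂ, IsImmersedPattern c R → IsImmersedPattern c' R →
        ∃ g : ℂ ≃ᵢ ℂ, ∀ N M : ℤ, InV N M → c' N M = g (c N M)) ∧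
      (∀ c : ℤ → ℤ → ℂ, IsImmersedPattern c R →
        (∃ f : ℤ → ℤ → ℂ, IsMapOfPattern c R f) ∧
        (∀ f : ℤ → ℤ → ℂ, IsMapOfPattern c R f →
          IsDiscreteConformal f ∧ IsImmersion f ∧
          (c 0 0 = 0 → SatisfiesConstraint γ f)))) := by

  refine ⟨fun α f hf hc h00 h10 h01 hi => ?_, fun R hR hsq hst => ?_⟩
  · refine exists_isRadiusFunction hf hc h00 ?_ hi
    -- Of the normalization beyond `f 0 0 = 0`, only the equality of the moduli of `f 1 0` and `f 0
    -- 1` is used.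
    rw [h10, h01, mul_comm, Complex.norm_exp_ofReal_mul_I, norm_one]
  have hp := extendOne_pos hR
  have hext : ∀ N M : ℤ, InV N M → extendOne R N M = R N M := fun _ _ => extendOne_of_inV
  have hsq' := hsq.squareExpr_extendOne
  have hst' := hst.rightEq_extendOne hR
  refine ⟨?_, fun c c' h h' => (h.congr hext).exists_isometry hp (h'.congr hext), fun c h => ?_⟩
  · obtain ⟨c, g, h0, k⟩ := (isDirection_dir hp hsq' hst' Complex.I_mul_I).exists_isCrossField
      hp hsq' hst' Complex.I_mul_I
    exact ⟨c, h0, (k.isImmersedPattern Complex.I_mul_I hp).congr fun N M hV => (hext N M hV).symm⟩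
  · obtain ⟨J, g, u, hJ, k⟩ := (h.congr hext).exists_isCrossField
    constructor
    · obtain ⟨f, hc, hg⟩ := exists_map c g
      exact ⟨f, (isMapOfPattern_congr hext f).1 ((k.isMapOfPattern_iff hJ hp f).2
        ⟨fun N M _ _ => hc N M, fun N M _ _ => hg N M⟩)⟩
    · intro f hf
      obtain ⟨hc, hg⟩ := (k.isMapOfPattern_iff hJ hp f).1 ((isMapOfPattern_congr hext f).2 hf)
      have hk := k.isKiteMap hJ hp hc hg
      exact ⟨hk.isDiscreteConformal hJ, hk.isImmersion hJ,
        k.satisfiesConstraint hp hsq' hst' hJ hc hg⟩
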